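/- Rings are unital and homomorphisms preserve units. Let $\iota\colon N\to M$ be a ring homomorphism (a ring extension $M|N$). Assume that it has depth two: as an $N$-$M$-bimodule, $M\otimes_N M$ is isomorphic to a direct summand of $M^n$ for some $n\ge 1$, and, as an $M$-$N$-bimodule, to a direct summand of $M^m$ for some $m\ge 1$. Equivalently, with $R=C_M(N)$ the centralizer of $N$ in $M$, $A=\mathrm{End}({}_NM_N)$ and $B=(M\otimes_N M)^N$ (elements written $b=b^1\otimes b^2$), there are finitely many $b_i,c_i\in B$ and $\beta_i,\gamma_i\in A$ with $\sum_i b_i^1\otimes b_i^2\beta_i(m)=m\otimes 1$ and $\sum_i\gamma_i(m)c_i^1\otimes c_i^2=1\otimes m$ for all $m\in M$. Then $A$, with composition, is a left bialgebroid over $R$ with $s_A(r)(m)=rm$, $t_A(r)(m)=mr$, $\Delta_A(\alpha)=\sum_i\gamma_i\otimes_R c_i^1\alpha(c_i^2\,-)$, $\varepsilon_A(\alpha)=\alpha(1)$, with respect to the bimodule structure $r\cdot\alpha\cdot r'=s_A(r)t_A(r')\alpha$. Also $B$, with product $bb'=b'^1b^1\otimes b^2b'^2$ and unit $1\otimes 1$,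 is a right bialgebroid over $R$ with $s_B(r)=1\otimes r$, $t_B(r)=r\otimes 1$, $\Delta_B(b)=\sum_i b_i\otimes_R(\beta_i(b^1)\otimes b^2)$, $\varepsilon_B(b)=b^1b^2$, with respect to $r\cdot b\cdot r'=b\,t_B(r)s_B(r')$. The modules $A_R$ and ${}_RA$ are finitely generated projective, so that the following duals of $A$ are defined, and both are right bialgebroids over $R$: * the right dual $A^*=\mathrm{Hom}(A_R,R_R)$, with $\langle bb',a\rangle=\langle b',\langle b,a_{(1)}\rangle\cdot a_{(2)}\rangle$, unit $\varepsilon_A$, bimodule structure $\langle r\cdot b\cdot r',a\rangle=r\langle b,a\,t_A(r')\rangle$, source $r\mapsto 1\cdot r$, target $r\mapsto r\cdot 1$, coproduct determined by $\langle b_{(1)}\cdot\langle b_{(2)},a'\rangle,a\rangle=\langle b,aa'\rangle$, and counit $b\mapsto\langle b,1_A\rangle$; * the left dual ${}^*A=\mathrm{Hom}({}_RA,{}_RR)$, with $[a,bb']=[a_{(1)}\cdot[a_{(2)},b],b']$, unit $\varepsilon_A$, bimodule structure $[a,r\cdot b\cdot r']=[a\,s_A(r),b]\,r'$, source $r\mapsto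 1\cdot r$, target $r\mapsto r\cdot 1$, coproduct determined by $[a,[a',b_{(1)}]\cdot b_{(2)}]=[aa',b]$, and counit $b\mapsto[1_A,b]$. The map $\eta\colon B\to A^*$, $\eta(b)(\alpha)=b^1\alpha(b^2)$, is an isomorphism of bialgebroids over $R$ (a ring isomorphism compatible with source, target, coproduct and counit). The map $\psi\colon B\to{}^*A$, $\psi(b)(\alpha)=\alpha(b^1)b^2$, is also an isomorphism of bialgebroids over $R$. Thus $A$ and $B$ are dual bialgebroids: $A$ has a right dual and a left dual, and both are isomorphic to the right bialgebroid $B$. -/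

import Mathlib

open scoped TensorProduct

noncomputable section

namespace Bialgd

/-! ### Tensor products over a noncommutative ring -/

section BalTensor

variable {S X Y Z : Type*} [AddCommGroup X] [AddCommGroup Y] [AddCommGroup Z]

/-- The relations `(x · s) ⊗ y = x ⊗ (s · y)`, where `x · s = ρ s x` and `s · y = l s y`. -/
def balRel (ρ : S → X →+ X) (l : S → Y →+ Y) : AddSubgroup (X ⊗[ℤ] Y) :=
  AddSubgroup.closure {z | ∃ (x : X) (s : S) (y : Y), z = ρ s x ⊗ₜ[ℤ] y - x ⊗ₜ[ℤ] l s y}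

/-- The tensor product `X ⊗_S Y` of a right `S`-module `X` (with action `x · s = ρ s x`) and a left
`S`-module `Y` (with action `s · y = l s y`). -/
def BalTensor (ρ : S → X →+ X) (l : S → Y →+ Y) : Type _ := (X ⊗[ℤ] Y) ⧸ balRel ρ l

instance (ρ : S → X →+ X) (l : S → Y →+ Y) : AddCommGroup (BalTensor ρ l) :=
  inferInstanceAs (AddCommGroup ((X ⊗[ℤ] Y) ⧸ balRel ρ l))

namespace BalTensor

variable (ρ : S → X →+ X) (l : S → Y →+ Y)

/-- The pure tensor `x ⊗ y`. -/
def mk (x : X) (y : Y) : BalTensor ρ l := QuotientAddGroup.mk' (balRel ρ l) (x ⊗ₜ[ℤ] y)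

theorem mk_add_left (x x' : X) (y : Y) : mk ρ l (x + x') y = mk ρ l x y + mk ρ l x' y := by
  unfold mk; rw [TensorProduct.add_tmul, map_add]; rfl

theorem mk_add_right (x : X) (y y' : Y) : mk ρ l x (y + y') = mk ρ l x y + mk ρ l x y' := by
  unfold mk; rw [TensorProduct.tmul_add, map_add]; rfl

theorem mk_bal (x : X) (s : S) (y : Y) : mk ρ l (ρ s x) y = mk ρ l x (l s y) := by
  have h : ρ s x ⊗ₜ[ℤ] y - x ⊗ₜ[ℤ] l s y ∈ balRel ρ l :=
    AddSubgroup.subset_closure ⟨x, s, y, rfl⟩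
  have h2 : QuotientAddGroup.mk' (balRel ρ l) (ρ s x ⊗ₜ[ℤ] y - x ⊗ₜ[ℤ] l s y) = 0 :=
    (QuotientAddGroup.eq_zero_iff _).2 h
  rw [map_sub, sub_eq_zero] at h2
  exact h2

variable {ρ l}

@[elab_as_elim]
theorem induction_on {P : BalTensor ρ l → Prop} (z : BalTensor ρ l) (zero : P 0)
    (tmul : ∀ x y, P (mk ρ l x y)) (add : ∀ a b, P a → P b → P (a + b)) : P z := by
  obtain ⟨w, rfl⟩ := QuotientAddGroup.mk'_surjective (balRel ρ l) z
  induction w using TensorProduct.induction_on with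
  | zero => rw [map_zero]; exact zero
  | tmul x y => exact tmul x y
  | add a b ha hb => rw [map_add]; exact add _ _ ha hb

theorem hom_ext {f g : BalTensor ρ l →+ Z} (h : ∀ x y, f (mk ρ l x y) = g (mk ρ l x y)) :
    f = g := by
  ext z
  induction z using induction_on with
  | zero => simp
  | tmul x y => exact h x y
  | add a b ha hb => rw [map_add, map_add, ha, hb]

/-- The additive map `X ⊗_S Y → Z`, `x ⊗ y ↦ f x y`, given by a balanced biadditive `f`. -/
def lift (f : X → Y → Z) (hl : ∀ x x' y, f (x + x') y = f x y + f x' y)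
    (hr : ∀ x y y', f x (y + y') = f x y + f x y')
    (hb : ∀ x s y, f (ρ s x) y = f x (l s y)) : BalTensor ρ l →+ Z :=
  QuotientAddGroup.lift (balRel ρ l)
    (TensorProduct.liftAddHom
      (AddMonoidHom.mk' (fun x => AddMonoidHom.mk' (f x) (hr x))
        (fun x x' => AddMonoidHom.ext fun y => hl x x' y))
      (fun n x y => by
        have h1 := map_zsmul (AddMonoidHom.mk' (fun x => f x y) (fun x x' => hl x x' y)) n x
        have h2 := map_zsmul (AddMonoidHom.mk' (f x) (hr x)) n y
        exact h1.trans h2.symm))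
    (by
      refine (AddSubgroup.closure_le _).2 ?_
      rintro _ ⟨x, s, y, rfl⟩
      change _ = _
      rw [map_sub, sub_eq_zero]
      exact hb x s y)

@[simp]
theorem lift_mk (f : X → Y → Z) (hl hr hb) (x : X) (y : Y) :
    lift (ρ := ρ) (l := l) f hl hr hb (mk ρ l x y) = f x y := rfl

end BalTensor

end BalTensor

/-! ### Bimodules and corings -/

/-- An `R`-`R`-bimodule structure on the additive group `X`: `l r x` is `r · x` and `ρ r x` is
`x · r`. -/
structure Bimod (R X : Type*) [Ring R] [AddCommGroup X] where
  l : R →+ X →+ X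
  ρ : R →+ X →+ X
  l_one : ∀ x, l 1 x = x
  l_mul : ∀ r r' x, l (r * r') x = l r (l r' x)
  ρ_one : ∀ x, ρ 1 x = x
  ρ_mul : ∀ r r' x, ρ (r * r') x = ρ r' (ρ r x)
  comm : ∀ r r' x, l r (ρ r' x) = ρ r' (l r x)

namespace Bimod

variable {R X : Type*} [Ring R] [AddCommGroup X] (P : Bimod R X)

/-- `X ⊗_R X`. -/
abbrev T2 : Type _ := BalTensor (fun r : R => P.ρ r) (fun r : R => P.l r)

/-- `x ⊗ y` in `X ⊗_R X`. -/
abbrev tmul (x y : X) : P.T2 := BalTensor.mk (fun r : R => P.ρ r) (fun r : R => P.l r) x y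

theorem tmul_add_left (x x' y : X) : P.tmul (x + x') y = P.tmul x y + P.tmul x' y :=
  BalTensor.mk_add_left _ _ x x' y

theorem tmul_add_right (x y y' : X) : P.tmul x (y + y') = P.tmul x y + P.tmul x y' :=
  BalTensor.mk_add_right _ _ x y y'

theorem tmul_bal (x : X) (r : R) (y : X) : P.tmul (P.ρ r x) y = P.tmul x (P.l r y) :=
  BalTensor.mk_bal _ _ x r y

/-- The left action `r · (x ⊗ y) = (r · x) ⊗ y` on `X ⊗_R X`. -/
def l2 (r : R) : P.T2 →+ P.T2 :=
  BalTensor.lift (fun x y => P.tmul (P.l r x) y)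
    (fun x x' y => by rw [map_add, Bimod.tmul_add_left])
    (fun x y y' => by rw [Bimod.tmul_add_right])
    (fun x s y => by rw [P.comm, tmul_bal])

/-- The right action `(x ⊗ y) · r = x ⊗ (y · r)` on `X ⊗_R X`. -/
def ρ2 (r : R) : P.T2 →+ P.T2 :=
  BalTensor.lift (fun x y => P.tmul x (P.ρ r y))
    (fun x x' y => by rw [Bimod.tmul_add_left])
    (fun x y y' => by rw [map_add, Bimod.tmul_add_right])
    (fun x s y => by rw [← P.comm, tmul_bal])

/-- `X ⊗_R X ⊗_R X`, as `X ⊗_R (X ⊗_R X)`. -/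
abbrev T3 : Type _ := BalTensor (fun r : R => P.ρ r) P.l2

/-- `x ⊗ (y ⊗ z)` in `X ⊗_R X ⊗_R X`. -/
abbrev tmul3 (x y z : X) : P.T3 := BalTensor.mk (fun r : R => P.ρ r) P.l2 x (P.tmul y z)

/-- The map `X ⊗_R X → X ⊗_R X ⊗_R X`, `x ⊗ y ↦ x ⊗ y ⊗ z`. -/
def appendR (z : X) : P.T2 →+ P.T3 :=
  BalTensor.lift (fun x y => P.tmul3 x y z)
    (fun x x' y => by rw [tmul3, BalTensor.mk_add_left])
    (fun x y y' => by rw [tmul3, tmul_add_left, BalTensor.mk_add_right])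
    (fun x s y => BalTensor.mk_bal _ _ x s (P.tmul y z))

theorem appendR_add (z z' : X) (t : P.T2) :
    P.appendR (z + z') t = P.appendR z t + P.appendR z' t := by
  have : P.appendR (z + z') = P.appendR z + P.appendR z' :=
    BalTensor.hom_ext fun x y => by
      change P.tmul3 x y (z + z') = P.tmul3 x y z + P.tmul3 x y z'
      rw [tmul3, tmul_add_right, BalTensor.mk_add_right]
  rw [this]; rfl

theorem appendR_bal (r : R) (z : X) (t : P.T2) :
    P.appendR z (P.ρ2 r t) = P.appendR (P.l r z) t := by
  have : (P.appendR z).comp (P.ρ2 r) = P.appendR (P.l r z) :=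
    BalTensor.hom_ext fun x y => by
      change P.tmul3 x (P.ρ r y) z = P.tmul3 x y (P.l r z)
      rw [tmul3, tmul_bal]
  exact DFunLike.congr_fun this t

/-- `Δ ⊗ id : X ⊗_R X → X ⊗_R X ⊗_R X` for a right `R`-linear `Δ`. -/
def comulLeft (Δ : X →+ P.T2) (h : ∀ r x, Δ (P.ρ r x) = P.ρ2 r (Δ x)) : P.T2 →+ P.T3 :=
  BalTensor.lift (fun x y => P.appendR y (Δ x))
    (fun x x' y => by rw [map_add, map_add])
    (fun x y y' => by rw [appendR_add])
    (fun x s y => by rw [h, appendR_bal])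

/-- `id ⊗ Δ : X ⊗_R X → X ⊗_R X ⊗_R X` for a left `R`-linear `Δ`. -/
def comulRight (Δ : X →+ P.T2) (h : ∀ r x, Δ (P.l r x) = P.l2 r (Δ x)) : P.T2 →+ P.T3 :=
  BalTensor.lift (fun x y => BalTensor.mk _ _ x (Δ y))
    (fun x x' y => by rw [BalTensor.mk_add_left])
    (fun x y y' => by rw [map_add, BalTensor.mk_add_right])
    (fun x s y => by rw [h]; exact BalTensor.mk_bal _ _ x s (Δ y))

/-- `ε ⊗ id : X ⊗_R X → R ⊗_R X = X`. -/
def counitLeft (ε : X →+ R) (h : ∀ r x, ε (P.ρ r x) = ε x * r) : P.T2 →+ X :=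
  BalTensor.lift (fun x y => P.l (ε x) y)
    (fun x x' y => by simp)
    (fun x y y' => by simp)
    (fun x s y => by rw [h, P.l_mul])

/-- `id ⊗ ε : X ⊗_R X → X ⊗_R R = X`. -/
def counitRight (ε : X →+ R) (h : ∀ r x, ε (P.l r x) = r * ε x) : P.T2 →+ X :=
  BalTensor.lift (fun x y => P.ρ (ε y) x)
    (fun x x' y => by simp)
    (fun x y y' => by simp)
    (fun x s y => by rw [h, P.ρ_mul])

/-- `⟨X, Δ, ε⟩` is a comonoid in the category of `R`-`R`-bimodules (an `R`-coring). -/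
structure IsCoring (Δ : X →+ P.T2) (ε : X →+ R) : Prop where
  comul_l : ∀ r x, Δ (P.l r x) = P.l2 r (Δ x)
  comul_ρ : ∀ r x, Δ (P.ρ r x) = P.ρ2 r (Δ x)
  counit_l : ∀ r x, ε (P.l r x) = r * ε x
  counit_ρ : ∀ r x, ε (P.ρ r x) = ε x * r
  coassoc : ∀ x, P.comulLeft Δ comul_ρ (Δ x) = P.comulRight Δ comul_l (Δ x)
  counit_comul : ∀ x, P.counitLeft ε counit_ρ (Δ x) = x
  comul_counit : ∀ x, P.counitRight ε counit_l (Δ x) = x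

/-- The map `f ⊗ f : X ⊗_R X → Y ⊗_R Y` for a bimodule map `f`. -/
def map2 {Y : Type*} [AddCommGroup Y] (Q : Bimod R Y) (f : X →+ Y)
    (hl : ∀ r x, f (P.l r x) = Q.l r (f x)) (hρ : ∀ r x, f (P.ρ r x) = Q.ρ r (f x)) :
    P.T2 →+ Q.T2 :=
  BalTensor.lift (fun x y => Q.tmul (f x) (f y))
    (fun x x' y => by rw [map_add, Bimod.tmul_add_left])
    (fun x y y' => by rw [map_add, Bimod.tmul_add_right])
    (fun x s y => by rw [hρ, hl, tmul_bal])

end Bimod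

/-! ### Left bialgebroids -/

/-- The `R`-`R`-bimodule structure `r · a · r' = s(r) t(r') a` on `A`. -/
def leftBimod {R A : Type*} [Ring R] [Ring A] (s : R →+* A) (t : Rᵐᵒᵖ →+* A)
    (comm : ∀ r r', s r * t r' = t r' * s r) : Bimod R A where
  l := AddMonoidHom.mul.comp s.toAddMonoidHom
  ρ := (AddMonoidHom.mul.comp t.toAddMonoidHom).comp MulOpposite.opAddEquiv.toAddMonoidHom
  l_one x := by simp
  l_mul r r' x := by simp [mul_assoc]
  ρ_one x := by simp
  ρ_mul r r' x := by simp [mul_assoc]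
  comm r r' x := by simp [← mul_assoc, comm]

/-- The data of a left bialgebroid over `R` on the ring `A`. -/
structure LeftBialgebroidData (R A : Type*) [Ring R] [Ring A] where
  s : R →+* A
  t : Rᵐᵒᵖ →+* A
  comm : ∀ r r', s r * t r' = t r' * s r
  comul : A →+ (leftBimod s t comm).T2
  counit : A →+ R

namespace LeftBialgebroidData

variable {R A : Type*} [Ring R] [Ring A] (𝒜 : LeftBialgebroidData R A)

/-- The bimodule structure `r · a · r' = s(r) t(r') a`. -/
abbrev bimod : Bimod R A := leftBimod 𝒜.s 𝒜.t 𝒜.comm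

@[simp] theorem bimod_l (r : R) (a : A) : 𝒜.bimod.l r a = 𝒜.s r * a := rfl

@[simp] theorem bimod_ρ (r : R) (a : A) : 𝒜.bimod.ρ r a = 𝒜.t (MulOpposite.op r) * a := rfl

/-- Right multiplication by `x ⊗ y` on `A ⊗_R A`: `a ⊗ a' ↦ a x ⊗ a' y`. -/
def mulT (x y : A) : 𝒜.bimod.T2 →+ 𝒜.bimod.T2 :=
  BalTensor.lift (fun a a' => 𝒜.bimod.tmul (a * x) (a' * y))
    (fun a a' b => by rw [add_mul, Bimod.tmul_add_left])
    (fun a b b' => by rw [add_mul, Bimod.tmul_add_right])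
    (fun a r b => by
      have := 𝒜.bimod.tmul_bal (a * x) r (b * y)
      simpa [mul_assoc] using this)

theorem mulT_add_left (x x' y : A) (T : 𝒜.bimod.T2) :
    𝒜.mulT (x + x') y T = 𝒜.mulT x y T + 𝒜.mulT x' y T := by
  have : 𝒜.mulT (x + x') y = 𝒜.mulT x y + 𝒜.mulT x' y :=
    BalTensor.hom_ext fun a b => by
      change 𝒜.bimod.tmul (a * (x + x')) (b * y) =
        𝒜.bimod.tmul (a * x) (b * y) + 𝒜.bimod.tmul (a * x') (b * y)
      rw [mul_add, Bimod.tmul_add_left]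
  rw [this]; rfl

theorem mulT_add_right (x y y' : A) (T : 𝒜.bimod.T2) :
    𝒜.mulT x (y + y') T = 𝒜.mulT x y T + 𝒜.mulT x y' T := by
  have : 𝒜.mulT x (y + y') = 𝒜.mulT x y + 𝒜.mulT x y' :=
    BalTensor.hom_ext fun a b => by
      change 𝒜.bimod.tmul (a * x) (b * (y + y')) =
        𝒜.bimod.tmul (a * x) (b * y) + 𝒜.bimod.tmul (a * x) (b * y')
      rw [mul_add, Bimod.tmul_add_right]
  rw [this]; rfl

theorem mulT_mulT (x y x' y' : A) (T : 𝒜.bimod.T2) :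
    𝒜.mulT x y (𝒜.mulT x' y' T) = 𝒜.mulT (x' * x) (y' * y) T := by
  have : (𝒜.mulT x y).comp (𝒜.mulT x' y') = 𝒜.mulT (x' * x) (y' * y) :=
    BalTensor.hom_ext fun a b => by
      change 𝒜.bimod.tmul (a * x' * x) (b * y' * y) = 𝒜.bimod.tmul (a * (x' * x)) (b * (y' * y))
      rw [mul_assoc, mul_assoc]
  exact DFunLike.congr_fun this T

/-- The product `Y ↦ X Y` on `A ⊗_R A`, `(a ⊗ a')(x ⊗ y) = a x ⊗ a' y`, for an element `X` with
`X (t(r) ⊗ 1) = X (1 ⊗ s(r))`. -/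
def takeuchiMul (X : 𝒜.bimod.T2)
    (hX : ∀ r, 𝒜.mulT (𝒜.t (MulOpposite.op r)) 1 X = 𝒜.mulT 1 (𝒜.s r) X) :
    𝒜.bimod.T2 →+ 𝒜.bimod.T2 :=
  BalTensor.lift (fun x y => 𝒜.mulT x y X)
    (fun x x' y => 𝒜.mulT_add_left x x' y X)
    (fun x y y' => 𝒜.mulT_add_right x y y' X)
    (fun x r y => by
      have := congrArg (𝒜.mulT x y) (hX r)
      rw [mulT_mulT, mulT_mulT, one_mul, one_mul] at this
      exact this)

/-- The axioms of a left bialgebroid. -/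
structure IsLeftBialgebroid : Prop where
  coring : 𝒜.bimod.IsCoring 𝒜.comul 𝒜.counit
  takeuchi : ∀ a r, 𝒜.mulT (𝒜.t (MulOpposite.op r)) 1 (𝒜.comul a) =
    𝒜.mulT 1 (𝒜.s r) (𝒜.comul a)
  comul_mul : ∀ a b, 𝒜.comul (a * b) = 𝒜.takeuchiMul (𝒜.comul a) (takeuchi a) (𝒜.comul b)
  comul_one : 𝒜.comul 1 = 𝒜.bimod.tmul 1 1
  counit_one : 𝒜.counit 1 = 1
  counit_s : ∀ a b, 𝒜.counit (a * 𝒜.s (𝒜.counit b)) = 𝒜.counit (a * b)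
  counit_t : ∀ a b, 𝒜.counit (a * 𝒜.t (MulOpposite.op (𝒜.counit b))) = 𝒜.counit (a * b)

end LeftBialgebroidData

/-- A left bialgebroid over `R` with underlying ring `A`. -/
structure LeftBialgebroid (R A : Type*) [Ring R] [Ring A] extends LeftBialgebroidData R A where
  isLeftBialgebroid : toLeftBialgebroidData.IsLeftBialgebroid

/-! ### Right bialgebroids -/

/-- The `R`-`R`-bimodule structure `r · b · r' = b t(r) s(r')` on `B`. -/
def rightBimod {R B : Type*} [Ring R] [Ring B] (s : R →+* B) (t : Rᵐᵒᵖ →+* B)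
    (comm : ∀ r r', s r * t r' = t r' * s r) : Bimod R B where
  l := (AddMonoidHom.mul.flip.comp t.toAddMonoidHom).comp MulOpposite.opAddEquiv.toAddMonoidHom
  ρ := AddMonoidHom.mul.flip.comp s.toAddMonoidHom
  l_one x := by simp
  l_mul r r' x := by simp [mul_assoc]
  ρ_one x := by simp
  ρ_mul r r' x := by simp [mul_assoc]
  comm r r' x := by simp [mul_assoc, comm]

/-- The data of a right bialgebroid over `R` on the ring `B`. -/
structure RightBialgebroidData (R B : Type*) [Ring R] [Ring B] where
  s : R →+* B
  t : Rᵐᵒᵖ →+* B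
  comm : ∀ r r', s r * t r' = t r' * s r
  comul : B →+ (rightBimod s t comm).T2
  counit : B →+ R

namespace RightBialgebroidData

variable {R B : Type*} [Ring R] [Ring B] (ℬ : RightBialgebroidData R B)

/-- The bimodule structure `r · b · r' = b t(r) s(r')`. -/
abbrev bimod : Bimod R B := rightBimod ℬ.s ℬ.t ℬ.comm

@[simp] theorem bimod_l (r : R) (b : B) : ℬ.bimod.l r b = b * ℬ.t (MulOpposite.op r) := rfl

@[simp] theorem bimod_ρ (r : R) (b : B) : ℬ.bimod.ρ r b = b * ℬ.s r := rfl

/-- Left multiplication by `x ⊗ y` on `B ⊗_R B`: `b ⊗ b' ↦ x b ⊗ y b'`. -/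
def mulT (x y : B) : ℬ.bimod.T2 →+ ℬ.bimod.T2 :=
  BalTensor.lift (fun b b' => ℬ.bimod.tmul (x * b) (y * b'))
    (fun a a' b => by rw [mul_add, Bimod.tmul_add_left])
    (fun a b b' => by rw [mul_add, Bimod.tmul_add_right])
    (fun a r b => by
      have := ℬ.bimod.tmul_bal (x * a) r (y * b)
      simpa [mul_assoc] using this)

theorem mulT_add_left (x x' y : B) (T : ℬ.bimod.T2) :
    ℬ.mulT (x + x') y T = ℬ.mulT x y T + ℬ.mulT x' y T := by
  have : ℬ.mulT (x + x') y = ℬ.mulT x y + ℬ.mulT x' y :=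
    BalTensor.hom_ext fun a b => by
      change ℬ.bimod.tmul ((x + x') * a) (y * b) =
        ℬ.bimod.tmul (x * a) (y * b) + ℬ.bimod.tmul (x' * a) (y * b)
      rw [add_mul, Bimod.tmul_add_left]
  rw [this]; rfl

theorem mulT_add_right (x y y' : B) (T : ℬ.bimod.T2) :
    ℬ.mulT x (y + y') T = ℬ.mulT x y T + ℬ.mulT x y' T := by
  have : ℬ.mulT x (y + y') = ℬ.mulT x y + ℬ.mulT x y' :=
    BalTensor.hom_ext fun a b => by
      change ℬ.bimod.tmul (x * a) ((y + y') * b) =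
        ℬ.bimod.tmul (x * a) (y * b) + ℬ.bimod.tmul (x * a) (y' * b)
      rw [add_mul, Bimod.tmul_add_right]
  rw [this]; rfl

theorem mulT_mulT (x y x' y' : B) (T : ℬ.bimod.T2) :
    ℬ.mulT x y (ℬ.mulT x' y' T) = ℬ.mulT (x * x') (y * y') T := by
  have : (ℬ.mulT x y).comp (ℬ.mulT x' y') = ℬ.mulT (x * x') (y * y') :=
    BalTensor.hom_ext fun a b => by
      change ℬ.bimod.tmul (x * (x' * a)) (y * (y' * b)) =
        ℬ.bimod.tmul (x * x' * a) (y * y' * b)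
      rw [mul_assoc, mul_assoc]
  exact DFunLike.congr_fun this T

/-- The product `X ↦ X Y` on `B ⊗_R B`, `(x ⊗ y)(b ⊗ b') = x b ⊗ y b'`, for an element `Y` with
`(s(r) ⊗ 1) Y = (1 ⊗ t(r)) Y`. -/
def takeuchiMul (Y : ℬ.bimod.T2)
    (hY : ∀ r, ℬ.mulT (ℬ.s r) 1 Y = ℬ.mulT 1 (ℬ.t (MulOpposite.op r)) Y) :
    ℬ.bimod.T2 →+ ℬ.bimod.T2 :=
  BalTensor.lift (fun x y => ℬ.mulT x y Y)
    (fun x x' y => ℬ.mulT_add_left x x' y Y)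
    (fun x y y' => ℬ.mulT_add_right x y y' Y)
    (fun x r y => by
      have := congrArg (ℬ.mulT x y) (hY r)
      rw [mulT_mulT, mulT_mulT, mul_one, mul_one] at this
      exact this)

/-- The axioms of a right bialgebroid. -/
structure IsRightBialgebroid : Prop where
  coring : ℬ.bimod.IsCoring ℬ.comul ℬ.counit
  takeuchi : ∀ b r, ℬ.mulT (ℬ.s r) 1 (ℬ.comul b) =
    ℬ.mulT 1 (ℬ.t (MulOpposite.op r)) (ℬ.comul b)
  comul_mul : ∀ a b, ℬ.comul (a * b) = ℬ.takeuchiMul (ℬ.comul b) (takeuchi b) (ℬ.comul a)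
  comul_one : ℬ.comul 1 = ℬ.bimod.tmul 1 1
  counit_one : ℬ.counit 1 = 1
  counit_t : ∀ a b, ℬ.counit (ℬ.t (MulOpposite.op (ℬ.counit a)) * b) = ℬ.counit (a * b)
  counit_s : ∀ a b, ℬ.counit (ℬ.s (ℬ.counit a) * b) = ℬ.counit (a * b)

end RightBialgebroidData

/-- A right bialgebroid over `R` with underlying ring `B`. -/
structure RightBialgebroid (R B : Type*) [Ring R] [Ring B] extends RightBialgebroidData R B where
  isRightBialgebroid : toRightBialgebroidData.IsRightBialgebroid

/-- A ring isomorphism `e : B ≃ C` is an isomorphism of bialgebroids over `R` when it is compatible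
with source, target, comultiplication and counit. -/
structure IsRightBialgebroidIso {R B C : Type*} [Ring R] [Ring B] [Ring C]
    (ℬ : RightBialgebroidData R B) (𝒞 : RightBialgebroidData R C) (e : B ≃+* C) : Prop where
  map_s : ∀ r, e (ℬ.s r) = 𝒞.s r
  map_t : ∀ r, e (ℬ.t r) = 𝒞.t r
  map_counit : ∀ b, 𝒞.counit (e b) = ℬ.counit b
  map_comul : ∀ b, 𝒞.comul (e b) =
    ℬ.bimod.map2 𝒞.bimod (e : B →+ C) (fun r x => by simp [map_t])
      (fun r x => by simp [map_s]) (ℬ.comul b)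

/-- Two right bialgebroids over `R` are isomorphic. -/
def RightBialgebroid.Isomorphic {R B C : Type*} [Ring R] [Ring B] [Ring C]
    (ℬ : RightBialgebroid R B) (𝒞 : RightBialgebroid R C) : Prop :=
  ∃ e : B ≃+* C, IsRightBialgebroidIso ℬ.toRightBialgebroidData 𝒞.toRightBialgebroidData e


/-! ### Duals of a left bialgebroid -/

namespace LeftBialgebroid

open MulOpposite

variable {R A : Type*} [Ring R] [Ring A] (𝒜 : LeftBialgebroid R A)

/-- The right `R`-module `A_R`, `a · r = t(r) a`, as a left `Rᵐᵒᵖ`-module. -/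
def RightMod (_𝒜 : LeftBialgebroid R A) : Type _ := A

instance : AddCommGroup 𝒜.RightMod := inferInstanceAs (AddCommGroup A)

instance : Module Rᵐᵒᵖ 𝒜.RightMod := Module.compHom A 𝒜.t

/-- The left `R`-module `_R A`, `r · a = s(r) a`. -/
def LeftMod (_𝒜 : LeftBialgebroid R A) : Type _ := A

instance : AddCommGroup 𝒜.LeftMod := inferInstanceAs (AddCommGroup A)

instance : Module R 𝒜.LeftMod := Module.compHom A 𝒜.s

/-- `A_R` is finitely generated projective. -/
def RightFGP : Prop := Module.Finite Rᵐᵒᵖ 𝒜.RightMod ∧ Module.Projective Rᵐᵒᵖ 𝒜.RightMod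

/-- `_R A` is finitely generated projective. -/
def LeftFGP : Prop := Module.Finite R 𝒜.LeftMod ∧ Module.Projective R 𝒜.LeftMod

theorem s_t (r : R) (x : Rᵐᵒᵖ) : 𝒜.s r * 𝒜.t x = 𝒜.t x * 𝒜.s r := 𝒜.comm r x

theorem comul_s_mul (r : R) (a : A) : 𝒜.comul (𝒜.s r * a) = 𝒜.bimod.l2 r (𝒜.comul a) :=
  𝒜.isLeftBialgebroid.coring.comul_l r a

theorem comul_t_mul (r : R) (a : A) : 𝒜.comul (𝒜.t (op r) * a) = 𝒜.bimod.ρ2 r (𝒜.comul a) :=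
  𝒜.isLeftBialgebroid.coring.comul_ρ r a

theorem counit_s_mul (r : R) (a : A) : 𝒜.counit (𝒜.s r * a) = r * 𝒜.counit a :=
  𝒜.isLeftBialgebroid.coring.counit_l r a

theorem counit_t_mul (r : R) (a : A) : 𝒜.counit (𝒜.t (op r) * a) = 𝒜.counit a * r :=
  𝒜.isLeftBialgebroid.coring.counit_ρ r a

theorem comul_mul_s (r : R) (a : A) : 𝒜.comul (a * 𝒜.s r) = 𝒜.mulT (𝒜.s r) 1 (𝒜.comul a) := by
  have h : 𝒜.comul (𝒜.s r) = 𝒜.bimod.tmul (𝒜.s r) 1 := by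
    rw [← mul_one (𝒜.s r), comul_s_mul, 𝒜.isLeftBialgebroid.comul_one]
    rfl
  rw [𝒜.isLeftBialgebroid.comul_mul, h]
  rfl

theorem comul_mul_t (r : R) (a : A) :
    𝒜.comul (a * 𝒜.t (op r)) = 𝒜.mulT 1 (𝒜.t (op r)) (𝒜.comul a) := by
  have h : 𝒜.comul (𝒜.t (op r)) = 𝒜.bimod.tmul 1 (𝒜.t (op r)) := by
    rw [← mul_one (𝒜.t (op r)), comul_t_mul, 𝒜.isLeftBialgebroid.comul_one]
    rfl
  rw [𝒜.isLeftBialgebroid.comul_mul, h]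
  rfl

/-! #### The right dual -/

/-- The right dual `A* = Hom(A_R, R_R)`. -/
def RightDual : Type _ := 𝒜.RightMod →ₗ[Rᵐᵒᵖ] R

instance : AddCommGroup 𝒜.RightDual := inferInstanceAs (AddCommGroup (𝒜.RightMod →ₗ[Rᵐᵒᵖ] R))

namespace RightDual

variable {𝒜}

/-- The evaluation `⟨b, a⟩`. -/
def ev (b : 𝒜.RightDual) : A →+ R :=
  LinearMap.toAddMonoidHom (show 𝒜.RightMod →ₗ[Rᵐᵒᵖ] R from b)

theorem ev_t (b : 𝒜.RightDual) (r : R) (a : A) : b.ev (𝒜.t (op r) * a) = b.ev a * r :=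
  LinearMap.map_smul (show 𝒜.RightMod →ₗ[Rᵐᵒᵖ] R from b) (op r) a

/-- An additive map with `f(a · r) = f(a) r` is an element of `A*`. -/
def ofHom (f : A →+ R) (h : ∀ r a, f (𝒜.t (op r) * a) = f a * r) : 𝒜.RightDual :=
  { toFun := f
    map_add' := map_add f
    map_smul' := fun r a => h (unop r) a : 𝒜.RightMod →ₗ[Rᵐᵒᵖ] R }

@[simp] theorem ev_ofHom (f : A →+ R) (h) (a : A) : (ofHom (𝒜 := 𝒜) f h).ev a = f a := rfl

@[simp] theorem ev_add (b b' : 𝒜.RightDual) (a : A) : (b + b').ev a = b.ev a + b'.ev a := rfl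

@[simp] theorem ev_zero (a : A) : (0 : 𝒜.RightDual).ev a = 0 := rfl

theorem ext {b b' : 𝒜.RightDual} (h : ∀ a, b.ev a = b'.ev a) : b = b' :=
  DFunLike.ext (F := 𝒜.RightMod →ₗ[Rᵐᵒᵖ] R) _ _ h

/-- The map `A ⊗_R A → A`, `a ⊗ a' ↦ ⟨b, a⟩ · a'`. -/
def contract (b : 𝒜.RightDual) : 𝒜.bimod.T2 →+ A :=
  BalTensor.lift (fun a a' => 𝒜.s (b.ev a) * a')
    (fun a a' c => by simp [add_mul])
    (fun a c c' => by simp [mul_add])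
    (fun a r a' => by simp [ev_t, mul_assoc])

@[simp] theorem contract_tmul (b : 𝒜.RightDual) (a a' : A) :
    b.contract (𝒜.bimod.tmul a a') = 𝒜.s (b.ev a) * a' := rfl

theorem contract_ρ2 (b : 𝒜.RightDual) (r : R) (T : 𝒜.bimod.T2) :
    b.contract (𝒜.bimod.ρ2 r T) = 𝒜.t (op r) * b.contract T := by
  have : b.contract.comp (𝒜.bimod.ρ2 r) = (AddMonoidHom.mulLeft (𝒜.t (op r))).comp b.contract :=
    BalTensor.hom_ext fun x y => by
      change 𝒜.s (b.ev x) * (𝒜.t (op r) * y) = 𝒜.t (op r) * (𝒜.s (b.ev x) * y)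
      rw [← mul_assoc, s_t, mul_assoc]
  exact DFunLike.congr_fun this T

theorem contract_mulT (b : 𝒜.RightDual) (x : A) (T : 𝒜.bimod.T2) :
    b.contract (𝒜.mulT 1 x T) = b.contract T * x := by
  have : b.contract.comp (𝒜.mulT 1 x) = (AddMonoidHom.mulRight x).comp b.contract :=
    BalTensor.hom_ext fun y z => by
      change 𝒜.s (b.ev (y * 1)) * (z * x) = 𝒜.s (b.ev y) * z * x
      rw [mul_one, mul_assoc]
  exact DFunLike.congr_fun this T

theorem contract_add (b b' : 𝒜.RightDual) (T : 𝒜.bimod.T2) :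
    (b + b').contract T = b.contract T + b'.contract T := by
  have : (b + b').contract = b.contract + b'.contract :=
    BalTensor.hom_ext fun y z => by
      change 𝒜.s ((b + b').ev y) * z = 𝒜.s (b.ev y) * z + 𝒜.s (b'.ev y) * z
      rw [ev_add, map_add, add_mul]
  rw [this]; rfl

/-- The product `⟨b b', a⟩ = ⟨b', ⟨b, a₁⟩ · a₂⟩`. -/
def mul (b b' : 𝒜.RightDual) : 𝒜.RightDual :=
  ofHom ((b'.ev.comp b.contract).comp 𝒜.comul) fun r a => by
    simp [comul_t_mul, contract_ρ2, ev_t]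

theorem ev_mul (b b' : 𝒜.RightDual) (a : A) :
    (b.mul b').ev a = b'.ev (b.contract (𝒜.comul a)) := rfl

/-- The unit `ε`. -/
def one : 𝒜.RightDual := ofHom 𝒜.counit fun r a => 𝒜.counit_t_mul r a

theorem ev_one (a : A) : (one : 𝒜.RightDual).ev a = 𝒜.counit a := rfl

/-- The map `a ⊗ a' ⊗ a'' ↦ ⟨b', ⟨b, a⟩ · a'⟩ · a''`. -/
def contract3 (b b' : 𝒜.RightDual) : 𝒜.bimod.T3 →+ A :=
  BalTensor.lift (fun a T => b'.contract (𝒜.bimod.l2 (b.ev a) T))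
    (fun a a' T => by
      have : 𝒜.bimod.l2 (b.ev (a + a')) = 𝒜.bimod.l2 (b.ev a) + 𝒜.bimod.l2 (b.ev a') :=
        BalTensor.hom_ext fun x y => by
          change 𝒜.bimod.tmul (𝒜.bimod.l (b.ev (a + a')) x) y =
            𝒜.bimod.tmul (𝒜.bimod.l (b.ev a) x) y + 𝒜.bimod.tmul (𝒜.bimod.l (b.ev a') x) y
          rw [map_add, map_add, AddMonoidHom.add_apply, Bimod.tmul_add_left]
      rw [this, AddMonoidHom.add_apply, map_add])
    (fun a T T' => by rw [map_add, map_add])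
    (fun a r T => by
      have : 𝒜.bimod.l2 (b.ev a * r) = (𝒜.bimod.l2 (b.ev a)).comp (𝒜.bimod.l2 r) :=
        BalTensor.hom_ext fun x y => by
          change 𝒜.bimod.tmul (𝒜.bimod.l (b.ev a * r) x) y =
            𝒜.bimod.tmul (𝒜.bimod.l (b.ev a) (𝒜.bimod.l r x)) y
          rw [Bimod.l_mul]
      rw [LeftBialgebroidData.bimod_ρ, ev_t, this]; rfl)

theorem mul_assoc' (b b' b'' : 𝒜.RightDual) : (b.mul b').mul b'' = b.mul (b'.mul b'') := by
  apply ext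
  intro a
  rw [ev_mul, ev_mul, ev_mul]
  congr 1
  have hc := 𝒜.isLeftBialgebroid.coring.coassoc a
  have h1 : (contract3 b b').comp (𝒜.bimod.comulLeft 𝒜.comul 𝒜.isLeftBialgebroid.coring.comul_ρ) =
      (b.mul b').contract := by
    refine BalTensor.hom_ext fun x y => ?_
    change contract3 b b' (𝒜.bimod.appendR y (𝒜.comul x)) = 𝒜.s ((b.mul b').ev x) * y
    rw [ev_mul]
    have : (contract3 b b').comp (𝒜.bimod.appendR y) =
        (AddMonoidHom.mulRight y).comp (𝒜.s.toAddMonoidHom.comp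
          (b'.ev.comp b.contract)) := by
      refine BalTensor.hom_ext fun u v => ?_
      rfl
    exact DFunLike.congr_fun this _
  have h2 : (contract3 b b').comp (𝒜.bimod.comulRight 𝒜.comul
      𝒜.isLeftBialgebroid.coring.comul_l) = (b'.contract.comp 𝒜.comul).comp b.contract := by
    refine BalTensor.hom_ext fun x y => ?_
    change b'.contract (𝒜.bimod.l2 (b.ev x) (𝒜.comul y)) =
      b'.contract (𝒜.comul (𝒜.s (b.ev x) * y))
    rw [comul_s_mul]
  have e1 := DFunLike.congr_fun h1 (𝒜.comul a)
  have e2 := DFunLike.congr_fun h2 (𝒜.comul a)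
  exact e1.symm.trans ((congrArg (contract3 b b') hc).trans e2)

theorem one_mul' (b : 𝒜.RightDual) : one.mul b = b := by
  apply ext
  intro a
  rw [ev_mul]
  exact congrArg b.ev (𝒜.isLeftBialgebroid.coring.counit_comul a)

theorem mul_one' (b : 𝒜.RightDual) : b.mul one = b := by
  apply ext
  intro a
  rw [ev_mul, ev_one]
  have : 𝒜.counit.comp b.contract =
      b.ev.comp (𝒜.bimod.counitRight 𝒜.counit 𝒜.isLeftBialgebroid.coring.counit_l) := by
    refine BalTensor.hom_ext fun x y => ?_
    change 𝒜.counit (𝒜.s (b.ev x) * y) = b.ev (𝒜.t (op (𝒜.counit y)) * x)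
    rw [counit_s_mul, ev_t]
  exact (DFunLike.congr_fun this (𝒜.comul a)).trans
    (congrArg b.ev (𝒜.isLeftBialgebroid.coring.comul_counit a))

instance : Ring 𝒜.RightDual :=
  { (inferInstance : AddCommGroup 𝒜.RightDual) with
    mul := mul
    one := one
    mul_assoc := mul_assoc'
    one_mul := one_mul'
    mul_one := mul_one'
    left_distrib := fun a b c => rfl
    right_distrib := fun a b c => ext fun x => by
      change c.ev ((a + b).contract (𝒜.comul x)) =
        c.ev (a.contract (𝒜.comul x)) + c.ev (b.contract (𝒜.comul x))
      rw [contract_add, map_add]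
    zero_mul := fun b => ext fun x => by
      change b.ev ((0 : 𝒜.RightDual).contract (𝒜.comul x)) = 0
      have : (0 : 𝒜.RightDual).contract = 0 :=
        BalTensor.hom_ext fun y z => by
          change 𝒜.s ((0 : 𝒜.RightDual).ev y) * z = 0
          simp
      rw [this]; exact map_zero _
    mul_zero := fun b => rfl }

theorem ev_mul_eq (b b' : 𝒜.RightDual) (a : A) :
    (b * b').ev a = b'.ev (b.contract (𝒜.comul a)) := rfl

/-- `s(r) = 1 · r : a ↦ ε(a t(r))`. -/
def sElt (r : R) : 𝒜.RightDual :=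
  ofHom (𝒜.counit.comp (AddMonoidHom.mulRight (𝒜.t (op r)))) fun r' a => by
    simp [mul_assoc, counit_t_mul]

/-- `t(r) = r · 1 : a ↦ r ε(a)`. -/
def tElt (r : R) : 𝒜.RightDual :=
  ofHom ((AddMonoidHom.mulLeft r).comp 𝒜.counit) fun r' a => by
    simp [mul_assoc, counit_t_mul]

/-- The bimodule structure of `A*`: `⟨b · r, a⟩ = ⟨b, a t(r)⟩`. -/
theorem ev_mul_sElt (b : 𝒜.RightDual) (r : R) (a : A) :
    (b * sElt r).ev a = b.ev (a * 𝒜.t (op r)) := by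
  have h : (b * sElt r).ev a = 𝒜.counit (b.contract (𝒜.comul a) * 𝒜.t (op r)) := rfl
  rw [h, ← contract_mulT, ← comul_mul_t]
  exact congrArg (fun z => z.ev (a * 𝒜.t (op r))) (mul_one' b)

/-- The bimodule structure of `A*`: `⟨r · b, a⟩ = r ⟨b, a⟩`. -/
theorem ev_mul_tElt (b : 𝒜.RightDual) (r : R) (a : A) :
    (b * tElt r).ev a = r * b.ev a :=
  congrArg (fun z => r * z.ev a) (mul_one' b)

/-- The source map of `A*`. -/
def sHom : R →+* 𝒜.RightDual where
  toFun := sElt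
  map_one' := ext fun a => by
    change 𝒜.counit (a * 𝒜.t (op 1)) = 𝒜.counit a
    simp
  map_mul' r r' := ext fun a => by
    rw [ev_mul_sElt]
    change 𝒜.counit (a * 𝒜.t (op (r * r'))) = 𝒜.counit (a * 𝒜.t (op r') * 𝒜.t (op r))
    simp [mul_assoc]
  map_zero' := ext fun a => by
    change 𝒜.counit (a * 𝒜.t (op 0)) = 0
    simp
  map_add' r r' := ext fun a => by
    change 𝒜.counit (a * 𝒜.t (op (r + r'))) =
      𝒜.counit (a * 𝒜.t (op r)) + 𝒜.counit (a * 𝒜.t (op r'))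
    simp [mul_add]

/-- The target map of `A*`. -/
def tHom : Rᵐᵒᵖ →+* 𝒜.RightDual where
  toFun r := tElt (unop r)
  map_one' := ext fun a => one_mul _
  map_mul' r r' := ext fun a => by
    rw [ev_mul_tElt]
    exact mul_assoc _ _ _
  map_zero' := ext fun a => zero_mul _
  map_add' r r' := ext fun a => add_mul _ _ _

theorem s_comm_t (r : R) (r' : Rᵐᵒᵖ) :
    (sHom r * tHom r' : 𝒜.RightDual) = tHom r' * sHom r := by
  apply ext
  intro a
  exact (ev_mul_tElt (sHom r) (unop r') a).trans (ev_mul_sElt (tHom r') r a).symm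

variable (𝒜) in
/-- Dual bases `{a_i}` of `A_R` and `{b_i}` of `_R A*`: `a = ∑ a_i · ⟨b_i, a⟩`. -/
structure DualBasis where
  n : ℕ
  a : Fin n → A
  b : Fin n → 𝒜.RightDual
  sum_eq : ∀ x, ∑ i, 𝒜.t (op ((b i).ev x)) * a i = x

theorem nonempty_dualBasis (h : 𝒜.RightFGP) : Nonempty (DualBasis 𝒜) := by
  obtain ⟨h1, h2⟩ := h
  obtain ⟨n, f, hf⟩ := Module.Finite.exists_fin' Rᵐᵒᵖ 𝒜.RightMod
  obtain ⟨g, hg⟩ := Module.projective_lifting_property f LinearMap.id hf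
  refine ⟨⟨n, fun i => f (Pi.single i 1), fun i => ofHom (𝒜 := 𝒜)
    (AddMonoidHom.mk' (fun a : A => unop (g a i)) fun a a' => by
      rw [show g (a + a' : A) = g a + g a' from map_add g a a']; rfl) ?_, ?_⟩⟩
  · intro r a
    have := congrFun (map_smul g (op r) (show 𝒜.RightMod from a)) i
    change unop (g (𝒜.t (op r) * a) i) = _
    have h3 : g (𝒜.t (op r) * a) i = op r * g a i := this
    rw [h3]; rfl
  · intro x
    have h3 : f (g x) = x := DFunLike.congr_fun hg x
    have h4 : g x = ∑ i, g x i • (Pi.single i 1 : Fin n → Rᵐᵒᵖ) := by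
      funext j
      simp [Finset.sum_apply, Pi.single_apply]
    conv_rhs => rw [← h3, h4, map_sum]
    refine Finset.sum_congr rfl fun i _ => ?_
    rw [map_smul]
    rfl

end RightDual

/-- The right bialgebroid `A*` over `R`, for `A_R` finitely generated projective, with
`Δ(b) = ∑ ⟨b, a_i a_j⟩ · b_i ⊗ b_j` in terms of dual bases, and `ε(b) = ⟨b, 1⟩`. -/
def rightDual (h : 𝒜.RightFGP) : RightBialgebroidData R 𝒜.RightDual where
  s := RightDual.sHom
  t := RightDual.tHom
  comm := RightDual.s_comm_t
  comul :=
    let d := (RightDual.nonempty_dualBasis h).some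
    let P := rightBimod RightDual.sHom RightDual.tHom (RightDual.s_comm_t (𝒜 := 𝒜))
    AddMonoidHom.mk' (fun b => ∑ i, ∑ j, P.tmul (P.l (b.ev (d.a i * d.a j)) (d.b i)) (d.b j))
      fun b b' => by
        simp only [← Finset.sum_add_distrib]
        refine Finset.sum_congr rfl fun i _ => Finset.sum_congr rfl fun j _ => ?_
        rw [RightDual.ev_add, map_add, AddMonoidHom.add_apply, Bimod.tmul_add_left]
  counit := AddMonoidHom.mk' (fun b => b.ev 1) fun _ _ => rfl

/-- The pairing `b ⊗ b' ↦ ⟨b · ⟨b', a'⟩, a⟩` on `A* ⊗_R A*`. -/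
def rightDualPairing (h : 𝒜.RightFGP) (a a' : A) : (𝒜.rightDual h).bimod.T2 →+ R :=
  BalTensor.lift (fun b b' => ((𝒜.rightDual h).bimod.ρ (b'.ev a') b).ev a)
    (fun b b' c => by rw [map_add]; rfl)
    (fun b c c' => by rw [RightDual.ev_add, map_add]; rfl)
    (fun b r b' => by
      have : ((𝒜.rightDual h).bimod.l r b').ev a' = r * b'.ev a' := RightDual.ev_mul_tElt b' r a'
      rw [this, Bimod.ρ_mul])

/-- The comultiplication of `A*` satisfies `⟨b₁ · ⟨b₂, a'⟩, a⟩ = ⟨b, a a'⟩`. -/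
theorem rightDual_comul (h : 𝒜.RightFGP) (b : 𝒜.RightDual) (a a' : A) :
    𝒜.rightDualPairing h a a' ((𝒜.rightDual h).comul b) = b.ev (a * a') := by
  set d := (RightDual.nonempty_dualBasis h).some with hd
  have h1 : 𝒜.rightDualPairing h a a' ((𝒜.rightDual h).comul b) =
      ∑ i, ∑ j, ((d.b i * RightDual.tElt (b.ev (d.a i * d.a j))) *
        RightDual.sElt ((d.b j).ev a')).ev a := by
    have h0 : (𝒜.rightDual h).comul b = ∑ i, ∑ j, (𝒜.rightDual h).bimod.tmul
      ((𝒜.rightDual h).bimod.l (b.ev (d.a i * d.a j)) (d.b i)) (d.b j) := rfl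
    rw [h0, map_sum]
    refine Finset.sum_congr rfl fun i _ => ?_
    rw [map_sum]
    rfl
  rw [h1]
  simp only [RightDual.ev_mul_sElt, RightDual.ev_mul_tElt, ← RightDual.ev_t]
  simp only [← map_sum]
  congr 1
  rw [Finset.sum_comm]
  have h2 : ∀ j, ∑ i, 𝒜.t (op ((d.b i).ev (a * 𝒜.t (op ((d.b j).ev a'))))) * (d.a i * d.a j) =
      a * (𝒜.t (op ((d.b j).ev a')) * d.a j) := by
    intro j
    simp only [← mul_assoc, ← Finset.sum_mul]
    rw [d.sum_eq]
  simp only [h2, ← Finset.mul_sum]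
  rw [d.sum_eq]

end LeftBialgebroid

namespace LeftBialgebroid

open MulOpposite

variable {R A : Type*} [Ring R] [Ring A] (𝒜 : LeftBialgebroid R A)

/-! #### The left dual -/

/-- The left dual `*A = Hom(_R A, _R R)`. -/
def LeftDual : Type _ := 𝒜.LeftMod →ₗ[R] R

instance : AddCommGroup 𝒜.LeftDual := inferInstanceAs (AddCommGroup (𝒜.LeftMod →ₗ[R] R))

namespace LeftDual

variable {𝒜}

/-- The evaluation `[a, b]`. -/
def ev (b : 𝒜.LeftDual) : A →+ R :=
  LinearMap.toAddMonoidHom (show 𝒜.LeftMod →ₗ[R] R from b)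

theorem ev_s (b : 𝒜.LeftDual) (r : R) (a : A) : b.ev (𝒜.s r * a) = r * b.ev a :=
  LinearMap.map_smul (show 𝒜.LeftMod →ₗ[R] R from b) r a

/-- An additive map with `f(r · a) = r f(a)` is an element of `*A`. -/
def ofHom (f : A →+ R) (h : ∀ r a, f (𝒜.s r * a) = r * f a) : 𝒜.LeftDual :=
  { toFun := f
    map_add' := map_add f
    map_smul' := fun r a => h r a : 𝒜.LeftMod →ₗ[R] R }

@[simp] theorem ev_ofHom (f : A →+ R) (h) (a : A) : (ofHom (𝒜 := 𝒜) f h).ev a = f a := rfl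

@[simp] theorem ev_add (b b' : 𝒜.LeftDual) (a : A) : (b + b').ev a = b.ev a + b'.ev a := rfl

@[simp] theorem ev_zero (a : A) : (0 : 𝒜.LeftDual).ev a = 0 := rfl

theorem ext {b b' : 𝒜.LeftDual} (h : ∀ a, b.ev a = b'.ev a) : b = b' :=
  DFunLike.ext (F := 𝒜.LeftMod →ₗ[R] R) _ _ h

/-- The map `A ⊗_R A → A`, `a ⊗ a' ↦ a · [a', b]`. -/
def contract (b : 𝒜.LeftDual) : 𝒜.bimod.T2 →+ A :=
  BalTensor.lift (fun a a' => 𝒜.t (op (b.ev a')) * a)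
    (fun a a' c => by simp [mul_add])
    (fun a c c' => by simp [add_mul])
    (fun a r a' => by simp [ev_s, mul_assoc])

@[simp] theorem contract_tmul (b : 𝒜.LeftDual) (a a' : A) :
    b.contract (𝒜.bimod.tmul a a') = 𝒜.t (op (b.ev a')) * a := rfl

theorem contract_l2 (b : 𝒜.LeftDual) (r : R) (T : 𝒜.bimod.T2) :
    b.contract (𝒜.bimod.l2 r T) = 𝒜.s r * b.contract T := by
  have : b.contract.comp (𝒜.bimod.l2 r) = (AddMonoidHom.mulLeft (𝒜.s r)).comp b.contract :=
    BalTensor.hom_ext fun x y => by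
      change 𝒜.t (op (b.ev y)) * (𝒜.s r * x) = 𝒜.s r * (𝒜.t (op (b.ev y)) * x)
      rw [← mul_assoc, ← s_t, mul_assoc]
  exact DFunLike.congr_fun this T

theorem contract_mulT (b : 𝒜.LeftDual) (x : A) (T : 𝒜.bimod.T2) :
    b.contract (𝒜.mulT x 1 T) = b.contract T * x := by
  have : b.contract.comp (𝒜.mulT x 1) = (AddMonoidHom.mulRight x).comp b.contract :=
    BalTensor.hom_ext fun y z => by
      change 𝒜.t (op (b.ev (z * 1))) * (y * x) = 𝒜.t (op (b.ev z)) * y * x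
      rw [mul_one, mul_assoc]
  exact DFunLike.congr_fun this T

theorem contract_add (b b' : 𝒜.LeftDual) (T : 𝒜.bimod.T2) :
    (b + b').contract T = b.contract T + b'.contract T := by
  have : (b + b').contract = b.contract + b'.contract :=
    BalTensor.hom_ext fun y z => by
      change 𝒜.t (op ((b + b').ev z)) * y = 𝒜.t (op (b.ev z)) * y + 𝒜.t (op (b'.ev z)) * y
      rw [ev_add, op_add, map_add, add_mul]
  rw [this]; rfl

/-- The product `[a, b b'] = [a₁ · [a₂, b], b']`. -/
def mul (b b' : 𝒜.LeftDual) : 𝒜.LeftDual :=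
  ofHom ((b'.ev.comp b.contract).comp 𝒜.comul) fun r a => by
    simp [comul_s_mul, contract_l2, ev_s]

theorem ev_mul (b b' : 𝒜.LeftDual) (a : A) :
    (b.mul b').ev a = b'.ev (b.contract (𝒜.comul a)) := rfl

/-- The unit `ε`. -/
def one : 𝒜.LeftDual := ofHom 𝒜.counit fun r a => 𝒜.counit_s_mul r a

theorem ev_one (a : A) : (one : 𝒜.LeftDual).ev a = 𝒜.counit a := rfl

/-- The map `a ⊗ a' ⊗ a'' ↦ a · [a' · [a'', b], b']`. -/
def contract3 (b b' : 𝒜.LeftDual) : 𝒜.bimod.T3 →+ A :=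
  BalTensor.lift (fun a T => 𝒜.t (op (b'.ev (b.contract T))) * a)
    (fun a a' T => by rw [mul_add])
    (fun a T T' => by simp [add_mul])
    (fun a r T => by
      rw [contract_l2, ev_s, LeftBialgebroidData.bimod_ρ, op_mul, map_mul, mul_assoc])

theorem mul_assoc' (b b' b'' : 𝒜.LeftDual) : (b.mul b').mul b'' = b.mul (b'.mul b'') := by
  apply ext
  intro a
  rw [ev_mul, ev_mul, ev_mul]
  congr 1
  have hc := 𝒜.isLeftBialgebroid.coring.coassoc a
  have h1 : (contract3 b b').comp (𝒜.bimod.comulRight 𝒜.comul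
      𝒜.isLeftBialgebroid.coring.comul_l) = (b.mul b').contract := by
    refine BalTensor.hom_ext fun x y => ?_
    rfl
  have h2 : (contract3 b b').comp (𝒜.bimod.comulLeft 𝒜.comul
      𝒜.isLeftBialgebroid.coring.comul_ρ) = (b'.contract.comp 𝒜.comul).comp b.contract := by
    refine BalTensor.hom_ext fun x y => ?_
    change contract3 b b' (𝒜.bimod.appendR y (𝒜.comul x)) =
      b'.contract (𝒜.comul (𝒜.t (op (b.ev y)) * x))
    rw [comul_t_mul]
    have : (contract3 b b').comp (𝒜.bimod.appendR y) =
        b'.contract.comp (𝒜.bimod.ρ2 (b.ev y)) :=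
      BalTensor.hom_ext fun u v => rfl
    exact DFunLike.congr_fun this _
  have e1 := DFunLike.congr_fun h1 (𝒜.comul a)
  have e2 := DFunLike.congr_fun h2 (𝒜.comul a)
  exact e1.symm.trans ((congrArg (contract3 b b') hc).symm.trans e2)

theorem one_mul' (b : 𝒜.LeftDual) : one.mul b = b := by
  apply ext
  intro a
  rw [ev_mul]
  exact congrArg b.ev (𝒜.isLeftBialgebroid.coring.comul_counit a)

theorem mul_one' (b : 𝒜.LeftDual) : b.mul one = b := by
  apply ext
  intro a
  rw [ev_mul, ev_one]
  have : 𝒜.counit.comp b.contract =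
      b.ev.comp (𝒜.bimod.counitLeft 𝒜.counit 𝒜.isLeftBialgebroid.coring.counit_ρ) := by
    refine BalTensor.hom_ext fun x y => ?_
    change 𝒜.counit (𝒜.t (op (b.ev y)) * x) = b.ev (𝒜.s (𝒜.counit x) * y)
    rw [counit_t_mul, ev_s]
  exact (DFunLike.congr_fun this (𝒜.comul a)).trans
    (congrArg b.ev (𝒜.isLeftBialgebroid.coring.counit_comul a))

instance : Ring 𝒜.LeftDual :=
  { (inferInstance : AddCommGroup 𝒜.LeftDual) with
    mul := mul
    one := one
    mul_assoc := mul_assoc'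
    one_mul := one_mul'
    mul_one := mul_one'
    left_distrib := fun a b c => rfl
    right_distrib := fun a b c => ext fun x => by
      change c.ev ((a + b).contract (𝒜.comul x)) =
        c.ev (a.contract (𝒜.comul x)) + c.ev (b.contract (𝒜.comul x))
      rw [contract_add, map_add]
    zero_mul := fun b => ext fun x => by
      change b.ev ((0 : 𝒜.LeftDual).contract (𝒜.comul x)) = 0
      have : (0 : 𝒜.LeftDual).contract = 0 :=
        BalTensor.hom_ext fun y z => by
          change 𝒜.t (op ((0 : 𝒜.LeftDual).ev z)) * y = 0
          simp
      rw [this]; exact map_zero _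
    mul_zero := fun b => rfl }

theorem ev_mul_eq (b b' : 𝒜.LeftDual) (a : A) :
    (b * b').ev a = b'.ev (b.contract (𝒜.comul a)) := rfl

/-- `s(r) = 1 · r : a ↦ ε(a) r`. -/
def sElt (r : R) : 𝒜.LeftDual :=
  ofHom ((AddMonoidHom.mulRight r).comp 𝒜.counit) fun r' a => by
    simp [mul_assoc, counit_s_mul]

/-- `t(r) = r · 1 : a ↦ ε(a s(r))`. -/
def tElt (r : R) : 𝒜.LeftDual :=
  ofHom (𝒜.counit.comp (AddMonoidHom.mulRight (𝒜.s r))) fun r' a => by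
    simp [mul_assoc, counit_s_mul]

/-- The bimodule structure of `*A`: `[a, b · r] = [a, b] r`. -/
theorem ev_mul_sElt (b : 𝒜.LeftDual) (r : R) (a : A) :
    (b * sElt r).ev a = b.ev a * r :=
  congrArg (fun z => z.ev a * r) (mul_one' b)

/-- The bimodule structure of `*A`: `[a, r · b] = [a s(r), b]`. -/
theorem ev_mul_tElt (b : 𝒜.LeftDual) (r : R) (a : A) :
    (b * tElt r).ev a = b.ev (a * 𝒜.s r) := by
  have h : (b * tElt r).ev a = 𝒜.counit (b.contract (𝒜.comul a) * 𝒜.s r) := rfl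
  rw [h, ← contract_mulT, ← comul_mul_s]
  exact congrArg (fun z => z.ev (a * 𝒜.s r)) (mul_one' b)

/-- The source map of `*A`. -/
def sHom : R →+* 𝒜.LeftDual where
  toFun := sElt
  map_one' := ext fun a => mul_one _
  map_mul' r r' := ext fun a => by
    rw [ev_mul_sElt]
    exact (mul_assoc _ _ _).symm
  map_zero' := ext fun a => mul_zero _
  map_add' r r' := ext fun a => mul_add _ _ _

/-- The target map of `*A`. -/
def tHom : Rᵐᵒᵖ →+* 𝒜.LeftDual where
  toFun r := tElt (unop r)
  map_one' := ext fun a => by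
    change 𝒜.counit (a * 𝒜.s 1) = 𝒜.counit a
    simp
  map_mul' r r' := ext fun a => by
    rw [ev_mul_tElt]
    change 𝒜.counit (a * 𝒜.s (unop r' * unop r)) =
      𝒜.counit (a * 𝒜.s (unop r') * 𝒜.s (unop r))
    simp [mul_assoc]
  map_zero' := ext fun a => by
    change 𝒜.counit (a * 𝒜.s 0) = 0
    simp
  map_add' r r' := ext fun a => by
    change 𝒜.counit (a * 𝒜.s (unop r + unop r')) =
      𝒜.counit (a * 𝒜.s (unop r)) + 𝒜.counit (a * 𝒜.s (unop r'))
    simp [mul_add]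

theorem s_comm_t (r : R) (r' : Rᵐᵒᵖ) :
    (sHom r * tHom r' : 𝒜.LeftDual) = tHom r' * sHom r := by
  apply ext
  intro a
  exact (ev_mul_tElt (sHom r) (unop r') a).trans (ev_mul_sElt (tHom r') r a).symm

variable (𝒜) in
/-- Dual bases `{a_i}` of `_R A` and `{b_i}` of `*A_R`: `a = ∑ [a, b_i] · a_i`. -/
structure DualBasis where
  n : ℕ
  a : Fin n → A
  b : Fin n → 𝒜.LeftDual
  sum_eq : ∀ x, ∑ i, 𝒜.s ((b i).ev x) * a i = x

theorem nonempty_dualBasis (h : 𝒜.LeftFGP) : Nonempty (DualBasis 𝒜) := by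
  obtain ⟨h1, h2⟩ := h
  obtain ⟨n, f, hf⟩ := Module.Finite.exists_fin' R 𝒜.LeftMod
  obtain ⟨g, hg⟩ := Module.projective_lifting_property f LinearMap.id hf
  refine ⟨⟨n, fun i => f (Pi.single i 1), fun i => ofHom (𝒜 := 𝒜)
    (AddMonoidHom.mk' (fun a : A => g a i) fun a a' => by
      rw [show g (a + a' : A) = g a + g a' from map_add g a a']; rfl) ?_, ?_⟩⟩
  · intro r a
    exact congrFun (map_smul g r (show 𝒜.LeftMod from a)) i
  · intro x
    have h3 : f (g x) = x := DFunLike.congr_fun hg x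
    have h4 : g x = ∑ i, g x i • (Pi.single i 1 : Fin n → R) := by
      funext j
      simp [Finset.sum_apply, Pi.single_apply]
    conv_rhs => rw [← h3, h4, map_sum]
    refine Finset.sum_congr rfl fun i _ => ?_
    rw [map_smul]
    rfl

end LeftDual

/-- The right bialgebroid `*A` over `R`, for `_R A` finitely generated projective, with
`Δ(b) = ∑ b_i ⊗ b_j · [a_j a_i, b]` in terms of dual bases, and `ε(b) = [1, b]`. -/
def leftDual (h : 𝒜.LeftFGP) : RightBialgebroidData R 𝒜.LeftDual where
  s := LeftDual.sHom
  t := LeftDual.tHom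
  comm := LeftDual.s_comm_t
  comul :=
    let d := (LeftDual.nonempty_dualBasis h).some
    let P := rightBimod LeftDual.sHom LeftDual.tHom (LeftDual.s_comm_t (𝒜 := 𝒜))
    AddMonoidHom.mk' (fun b => ∑ i, ∑ j, P.tmul (d.b i) (P.ρ (b.ev (d.a j * d.a i)) (d.b j)))
      fun b b' => by
        simp only [← Finset.sum_add_distrib]
        refine Finset.sum_congr rfl fun i _ => Finset.sum_congr rfl fun j _ => ?_
        rw [LeftDual.ev_add, map_add, AddMonoidHom.add_apply, Bimod.tmul_add_right]
  counit := AddMonoidHom.mk' (fun b => b.ev 1) fun _ _ => rfl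

/-- The pairing `b ⊗ b' ↦ [a, [a', b] · b']` on `*A ⊗_R *A`. -/
def leftDualPairing (h : 𝒜.LeftFGP) (a a' : A) : (𝒜.leftDual h).bimod.T2 →+ R :=
  BalTensor.lift (fun b b' => ((𝒜.leftDual h).bimod.l (b.ev a') b').ev a)
    (fun b b' c => by rw [LeftDual.ev_add, map_add]; rfl)
    (fun b c c' => by rw [map_add]; rfl)
    (fun b r b' => by
      have : ((𝒜.leftDual h).bimod.ρ r b).ev a' = b.ev a' * r := LeftDual.ev_mul_sElt b r a'
      rw [this, Bimod.l_mul])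

/-- The comultiplication of `*A` satisfies `[a, [a', b₁] · b₂] = [a a', b]`. -/
theorem leftDual_comul (h : 𝒜.LeftFGP) (b : 𝒜.LeftDual) (a a' : A) :
    𝒜.leftDualPairing h a a' ((𝒜.leftDual h).comul b) = b.ev (a * a') := by
  set d := (LeftDual.nonempty_dualBasis h).some with hd
  have h1 : 𝒜.leftDualPairing h a a' ((𝒜.leftDual h).comul b) =
      ∑ i, ∑ j, ((d.b j * LeftDual.sElt (b.ev (d.a j * d.a i))) *
        LeftDual.tElt ((d.b i).ev a')).ev a := by
    have h0 : (𝒜.leftDual h).comul b = ∑ i, ∑ j, (𝒜.leftDual h).bimod.tmul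
      (d.b i) ((𝒜.leftDual h).bimod.ρ (b.ev (d.a j * d.a i)) (d.b j)) := rfl
    rw [h0, map_sum]
    refine Finset.sum_congr rfl fun i _ => ?_
    rw [map_sum]
    rfl
  rw [h1]
  simp only [LeftDual.ev_mul_sElt, LeftDual.ev_mul_tElt, ← LeftDual.ev_s]
  simp only [← map_sum]
  congr 1
  have h2 : ∀ i, ∑ j, 𝒜.s ((d.b j).ev (a * 𝒜.s ((d.b i).ev a'))) * (d.a j * d.a i) =
      a * (𝒜.s ((d.b i).ev a') * d.a i) := by
    intro j
    simp only [← mul_assoc, ← Finset.sum_mul]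
    rw [d.sum_eq]
  simp only [h2, ← Finset.mul_sum]
  rw [d.sum_eq]

end LeftBialgebroid

/-! ### Depth two ring extensions -/

section DepthTwo

open MulOpposite

variable {N M : Type*} [Ring N] [Ring M] (ι : N →+* M)

/-- The centralizer `R = C_M(N)`. -/
abbrev centralizerRing : Subring M := Subring.centralizer (Set.range ι)

theorem centralizerRing_comm (r : centralizerRing ι) (n : N) : (r : M) * ι n = ι n * r :=
  (Subring.mem_centralizer_iff.1 r.2 (ι n) ⟨n, rfl⟩).symm

/-- The tensor-square `M ⊗_N M`. -/
abbrev TensorSq : Type _ :=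
  BalTensor (fun n : N => AddMonoidHom.mulRight (ι n)) (fun n : N => AddMonoidHom.mulLeft (ι n))

namespace TensorSq

/-- `x ⊗ y` in `M ⊗_N M`. -/
abbrev tmul (x y : M) : TensorSq ι :=
  BalTensor.mk (fun n : N => AddMonoidHom.mulRight (ι n)) (fun n : N => AddMonoidHom.mulLeft (ι n))
    x y

theorem tmul_add_left (x x' y : M) : tmul ι (x + x') y = tmul ι x y + tmul ι x' y :=
  BalTensor.mk_add_left _ _ x x' y

theorem tmul_add_right (x y y' : M) : tmul ι x (y + y') = tmul ι x y + tmul ι x y' :=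
  BalTensor.mk_add_right _ _ x y y'

theorem tmul_bal (x : M) (n : N) (y : M) : tmul ι (x * ι n) y = tmul ι x (ι n * y) :=
  BalTensor.mk_bal (fun n : N => AddMonoidHom.mulRight (ι n))
    (fun n : N => AddMonoidHom.mulLeft (ι n)) x n y

/-- The `M`-`M`-bimodule structure of `M ⊗_N M`: `a · (x ⊗ y) · c = a x ⊗ y c`. -/
def act (a c : M) : TensorSq ι →+ TensorSq ι :=
  BalTensor.lift (fun x y => tmul ι (a * x) (y * c))
    (fun x x' y => by rw [mul_add, tmul_add_left])
    (fun x y y' => by rw [add_mul, tmul_add_right])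
    (fun x n y => by
      change tmul ι (a * (x * ι n)) (y * c) = tmul ι (a * x) (ι n * y * c)
      rw [← mul_assoc, tmul_bal, mul_assoc])

@[simp] theorem act_tmul (a c x y : M) : act ι a c (tmul ι x y) = tmul ι (a * x) (y * c) := rfl

theorem act_act (a c a' c' : M) (z : TensorSq ι) :
    act ι a c (act ι a' c' z) = act ι (a * a') (c' * c) z := by
  have : (act ι a c).comp (act ι a' c') = act ι (a * a') (c' * c) :=
    BalTensor.hom_ext fun x y => by
      change tmul ι (a * (a' * x)) (y * c' * c) = tmul ι (a * a' * x) (y * (c' * c))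
      rw [mul_assoc, mul_assoc]
  exact DFunLike.congr_fun this z

theorem act_one_one (z : TensorSq ι) : act ι 1 1 z = z := by
  have : act ι 1 1 = AddMonoidHom.id _ :=
    BalTensor.hom_ext fun x y => by
      change tmul ι (1 * x) (y * 1) = tmul ι x y
      rw [one_mul, mul_one]
  exact DFunLike.congr_fun this z

theorem act_add_left (a a' c : M) (z : TensorSq ι) :
    act ι (a + a') c z = act ι a c z + act ι a' c z := by
  have : act ι (a + a') c = act ι a c + act ι a' c :=
    BalTensor.hom_ext fun x y => by
      change tmul ι ((a + a') * x) (y * c) = tmul ι (a * x) (y * c) + tmul ι (a' * x) (y * c)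
      rw [add_mul, tmul_add_left]
  rw [this]; rfl

theorem act_add_right (a c c' : M) (z : TensorSq ι) :
    act ι a (c + c') z = act ι a c z + act ι a c' z := by
  have : act ι a (c + c') = act ι a c + act ι a c' :=
    BalTensor.hom_ext fun x y => by
      change tmul ι (a * x) (y * (c + c')) = tmul ι (a * x) (y * c) + tmul ι (a * x) (y * c')
      rw [mul_add, tmul_add_right]
  rw [this]; rfl

end TensorSq

open TensorSq

/-- `M | N` is left D2: as an `N`-`M`-bimodule, `M ⊗_N M` is isomorphic to a direct summand of
`M ⊕ ⋯ ⊕ M` (`n` summands), i.e. there are bimodule maps `σ` and `π` between them with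
`π ∘ σ = id`. -/
def IsLeftD2 : Prop :=
  ∃ n : ℕ, 0 < n ∧ ∃ (σ : TensorSq ι →+ (Fin n → M)) (π : (Fin n → M) →+ TensorSq ι),
    (∀ (a : N) (m : M) (z : TensorSq ι), σ (act ι (ι a) m z) = fun i => ι a * σ z i * m) ∧
    (∀ (a : N) (m : M) (v : Fin n → M), π (fun i => ι a * v i * m) = act ι (ι a) m (π v)) ∧
    ∀ z, π (σ z) = z

/-- `M | N` is right D2: as an `M`-`N`-bimodule, `M ⊗_N M` is isomorphic to a direct summand of
`M ⊕ ⋯ ⊕ M`. -/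
def IsRightD2 : Prop :=
  ∃ n : ℕ, 0 < n ∧ ∃ (σ : TensorSq ι →+ (Fin n → M)) (π : (Fin n → M) →+ TensorSq ι),
    (∀ (m : M) (a : N) (z : TensorSq ι), σ (act ι m (ι a) z) = fun i => m * σ z i * ι a) ∧
    (∀ (m : M) (a : N) (v : Fin n → M), π (fun i => m * v i * ι a) = act ι m (ι a) (π v)) ∧
    ∀ z, π (σ z) = z

/-- `M | N` is D2. -/
def IsD2 : Prop := IsLeftD2 ι ∧ IsRightD2 ι

/-- The ring `End(_N M_N)`, as a ring of additive endomorphisms of `M`. -/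
def bimodEnd : Subring (AddMonoid.End M) where
  carrier := {f | (∀ n m, f (ι n * m) = ι n * f m) ∧ ∀ n m, f (m * ι n) = f m * ι n}
  zero_mem' := ⟨fun n m => (mul_zero _).symm, fun n m => (zero_mul _).symm⟩
  one_mem' := ⟨fun n m => rfl, fun n m => rfl⟩
  add_mem' {f g} hf hg :=
    ⟨fun n m => by
      change f (ι n * m) + g (ι n * m) = ι n * (f m + g m)
      rw [hf.1, hg.1, mul_add],
     fun n m => by
      change f (m * ι n) + g (m * ι n) = (f m + g m) * ι n
      rw [hf.2, hg.2, add_mul]⟩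
  neg_mem' {f} hf :=
    ⟨fun n m => by
      change -f (ι n * m) = ι n * -f m
      rw [hf.1, mul_neg],
     fun n m => by
      change -f (m * ι n) = -f m * ι n
      rw [hf.2, neg_mul]⟩
  mul_mem' {f g} hf hg :=
    ⟨fun n m => by
      change f (g (ι n * m)) = ι n * f (g m)
      rw [hg.1, hf.1],
     fun n m => by
      change f (g (m * ι n)) = f (g m) * ι n
      rw [hg.2, hf.2]⟩

/-- The ring `A = End(_N M_N)`. -/
def StepA : Type _ := bimodEnd ι

instance : Ring (StepA ι) := inferInstanceAs (Ring (bimodEnd ι))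

namespace StepA

variable {ι}

/-- The value `α(m)`. -/
def ev (α : StepA ι) : M →+ M := (α.1 : AddMonoid.End M)

theorem ev_l (α : StepA ι) (n : N) (m : M) : α.ev (ι n * m) = ι n * α.ev m := α.2.1 n m

theorem ev_r (α : StepA ι) (n : N) (m : M) : α.ev (m * ι n) = α.ev m * ι n := α.2.2 n m

theorem ext {α β : StepA ι} (h : ∀ m, α.ev m = β.ev m) : α = β :=
  Subtype.ext (DFunLike.ext (F := M →+ M) _ _ h)

variable (ι)

/-- `s_A(r) = λ(r) : m ↦ r m`. -/
def sHom : centralizerRing ι →+* StepA ι where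
  toFun r := ⟨AddMonoidHom.mulLeft (r : M),
    fun n m => by
      change (r : M) * (ι n * m) = ι n * (r * m)
      rw [← mul_assoc, centralizerRing_comm, mul_assoc],
    fun n m => (mul_assoc _ _ _).symm⟩
  map_one' := ext fun m => one_mul m
  map_mul' r r' := ext fun m => mul_assoc _ _ _
  map_zero' := ext fun m => zero_mul m
  map_add' r r' := ext fun m => add_mul _ _ _

/-- `t_A(r) = ρ(r) : m ↦ m r`. -/
def tHom : (centralizerRing ι)ᵐᵒᵖ →+* StepA ι where
  toFun r := ⟨AddMonoidHom.mulRight ((unop r : centralizerRing ι) : M),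
    fun n m => mul_assoc _ _ _,
    fun n m => by
      change m * ι n * ((unop r : centralizerRing ι) : M) = m * ((unop r : centralizerRing ι) : M) * ι n
      rw [mul_assoc, ← centralizerRing_comm, mul_assoc]⟩
  map_one' := ext fun m => mul_one m
  map_mul' r r' := ext fun m => (mul_assoc m ((unop r' : centralizerRing ι) : M) ((unop r : centralizerRing ι) : M)).symm
  map_zero' := ext fun m => mul_zero m
  map_add' r r' := ext fun m => mul_add _ _ _

theorem s_comm_t (r : centralizerRing ι) (r' : (centralizerRing ι)ᵐᵒᵖ) :
    sHom ι r * tHom ι r' = tHom ι r' * sHom ι r :=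
  ext fun m => (mul_assoc (r : M) m ((unop r' : centralizerRing ι) : M)).symm

/-- `ε_A(α) = α(1)`. -/
def counit : StepA ι →+ centralizerRing ι :=
  AddMonoidHom.mk' (fun α => ⟨α.ev 1, Subring.mem_centralizer_iff.2 (by
    rintro _ ⟨n, rfl⟩
    rw [← ev_l, ← ev_r, one_mul, mul_one])⟩) fun α β => rfl

end StepA

/-- The centralizer `(M ⊗_N M)^N`. -/
def tensorCentralizer : AddSubgroup (TensorSq ι) where
  carrier := {b | ∀ n, act ι (ι n) 1 b = act ι 1 (ι n) b}
  zero_mem' n := by rw [map_zero, map_zero]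
  add_mem' {a b} ha hb n := by rw [map_add, map_add, ha n, hb n]
  neg_mem' {a} ha n := by rw [map_neg, map_neg, ha n]

/-- The underlying additive group of `B = (M ⊗_N M)^N`. -/
def StepB : Type _ := tensorCentralizer ι

instance : AddCommGroup (StepB ι) := inferInstanceAs (AddCommGroup (tensorCentralizer ι))

namespace StepB

variable {ι}

/-- The inclusion of `B` in `M ⊗_N M`. -/
def val : StepB ι →+ TensorSq ι := (tensorCentralizer ι).subtype

theorem ext {b b' : StepB ι} (h : b.val = b'.val) : b = b' := Subtype.ext h

theorem act_val (b : StepB ι) (n : N) : act ι (ι n) 1 b.val = act ι 1 (ι n) b.val := b.2 n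

/-- An element of `M ⊗_N M` centralized by `N`, as an element of `B`. -/
def ofMem (z : TensorSq ι) (h : ∀ n, act ι (ι n) 1 z = act ι 1 (ι n) z) : StepB ι := ⟨z, h⟩

@[simp] theorem val_ofMem (z : TensorSq ι) (h) : (ofMem z h).val = z := rfl

/-- The map `M ⊗_N M → M ⊗_N M`, `x ⊗ y ↦ x b¹ ⊗ b² y`, for `b` in `B`. -/
def leftMul (b : StepB ι) : TensorSq ι →+ TensorSq ι :=
  BalTensor.lift (fun x y => act ι x y b.val)
    (fun x x' y => act_add_left ι x x' y b.val)
    (fun x y y' => act_add_right ι x y y' b.val)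
    (fun x n y => by
      have := congrArg (act ι x y) (b.act_val n)
      rw [act_act, act_act, one_mul, mul_one] at this
      exact this)

theorem leftMul_tmul (b : StepB ι) (x y : M) : leftMul b (tmul ι x y) = act ι x y b.val := rfl

theorem leftMul_act (b : StepB ι) (x y : M) (z : TensorSq ι) :
    leftMul b (act ι x y z) = act ι x y (leftMul b z) := by
  have : (leftMul b).comp (act ι x y) = (act ι x y).comp (leftMul b) :=
    BalTensor.hom_ext fun u v => (act_act ι x y u v b.val).symm
  exact DFunLike.congr_fun this z

/-- The product `b b' = b'¹ b¹ ⊗ b² b'²`. -/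
def mul (b b' : StepB ι) : StepB ι :=
  ofMem (leftMul b b'.val) fun n => by rw [← leftMul_act, ← leftMul_act, b'.act_val n]

theorem coe_mul (b b' : StepB ι) : (mul b b').val = leftMul b b'.val := rfl

theorem leftMul_mul (b b' : StepB ι) (z : TensorSq ι) :
    leftMul (mul b b') z = leftMul b (leftMul b' z) := by
  have : leftMul (mul b b') = (leftMul b).comp (leftMul b') :=
    BalTensor.hom_ext fun x y => (leftMul_act b x y b'.val).symm
  exact DFunLike.congr_fun this z

theorem leftMul_add (b b' : StepB ι) (z : TensorSq ι) :
    leftMul (b + b') z = leftMul b z + leftMul b' z := by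
  have : leftMul (b + b') = leftMul b + leftMul b' :=
    BalTensor.hom_ext fun x y => map_add (act ι x y) b.val b'.val
  rw [this]; rfl

theorem leftMul_zero (z : TensorSq ι) : leftMul (0 : StepB ι) z = 0 := by
  have : leftMul (0 : StepB ι) = 0 :=
    BalTensor.hom_ext fun x y => map_zero (act ι x y)
  rw [this]; rfl

/-- `x ⊗ y` as an element of `B`, for `x`, `y` in the centralizer of `N`. -/
def ofCentralizer (x y : centralizerRing ι) : StepB ι :=
  ofMem (tmul ι x y) fun n => by
    rw [act_tmul, act_tmul, mul_one, one_mul, ← centralizerRing_comm, tmul_bal,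
      centralizerRing_comm]

/-- The ring structure of `B`, with unit `1 ⊗ 1`. -/
instance : Ring (StepB ι) :=
  { (inferInstance : AddCommGroup (StepB ι)) with
    mul := mul
    one := ofCentralizer 1 1
    mul_assoc := fun a b c => ext (leftMul_mul a b c.val)
    one_mul := fun b => ext (by
      have : leftMul (ofCentralizer (1 : centralizerRing ι) 1) = AddMonoidHom.id _ :=
        BalTensor.hom_ext fun x y => by
          change tmul ι (x * 1) (1 * y) = tmul ι x y
          rw [mul_one, one_mul]
      exact DFunLike.congr_fun this b.val)
    mul_one := fun b => ext (act_one_one ι b.val)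
    left_distrib := fun a b c => ext (map_add (leftMul a) b.val c.val)
    right_distrib := fun a b c => ext (leftMul_add a b c.val)
    zero_mul := fun b => ext (leftMul_zero b.val)
    mul_zero := fun b => ext (map_zero (leftMul b)) }

variable (ι)

/-- `s_B(r) = 1 ⊗ r`. -/
def sHom : centralizerRing ι →+* StepB ι where
  toFun r := ofCentralizer 1 r
  map_one' := rfl
  map_mul' r r' := ext (by
    change tmul ι 1 (r * r' : M) = tmul ι (1 * 1) (r * r' : M)
    rw [mul_one])
  map_zero' := ext (by
    have := tmul_add_right ι 1 0 0
    rw [add_zero] at this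
    exact left_eq_add.1 this)
  map_add' r r' := ext (tmul_add_right ι 1 (r : M) r')

/-- `t_B(r) = r ⊗ 1`. -/
def tHom : (centralizerRing ι)ᵐᵒᵖ →+* StepB ι where
  toFun r := ofCentralizer (unop r) 1
  map_one' := rfl
  map_mul' r r' := ext (by
    change tmul ι ((unop r' * unop r : centralizerRing ι) : M) 1 = tmul ι ((unop r' * unop r : centralizerRing ι) : M) (1 * 1)
    rw [mul_one])
  map_zero' := ext (by
    have := tmul_add_left ι 0 0 1
    rw [add_zero] at this
    exact left_eq_add.1 this)
  map_add' r r' := ext (tmul_add_left ι ((unop r : centralizerRing ι) : M) ((unop r' : centralizerRing ι) : M) 1)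

theorem s_comm_t (r : centralizerRing ι) (r' : (centralizerRing ι)ᵐᵒᵖ) :
    sHom ι r * tHom ι r' = tHom ι r' * sHom ι r :=
  ext (by
    change tmul ι (((unop r' : centralizerRing ι) : M) * 1) ((r : M) * 1) = tmul ι (1 * ((unop r' : centralizerRing ι) : M)) (1 * (r : M))
    simp only [mul_one, one_mul])

/-- The multiplication map `μ : M ⊗_N M → M`. -/
def mulMap : TensorSq ι →+ M :=
  BalTensor.lift (fun x y => x * y) add_mul mul_add fun x n y => mul_assoc x (ι n) y

theorem mulMap_act (a c : M) (z : TensorSq ι) : mulMap ι (act ι a c z) = a * mulMap ι z * c := by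
  have : (mulMap ι).comp (act ι a c) =
      (AddMonoidHom.mulRight c).comp ((AddMonoidHom.mulLeft a).comp (mulMap ι)) :=
    BalTensor.hom_ext fun x y => by
      change a * x * (y * c) = a * (x * y) * c
      simp only [mul_assoc]
  exact DFunLike.congr_fun this z

/-- `ε_B(b) = b¹ b²`. -/
def counit : StepB ι →+ centralizerRing ι :=
  AddMonoidHom.mk' (fun b => ⟨mulMap ι b.val, Subring.mem_centralizer_iff.2 (by
    rintro _ ⟨n, rfl⟩
    have := congrArg (mulMap ι) (b.act_val n)
    rw [mulMap_act, mulMap_act, mul_one, one_mul] at this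
    exact this)⟩) fun b b' => Subtype.ext (map_add (mulMap ι) b.val b'.val)

end StepB

/-- The map `M ⊗_N M → M`, `x ⊗ y ↦ x α(y)`. -/
def pairR (α : StepA ι) : TensorSq ι →+ M :=
  BalTensor.lift (fun x y => x * α.ev y)
    (fun x x' y => add_mul x x' _)
    (fun x y y' => by rw [map_add, mul_add])
    (fun x n y => by
      change x * ι n * α.ev y = x * α.ev (ι n * y)
      rw [StepA.ev_l, mul_assoc])

/-- The map `M ⊗_N M → M`, `x ⊗ y ↦ α(x) y`. -/
def pairL (α : StepA ι) : TensorSq ι →+ M :=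
  BalTensor.lift (fun x y => α.ev x * y)
    (fun x x' y => by rw [map_add, add_mul])
    (fun x y y' => mul_add _ y y')
    (fun x n y => by
      change α.ev (x * ι n) * y = α.ev x * (ι n * y)
      rw [StepA.ev_r, mul_assoc])

/-- The map `α ⊗ id : M ⊗_N M → M ⊗_N M`. -/
def mapFst (α : StepA ι) : TensorSq ι →+ TensorSq ι :=
  BalTensor.lift (fun x y => tmul ι (α.ev x) y)
    (fun x x' y => by rw [map_add, tmul_add_left])
    (fun x y y' => tmul_add_right ι _ y y')
    (fun x n y => by
      change tmul ι (α.ev (x * ι n)) y = tmul ι (α.ev x) (ι n * y)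
      rw [StepA.ev_r, tmul_bal])

theorem mapFst_act (α : StepA ι) (n : N) (m : M) (z : TensorSq ι) :
    mapFst ι α (act ι (ι n) m z) = act ι (ι n) m (mapFst ι α z) := by
  have : (mapFst ι α).comp (act ι (ι n) m) = (act ι (ι n) m).comp (mapFst ι α) :=
    BalTensor.hom_ext fun x y => by
      change tmul ι (α.ev (ι n * x)) (y * m) = tmul ι (ι n * α.ev x) (y * m)
      rw [StepA.ev_l]
  exact DFunLike.congr_fun this z

/-- `α ⊗ id` as a map `B → B`, `b ↦ α(b¹) ⊗ b²`. -/
def mapFstB (α : StepA ι) : StepB ι →+ StepB ι :=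
  AddMonoidHom.mk' (fun b => StepB.ofMem (mapFst ι α b.val) fun n => by
      have h1 := mapFst_act ι α n 1 b.val
      have h2 := mapFst_act ι α 1 (ι n) b.val
      rw [map_one] at h2
      rw [← h1, ← h2, b.act_val n])
    fun b b' => StepB.ext (map_add (mapFst ι α) b.val b'.val)

/-- The map `A → A`, `α ↦ c¹ α(c² -)`, for `c` in `B`. -/
def convB (c : StepB ι) : StepA ι →+ StepA ι :=
  AddMonoidHom.mk' (fun α =>
    ⟨AddMonoidHom.mk' (fun m => pairR ι α (act ι 1 m c.val))
        (fun m m' => by rw [act_add_right, map_add]),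
      fun n m => by
        change pairR ι α (act ι 1 (ι n * m) c.val) = ι n * pairR ι α (act ι 1 m c.val)
        have h1 : act ι 1 (ι n * m) c.val = act ι (ι n) 1 (act ι 1 m c.val) := by
          have := congrArg (act ι 1 m) (c.act_val n)
          rw [act_act, act_act, one_mul, one_mul, one_mul] at this
          rw [act_act, mul_one, mul_one, ← this]
        rw [h1]
        have h2 : (pairR ι α).comp (act ι (ι n) 1) =
            (AddMonoidHom.mulLeft (ι n)).comp (pairR ι α) :=
          BalTensor.hom_ext fun x y => by
            change ι n * x * α.ev (y * 1) = ι n * (x * α.ev y)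
            rw [mul_one, mul_assoc]
        exact DFunLike.congr_fun h2 _,
      fun n m => by
        change pairR ι α (act ι 1 (m * ι n) c.val) = pairR ι α (act ι 1 m c.val) * ι n
        have h2 : (pairR ι α).comp (act ι 1 (m * ι n)) =
            (AddMonoidHom.mulRight (ι n)).comp ((pairR ι α).comp (act ι 1 m)) :=
          BalTensor.hom_ext fun x y => by
            change 1 * x * α.ev (y * (m * ι n)) = 1 * x * α.ev (y * m) * ι n
            rw [← mul_assoc y, StepA.ev_r, mul_assoc (1 * x)]
        exact DFunLike.congr_fun h2 _⟩)
    fun α β => StepA.ext fun m => by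
      have : pairR ι (α + β) = pairR ι α + pairR ι β :=
        BalTensor.hom_ext fun x y => mul_add x (α.ev y) (β.ev y)
      exact DFunLike.congr_fun this (act ι 1 m c.val)

/-- A left D2 quasibasis: `∑ b_i¹ ⊗ b_i² β_i(m) = m ⊗ 1`. -/
structure LeftQuasibasis where
  n : ℕ
  b : Fin n → StepB ι
  β : Fin n → StepA ι
  sum_eq : ∀ m, ∑ i, act ι 1 ((β i).ev m) (b i).val = tmul ι m 1

/-- A right D2 quasibasis: `∑ γ_i(m) c_i¹ ⊗ c_i² = 1 ⊗ m`. -/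
structure RightQuasibasis where
  n : ℕ
  c : Fin n → StepB ι
  γ : Fin n → StepA ι
  sum_eq : ∀ m, ∑ i, act ι ((γ i).ev m) 1 (c i).val = tmul ι 1 m

variable {ι}

theorem IsLeftD2.nonempty_quasibasis (h : IsLeftD2 ι) : Nonempty (LeftQuasibasis ι) := by
  obtain ⟨n, -, σ, π, hσ, hπ, hπσ⟩ := h
  have key : ∀ (a : N) (m : M) (i : Fin n),
      act ι (ι a) m (π (Pi.single i 1)) = π (Pi.single i (ι a * m)) := by
    intro a m i
    rw [← hπ]
    congr 1
    funext j
    rcases eq_or_ne j i with rfl | hj <;> simp [*]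
  refine ⟨⟨n, fun i => ⟨π (Pi.single i 1), fun a => ?_⟩, fun i =>
    ⟨AddMonoidHom.mk' (fun m => σ (tmul ι m 1) i) fun m m' => by
      rw [tmul_add_left, map_add]; rfl, fun a m => ?_, fun a m => ?_⟩, fun m => ?_⟩⟩
  · have h1 := key a 1 i
    have h2 := key 1 (ι a) i
    rw [map_one] at h2
    rw [h1, h2, mul_one, one_mul]
  · have := congrFun (hσ a 1 (tmul ι m 1)) i
    rw [act_tmul, mul_one, mul_one] at this
    exact this
  · have := congrFun (hσ 1 (ι a) (tmul ι m 1)) i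
    rw [map_one, act_tmul, one_mul, one_mul, one_mul] at this
    change σ (tmul ι (m * ι a) 1) i = _
    rw [tmul_bal, mul_one]
    exact this
  · have h0 : tmul ι m 1 = π (∑ i, Pi.single i (σ (tmul ι m 1) i)) := by
      rw [Finset.univ_sum_single, hπσ]
    refine Eq.trans ?_ h0.symm
    rw [map_sum]
    refine Finset.sum_congr rfl fun i _ => ?_
    have := key 1 (σ (tmul ι m 1) i) i
    rw [map_one, one_mul] at this
    exact this

theorem IsRightD2.nonempty_quasibasis (h : IsRightD2 ι) : Nonempty (RightQuasibasis ι) := by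
  obtain ⟨n, -, σ, π, hσ, hπ, hπσ⟩ := h
  have key : ∀ (m : M) (a : N) (i : Fin n),
      act ι m (ι a) (π (Pi.single i 1)) = π (Pi.single i (m * ι a)) := by
    intro a m i
    rw [← hπ]
    congr 1
    funext j
    rcases eq_or_ne j i with rfl | hj <;> simp [*]
  refine ⟨⟨n, fun i => ⟨π (Pi.single i 1), fun a => ?_⟩, fun i =>
    ⟨AddMonoidHom.mk' (fun m => σ (tmul ι 1 m) i) fun m m' => by
      rw [tmul_add_right, map_add]; rfl, fun a m => ?_, fun a m => ?_⟩, fun m => ?_⟩⟩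
  · have h1 := key 1 a i
    have h2 := key (ι a) 1 i
    rw [map_one] at h2
    rw [h1, h2, mul_one, one_mul]
  · have := congrFun (hσ (ι a) 1 (tmul ι 1 m)) i
    rw [map_one, act_tmul, mul_one, mul_one, mul_one] at this
    change σ (tmul ι 1 (ι a * m)) i = _
    rw [← tmul_bal, one_mul]
    exact this
  · have := congrFun (hσ 1 a (tmul ι 1 m)) i
    rw [act_tmul, one_mul, one_mul] at this
    exact this
  · have h0 : tmul ι 1 m = π (∑ i, Pi.single i (σ (tmul ι 1 m) i)) := by
      rw [Finset.univ_sum_single, hπσ]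
    refine Eq.trans ?_ h0.symm
    rw [map_sum]
    refine Finset.sum_congr rfl fun i _ => ?_
    have := key (σ (tmul ι 1 m) i) 1 i
    rw [map_one, mul_one] at this
    exact this

/-- The left bialgebroid data on `A = End(_N M_N)` over `R = C_M(N)`:
`s_A(r) = λ(r)`, `t_A(r) = ρ(r)`, `Δ_A(α) = ∑ γ_i ⊗ c_i¹ α(c_i² -)` for a right D2 quasibasis, and
`ε_A(α) = α(1)`. -/
def bialgebroidA (h : IsD2 ι) : LeftBialgebroidData (centralizerRing ι) (StepA ι) where
  s := StepA.sHom ι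
  t := StepA.tHom ι
  comm := StepA.s_comm_t ι
  comul :=
    let q := h.2.nonempty_quasibasis.some
    let P := leftBimod (StepA.sHom ι) (StepA.tHom ι) (StepA.s_comm_t ι)
    AddMonoidHom.mk' (fun α => ∑ i, P.tmul (q.γ i) (convB ι (q.c i) α)) fun α β => by
      simp only [map_add, Bimod.tmul_add_right, Finset.sum_add_distrib]
  counit := StepA.counit ι

/-- The right bialgebroid data on `B = (M ⊗_N M)^N` over `R = C_M(N)`:
`s_B(r) = 1 ⊗ r`, `t_B(r) = r ⊗ 1`, `Δ_B(b) = ∑ b_i ⊗ (β_i(b¹) ⊗ b²)` for a left D2 quasibasis, and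
`ε_B(b) = b¹ b²`. -/
def bialgebroidB (h : IsD2 ι) : RightBialgebroidData (centralizerRing ι) (StepB ι) where
  s := StepB.sHom ι
  t := StepB.tHom ι
  comm := StepB.s_comm_t ι
  comul :=
    let q := h.1.nonempty_quasibasis.some
    let P := rightBimod (StepB.sHom ι) (StepB.tHom ι) (StepB.s_comm_t ι)
    AddMonoidHom.mk' (fun b => ∑ i, P.tmul (q.b i) (mapFstB ι (q.β i) b)) fun b b' => by
      simp only [map_add, Bimod.tmul_add_right, Finset.sum_add_distrib]
  counit := StepB.counit ι

end DepthTwo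

/-- A left bialgebroid `A` and a right bialgebroid `B` over `R` are dual bialgebroids: `A` has both
a right and a left dual, both are right bialgebroids, and both are isomorphic to `B`. -/
def AreDual {R A B : Type*} [Ring R] [Ring A] [Ring B] (𝒜 : LeftBialgebroid R A)
    (ℬ : RightBialgebroid R B) : Prop :=
  ∃ (hr : 𝒜.RightFGP) (hl : 𝒜.LeftFGP)
    (hr' : (𝒜.rightDual hr).IsRightBialgebroid) (hl' : (𝒜.leftDual hl).IsRightBialgebroid),
    ℬ.Isomorphic ⟨𝒜.rightDual hr, hr'⟩ ∧ ℬ.Isomorphic ⟨𝒜.leftDual hl, hl'⟩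

end Bialgd

end

open scoped TensorProduct

noncomputable section

namespace Bialgd

open MulOpposite TensorSq

/-! ### Dual bases and tensor products -/

namespace BalTensor

section

variable {S X Y κ : Type*} [AddCommGroup X] [AddCommGroup Y] (ρ : S → X →+ X) (l : S → Y →+ Y)

/-! Depth two is used only through the two quasibases, and these are dual bases. Applying `z ↦ z¹
α(z²)` to `∑ γ_i(m) c_i = 1 ⊗ m` gives `α = ∑ γ_i · ⟨c_i, α⟩` with `⟨b, α⟩ = b¹ α(b²)`. Applying `z
↦ α(z¹) z²` to `∑ b_i β_i(m) = m ⊗ 1` gives `α = ∑ [α, b_i] · β_i` with `[α, b] = α(b¹) b²`. Hence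
`A_R` and `_R A` are finitely generated projective. The same identities expand elements of `B`: `b =
∑ ⟨b, γ_i⟩ · c_i` and `b = ∑ b_i · [β_i, b]`. Together these expansions make `η` and `ψ` bijective.

Dual bases also make equality in tensor products over `R` decidable by evaluation: if `X_R` has a
finite dual basis, an element of `X ⊗_R Y` is determined by its slices in `Y`
(`BalTensor.ext_slice`). Two concrete models follow. An element of `A ⊗_R A` is determined by the
function sending `(x, y)` to `α(x) β(y)` on pure tensors (`ext_evalTwo`), and `Δ_A(α)` becomes `(x,
y) ↦ α(x y)` (`evalTwo_comul`). Coassociativity is then associativity of `M`, and the remaining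
axioms of `A` are equally short. The map `b ⊗ b' ↦ b¹ ⊗ b² b'¹ ⊗ b'²` embeds `B ⊗_R B` in `M ⊗_N M
⊗_N M` (`toCube_injective`), and `Δ_B(b)` becomes `b¹ ⊗ 1 ⊗ b²` (`toCube_comul`). The axioms of `B`
are checked there. In both models the coproduct no longer mentions the quasibasis.

Multiplicativity of `η` and `ψ` comes from contracting `Δ_A(α)` against `b`, which yields `m ↦ b¹
α(b² m)` and `m ↦ α(m b¹) b²` respectively. For the coproducts, evaluation on pairs from `A`
separates the points of `A* ⊗_R A*` and `*A ⊗_R *A`. On the images of `B ⊗_R B` this evaluation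
factors through the tensor cube, and on `b¹ ⊗ 1 ⊗ b²` it returns the pairing of `b` with a composite
`αβ`, which is the defining property of the dual coproduct. The bialgebroid axioms for the two duals
are not checked directly: they are transported from `B` along `η` and `ψ`. -/

theorem mk_zero_left (y : Y) : mk ρ l 0 y = 0 :=
  map_zero (AddMonoidHom.mk' (fun x => mk ρ l x y) fun a b => mk_add_left ρ l a b y)

theorem mk_zero_right (x : X) : mk ρ l x 0 = 0 :=
  map_zero (AddMonoidHom.mk' (mk ρ l x) (mk_add_right ρ l x))

theorem mk_sum_left (s : Finset κ) (f : κ → X) (y : Y) :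
    mk ρ l (∑ i ∈ s, f i) y = ∑ i ∈ s, mk ρ l (f i) y :=
  map_sum (AddMonoidHom.mk' (fun x => mk ρ l x y) fun a b => mk_add_left ρ l a b y) f s

theorem mk_sum_right (s : Finset κ) (x : X) (f : κ → Y) :
    mk ρ l x (∑ i ∈ s, f i) = ∑ i ∈ s, mk ρ l x (f i) :=
  map_sum (AddMonoidHom.mk' (mk ρ l x) (mk_add_right ρ l x)) f s

end

variable {R X Y : Type*} [Ring R] [AddCommGroup X] [AddCommGroup Y] {ρ : R → X →+ X}
  {l : R → Y →+ Y} (hadd : ∀ r r' y, l (r + r') y = l r y + l r' y)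
  (hmul : ∀ r r' y, l (r * r') y = l r (l r' y))

/-- The map `f ⊗ id : X ⊗_R Y → R ⊗_R Y = Y` for a right `R`-linear `f : X → R`. -/
def slice (f : X →+ R) (hf : ∀ r x, f (ρ r x) = f x * r) : BalTensor ρ l →+ Y :=
  lift (fun x y => l (f x) y)
    (fun x x' y => by rw [map_add, hadd])
    (fun x y y' => map_add _ y y')
    (fun x s y => by rw [hf, hmul])

@[simp] theorem slice_mk (f : X →+ R) (hf : ∀ r x, f (ρ r x) = f x * r) (x : X) (y : Y) :
    slice hadd hmul f hf (mk ρ l x y) = l (f x) y := rfl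

/-- By additivity one may take `T = u ⊗ v`. Expanding `u` in the dual basis of `X` and moving the
coefficients `f_i(u)` across the tensor sign gives `∑ x_i ⊗ f_i(u) · v`. -/
theorem eq_sum_slice {n : ℕ} (x : Fin n → X) (f : Fin n → X →+ R)
    (hf : ∀ i r x, f i (ρ r x) = f i x * r) (hx : ∀ z, ∑ i, ρ (f i z) (x i) = z)
    (T : BalTensor ρ l) : ∑ i, mk ρ l (x i) (slice hadd hmul (f i) (hf i) T) = T := by
  induction T using induction_on with
  | zero => exact Finset.sum_eq_zero fun i _ => by rw [map_zero, mk_zero_right]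
  | tmul u v =>
    conv_rhs => rw [← hx u, mk_sum_left]
    refine Finset.sum_congr rfl fun i _ => ?_
    rw [slice_mk, mk_bal]
  | add a b ha hb =>
    conv_rhs => rw [← ha, ← hb, ← Finset.sum_add_distrib]
    refine Finset.sum_congr rfl fun i _ => ?_
    rw [map_add, mk_add_right]

/-- Reduces equality in `X ⊗_R Y` to finitely many equalities in `Y`. Only `X` needs a dual basis,
so it applies to threefold tensor products by taking `Y = X ⊗_R X`. -/
theorem ext_slice {n : ℕ} (x : Fin n → X) (f : Fin n → X →+ R)
    (hf : ∀ i r x, f i (ρ r x) = f i x * r) (hx : ∀ z, ∑ i, ρ (f i z) (x i) = z)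
    {T T' : BalTensor ρ l}
    (h : ∀ i, slice hadd hmul (f i) (hf i) T = slice hadd hmul (f i) (hf i) T') : T = T' := by
  rw [← eq_sum_slice hadd hmul x f hf hx T, ← eq_sum_slice hadd hmul x f hf hx T']
  exact Finset.sum_congr rfl fun i _ => by rw [h i]

end BalTensor

namespace Bimod

variable {R X : Type*} [Ring R] [AddCommGroup X] (P : Bimod R X)

theorem l_add (r r' : R) (x : X) : P.l (r + r') x = P.l r x + P.l r' x := by
  rw [map_add]; rfl

/-- Together with `l2_mul`, this is what `slice` requires of the second factor when that factor is
`X ⊗_R X`. -/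
theorem l2_add (r r' : R) (T : P.T2) : P.l2 (r + r') T = P.l2 r T + P.l2 r' T := by
  have : P.l2 (r + r') = P.l2 r + P.l2 r' := BalTensor.hom_ext fun x y => by
    change P.tmul (P.l (r + r') x) y = P.tmul (P.l r x) y + P.tmul (P.l r' x) y
    rw [l_add, tmul_add_left]
  exact DFunLike.congr_fun this T

theorem l2_mul (r r' : R) (T : P.T2) : P.l2 (r * r') T = P.l2 r (P.l2 r' T) := by
  have : P.l2 (r * r') = (P.l2 r).comp (P.l2 r') := BalTensor.hom_ext fun x y => by
    change P.tmul (P.l (r * r') x) y = P.tmul (P.l r (P.l r' x)) y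
    rw [l_mul]
  exact DFunLike.congr_fun this T

end Bimod

/-! ### The pairings between `A` and `B` -/

section

variable {N M : Type*} [Ring N] [Ring M] {ι : N →+* M}

namespace StepA

@[simp] theorem ev_add (α β : StepA ι) (m : M) : (α + β).ev m = α.ev m + β.ev m := rfl

theorem ev_sum {κ : Type*} (s : Finset κ) (f : κ → StepA ι) (m : M) :
    (∑ i ∈ s, f i).ev m = ∑ i ∈ s, (f i).ev m :=
  map_sum (AddMonoidHom.mk' (fun α : StepA ι => α.ev m) fun _ _ => rfl) f s

end StepA

@[simp] theorem pairR_tmul (α : StepA ι) (x y : M) : pairR ι α (tmul ι x y) = x * α.ev y := rfl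

@[simp] theorem pairL_tmul (α : StepA ι) (x y : M) : pairL ι α (tmul ι x y) = α.ev x * y := rfl

theorem pairR_act_left (α : StepA ι) (a c : M) (z : TensorSq ι) :
    pairR ι α (act ι a c z) = a * pairR ι α (act ι 1 c z) := by
  have : (pairR ι α).comp (act ι a c) =
      (AddMonoidHom.mulLeft a).comp ((pairR ι α).comp (act ι 1 c)) :=
    BalTensor.hom_ext fun x y => by
      change a * x * α.ev (y * c) = a * (1 * x * α.ev (y * c))
      rw [one_mul, mul_assoc]
  exact DFunLike.congr_fun this z

theorem pairL_act_right (α : StepA ι) (a c : M) (z : TensorSq ι) :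
    pairL ι α (act ι a c z) = pairL ι α (act ι a 1 z) * c := by
  have : (pairL ι α).comp (act ι a c) =
      (AddMonoidHom.mulRight c).comp ((pairL ι α).comp (act ι a 1)) :=
    BalTensor.hom_ext fun x y => by
      change α.ev (a * x) * (y * c) = α.ev (a * x) * (y * 1) * c
      rw [mul_one, mul_assoc]
  exact DFunLike.congr_fun this z

/-- Right `N`-linearity of `α` pulls `ι n` out on the right, while `pairR_act_left` pulls it out on
the left. For `b` in `B` the two actions of `n` agree, so `b¹ α(b²)` commutes with `ι n`. -/
theorem pairR_act_map (α : StepA ι) (n : N) (z : TensorSq ι) :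
    pairR ι α (act ι 1 (ι n) z) = pairR ι α z * ι n := by
  have : (pairR ι α).comp (act ι 1 (ι n)) = (AddMonoidHom.mulRight (ι n)).comp (pairR ι α) :=
    BalTensor.hom_ext fun x y => by
      change 1 * x * α.ev (y * ι n) = x * α.ev y * ι n
      rw [one_mul, StepA.ev_r, mul_assoc]
  exact DFunLike.congr_fun this z

/-- Left `N`-linearity of `α` plays the corresponding role in showing that `α(b¹) b²` centralizes
`N`. -/
theorem pairL_act_map (α : StepA ι) (n : N) (z : TensorSq ι) :
    pairL ι α (act ι (ι n) 1 z) = ι n * pairL ι α z := by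
  have : (pairL ι α).comp (act ι (ι n) 1) = (AddMonoidHom.mulLeft (ι n)).comp (pairL ι α) :=
    BalTensor.hom_ext fun x y => by
      change α.ev (ι n * x) * (y * 1) = ι n * (α.ev x * y)
      rw [mul_one, StepA.ev_l, mul_assoc]
  exact DFunLike.congr_fun this z

theorem pairR_add (α β : StepA ι) (z : TensorSq ι) :
    pairR ι (α + β) z = pairR ι α z + pairR ι β z := by
  have : pairR ι (α + β) = pairR ι α + pairR ι β :=
    BalTensor.hom_ext fun x y => mul_add x (α.ev y) (β.ev y)
  exact DFunLike.congr_fun this z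

theorem pairL_add (α β : StepA ι) (z : TensorSq ι) :
    pairL ι (α + β) z = pairL ι α z + pairL ι β z := by
  have : pairL ι (α + β) = pairL ι α + pairL ι β :=
    BalTensor.hom_ext fun x y => add_mul (α.ev x) (β.ev x) y
  exact DFunLike.congr_fun this z

theorem pairR_t_mul (α : StepA ι) (r : centralizerRing ι) (z : TensorSq ι) :
    pairR ι (StepA.tHom ι (op r) * α) z = pairR ι α z * r := by
  have : pairR ι (StepA.tHom ι (op r) * α) = (AddMonoidHom.mulRight (r : M)).comp (pairR ι α) :=
    BalTensor.hom_ext fun x y => (mul_assoc x (α.ev y) (r : M)).symm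
  exact DFunLike.congr_fun this z

theorem pairL_s_mul (α : StepA ι) (r : centralizerRing ι) (z : TensorSq ι) :
    pairL ι (StepA.sHom ι r * α) z = r * pairL ι α z := by
  have : pairL ι (StepA.sHom ι r * α) = (AddMonoidHom.mulLeft (r : M)).comp (pairL ι α) :=
    BalTensor.hom_ext fun x y => mul_assoc (r : M) (α.ev x) y
  exact DFunLike.congr_fun this z

/-- The pairing `α ↦ b¹ α(b²)` with values in the centralizer. -/
def pairRB (b : StepB ι) : StepA ι →+ centralizerRing ι :=
  AddMonoidHom.mk' (fun α => ⟨pairR ι α b.val, Subring.mem_centralizer_iff.2 (by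
      rintro _ ⟨n, rfl⟩
      rw [← pairR_act_map, ← b.act_val, pairR_act_left, act_one_one])⟩)
    fun α β => Subtype.ext (pairR_add α β b.val)

/-- The pairing `α ↦ α(b¹) b²` with values in the centralizer. -/
def pairLB (b : StepB ι) : StepA ι →+ centralizerRing ι :=
  AddMonoidHom.mk' (fun α => ⟨pairL ι α b.val, Subring.mem_centralizer_iff.2 (by
      rintro _ ⟨n, rfl⟩
      rw [← pairL_act_map, b.act_val, pairL_act_right, act_one_one])⟩)
    fun α β => Subtype.ext (pairL_add α β b.val)

theorem pairRB_t_mul (b : StepB ι) (r : centralizerRing ι) (α : StepA ι) :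
    pairRB b (StepA.tHom ι (op r) * α) = pairRB b α * r :=
  Subtype.ext (pairR_t_mul α r b.val)

theorem pairLB_s_mul (b : StepB ι) (r : centralizerRing ι) (α : StepA ι) :
    pairLB b (StepA.sHom ι r * α) = r * pairLB b α :=
  Subtype.ext (pairL_s_mul α r b.val)

/-- `α = ∑ γ_i · ⟨c_i, α⟩`. -/
theorem RightQuasibasis.sum_pairRB (q : RightQuasibasis ι) (α : StepA ι) :
    ∑ i, StepA.tHom ι (op (pairRB (q.c i) α)) * q.γ i = α := by
  refine StepA.ext fun m => ?_
  rw [StepA.ev_sum]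
  -- Contracting `∑ γ_i(m) c_i = 1 ⊗ m` with `z ↦ z¹ α(z²)` turns the right side into `α(m)` and the
  -- `i`-th term into `γ_i(m) ⟨c_i, α⟩`.
  have h := congrArg (pairR ι α) (q.sum_eq m)
  rw [map_sum, pairR_tmul, one_mul] at h
  rw [← h]
  refine Finset.sum_congr rfl fun i _ => ?_
  rw [pairR_act_left, act_one_one]
  rfl

/-- `α = ∑ [α, b_i] · β_i`. -/
theorem LeftQuasibasis.sum_pairLB (q : LeftQuasibasis ι) (α : StepA ι) :
    ∑ i, StepA.sHom ι (pairLB (q.b i) α) * q.β i = α := by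
  refine StepA.ext fun m => ?_
  rw [StepA.ev_sum]
  have h := congrArg (pairL ι α) (q.sum_eq m)
  rw [map_sum, pairL_tmul, mul_one] at h
  rw [← h]
  refine Finset.sum_congr rfl fun i _ => ?_
  rw [pairL_act_right, act_one_one]
  rfl

/-! ### The left bialgebroid `A` -/

/-- The map `A ⊗_R A → M`, `α ⊗ β ↦ α(x) β(y)`. -/
def evalTwo (h : IsD2 ι) (x y : M) : (bialgebroidA h).bimod.T2 →+ M :=
  BalTensor.lift (fun α β => α.ev x * β.ev y)
    (fun _ _ _ => add_mul _ _ _) (fun _ _ _ => mul_add _ _ _)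
    (fun α r β => mul_assoc (α.ev x) (r : M) (β.ev y))

/-- The map `α ⊗ β ↦ z¹ α(z²) β(y)`. -/
def evalSq (h : IsD2 ι) (y : M) : (bialgebroidA h).bimod.T2 →+ TensorSq ι →+ M :=
  BalTensor.lift (fun α β => (AddMonoidHom.mulRight (β.ev y)).comp (pairR ι α))
    (fun α α' β => BalTensor.hom_ext fun u v => by
      change u * (α.ev v + α'.ev v) * β.ev y = u * α.ev v * β.ev y + u * α'.ev v * β.ev y
      rw [mul_add, add_mul])
    (fun α β β' => BalTensor.hom_ext fun u v => mul_add (u * α.ev v) (β.ev y) (β'.ev y))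
    (fun α r β => BalTensor.hom_ext fun u v => by
      change u * (α.ev v * r) * β.ev y = u * α.ev v * (r * β.ev y)
      simp only [mul_assoc])

variable (h : IsD2 ι)

theorem pairRB_ρ (b : StepB ι) (r : centralizerRing ι) (α : StepA ι) :
    pairRB b ((bialgebroidA h).bimod.ρ r α) = pairRB b α * r :=
  pairRB_t_mul b r α

theorem RightQuasibasis.sum_ρ_pairRB (q : RightQuasibasis ι) (α : StepA ι) :
    ∑ i, (bialgebroidA h).bimod.ρ (pairRB (q.c i) α) (q.γ i) = α :=
  q.sum_pairRB α

theorem evalSq_apply_tmul (y : M) (T : (bialgebroidA h).bimod.T2) (u v : M) :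
    evalSq h y T (tmul ι u v) = u * evalTwo h v y T := by
  induction T using BalTensor.induction_on with
  | zero => simp
  | tmul α β => exact mul_assoc u (α.ev v) (β.ev y)
  | add a b ha hb => rw [map_add, map_add, AddMonoidHom.add_apply, ha, hb, mul_add]

/-- The family `γ_i`, `⟨c_i, -⟩` is a dual basis of `A_R`, so only the slices by the `c_i` matter.
On `α ⊗ β` such a slice takes the value `c_i¹ α(c_i²) β(m)` at `m`. Writing `c_i` as a sum of pure
tensors `u ⊗ v`, this is a sum of terms `u · (α(v) β(m))`, hence is determined by the values of
`evalTwo`. -/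
theorem ext_evalTwo {T T' : (bialgebroidA h).bimod.T2}
    (hT : ∀ x y, evalTwo h x y T = evalTwo h x y T') : T = T' := by
  obtain ⟨q⟩ := h.2.nonempty_quasibasis
  refine BalTensor.ext_slice (Bimod.l_add (bialgebroidA h).bimod) (Bimod.l_mul (bialgebroidA h).bimod) q.γ
    (fun i => pairRB (q.c i)) (fun i => pairRB_ρ h (q.c i)) (q.sum_ρ_pairRB h) fun i =>
    StepA.ext fun m => ?_
  have key : ∀ T : (bialgebroidA h).bimod.T2,
      (BalTensor.slice (Bimod.l_add (bialgebroidA h).bimod) (Bimod.l_mul _) (pairRB (q.c i))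
        (pairRB_ρ h (q.c i)) T).ev m = evalSq h m T (q.c i).val := by
    intro T
    induction T using BalTensor.induction_on with
    | zero => simp; rfl
    | tmul α β => rfl
    | add a b ha hb => rw [map_add, StepA.ev_add, ha, hb, map_add]; rfl
  rw [key, key]
  congr 1
  exact BalTensor.hom_ext fun u v => by
    rw [evalSq_apply_tmul, evalSq_apply_tmul, hT]

/-- Applying `z ↦ z¹ α(z² y)` to `∑ γ_i(x) c_i = 1 ⊗ x` gives `∑ γ_i(x) c_i¹ α(c_i² y) = α(x y)`.
With `ext_evalTwo` this characterizes `Δ_A(α)` independently of the quasibasis, and all axioms for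
`A` are read off from it. -/
theorem evalTwo_comul (x y : M) (α : StepA ι) :
    evalTwo h x y ((bialgebroidA h).comul α) = α.ev (x * y) := by
  let q := h.2.nonempty_quasibasis.some
  have h0 : (bialgebroidA h).comul α =
    ∑ i, (bialgebroidA h).bimod.tmul (q.γ i) (convB ι (q.c i) α) := rfl
  rw [h0, map_sum]
  have h1 := congrArg (fun z => pairR ι α (act ι 1 y z)) (q.sum_eq x)
  simp only [map_sum, act_act, one_mul, mul_one, act_tmul, pairR_tmul] at h1
  rw [← h1]
  refine Finset.sum_congr rfl fun i _ => ?_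
  rw [pairR_act_left]
  rfl

/-- The version of `evalTwo_comul` with the first argument contracted against a tensor. It computes
the contraction of `Δ_A(α)` by an element of `B` in the proof that `η` is multiplicative. -/
theorem evalSq_comul (y : M) (α : StepA ι) (z : TensorSq ι) :
    evalSq h y ((bialgebroidA h).comul α) z = pairR ι α (act ι 1 y z) := by
  have : evalSq h y ((bialgebroidA h).comul α) = (pairR ι α).comp (act ι 1 y) :=
    BalTensor.hom_ext fun u v => by
      rw [evalSq_apply_tmul, evalTwo_comul]
      change u * α.ev (v * y) = 1 * u * α.ev (v * y)
      rw [one_mul]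
  exact DFunLike.congr_fun this z

theorem evalTwo_l2 (x y : M) (r : centralizerRing ι) (T : (bialgebroidA h).bimod.T2) :
    evalTwo h x y ((bialgebroidA h).bimod.l2 r T) = r * evalTwo h x y T := by
  have : (evalTwo h x y).comp ((bialgebroidA h).bimod.l2 r) =
      (AddMonoidHom.mulLeft (r : M)).comp (evalTwo h x y) :=
    BalTensor.hom_ext fun α β => mul_assoc (r : M) (α.ev x) (β.ev y)
  exact DFunLike.congr_fun this T

theorem evalTwo_ρ2 (x y : M) (r : centralizerRing ι) (T : (bialgebroidA h).bimod.T2) :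
    evalTwo h x y ((bialgebroidA h).bimod.ρ2 r T) = evalTwo h x y T * r := by
  have : (evalTwo h x y).comp ((bialgebroidA h).bimod.ρ2 r) =
      (AddMonoidHom.mulRight (r : M)).comp (evalTwo h x y) :=
    BalTensor.hom_ext fun α β => (mul_assoc (α.ev x) (β.ev y) (r : M)).symm
  exact DFunLike.congr_fun this T

theorem evalTwo_mulT (x y : M) (α β : StepA ι) (T : (bialgebroidA h).bimod.T2) :
    evalTwo h x y ((bialgebroidA h).mulT α β T) = evalTwo h (α.ev x) (β.ev y) T := by
  have : (evalTwo h x y).comp ((bialgebroidA h).mulT α β) = evalTwo h (α.ev x) (β.ev y) :=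
    BalTensor.hom_ext fun _ _ => rfl
  exact DFunLike.congr_fun this T

/-- The map `A ⊗_R A ⊗_R A → M`, `α ⊗ β ⊗ γ ↦ α(x) β(y) γ(z)`. -/
def evalThree (x y z : M) : (bialgebroidA h).bimod.T3 →+ M :=
  BalTensor.lift (fun α T => α.ev x * evalTwo h y z T)
    (fun _ _ _ => add_mul _ _ _) (fun α T T' => by rw [map_add, mul_add])
    (fun α r T => by
      rw [evalTwo_l2]
      exact mul_assoc (α.ev x) (r : M) _)

/-- The map `α ⊗ β ⊗ γ ↦ w¹ α(w²) β(y) γ(z)`. -/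
def evalThreeSq (y z : M) : (bialgebroidA h).bimod.T3 →+ TensorSq ι →+ M :=
  BalTensor.lift (fun α T => (AddMonoidHom.mulRight (evalTwo h y z T)).comp (pairR ι α))
    (fun α α' T => BalTensor.hom_ext fun u v => by
      change u * (α.ev v + α'.ev v) * _ = u * α.ev v * _ + u * α'.ev v * _
      rw [mul_add, add_mul])
    (fun α T T' => BalTensor.hom_ext fun u v => by
      rw [map_add]
      exact mul_add (u * α.ev v) _ _)
    (fun α r T => BalTensor.hom_ext fun u v => by
      rw [evalTwo_l2]
      change u * (α.ev v * r) * _ = u * α.ev v * (r * _)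
      simp only [mul_assoc])

theorem evalThreeSq_apply_tmul (y z : M) (T : (bialgebroidA h).bimod.T3) (u v : M) :
    evalThreeSq h y z T (tmul ι u v) = u * evalThree h v y z T := by
  induction T using BalTensor.induction_on with
  | zero => simp
  | tmul α β => exact mul_assoc u (α.ev v) _
  | add a b ha hb => rw [map_add, map_add, AddMonoidHom.add_apply, ha, hb, mul_add]

/-- Slicing off the first factor with the `c_i` leaves elements of `A ⊗_R A`, to which `ext_evalTwo`
applies. The evaluation of such a slice at `(y, z)` is again a contraction of the threefold
evaluation against `c_i`. -/
theorem ext_evalThree {T T' : (bialgebroidA h).bimod.T3}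
    (hT : ∀ x y z, evalThree h x y z T = evalThree h x y z T') : T = T' := by
  obtain ⟨q⟩ := h.2.nonempty_quasibasis
  refine BalTensor.ext_slice (Bimod.l2_add (bialgebroidA h).bimod) (Bimod.l2_mul (bialgebroidA h).bimod) q.γ
    (fun i => pairRB (q.c i)) (fun i => pairRB_ρ h (q.c i)) (q.sum_ρ_pairRB h) fun i =>
    ext_evalTwo h fun y z => ?_
  have key : ∀ T : (bialgebroidA h).bimod.T3,
      evalTwo h y z (BalTensor.slice (Bimod.l2_add (bialgebroidA h).bimod) (Bimod.l2_mul _)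
        (pairRB (q.c i)) (pairRB_ρ h (q.c i)) T) =
      evalThreeSq h y z T (q.c i).val := by
    intro T
    induction T using BalTensor.induction_on with
    | zero => simp
    | tmul α S => exact evalTwo_l2 h y z _ S
    | add a b ha hb => rw [map_add, map_add, ha, hb, map_add]; rfl
  rw [key, key]
  congr 1
  exact BalTensor.hom_ext fun u v => by
    rw [evalThreeSq_apply_tmul, evalThreeSq_apply_tmul, hT]

theorem evalThree_appendR (x y z : M) (β : StepA ι) (T : (bialgebroidA h).bimod.T2) :
    evalThree h x y z ((bialgebroidA h).bimod.appendR β T) = evalTwo h x y T * β.ev z := by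
  have : (evalThree h x y z).comp ((bialgebroidA h).bimod.appendR β) =
      (AddMonoidHom.mulRight (β.ev z)).comp (evalTwo h x y) :=
    BalTensor.hom_ext fun α α' => (mul_assoc (α.ev x) (α'.ev y) (β.ev z)).symm
  exact DFunLike.congr_fun this T

/-! ### Verification of the left bialgebroid axioms for `A` -/

theorem bialgebroidA_comul_l (r : centralizerRing ι) (α : StepA ι) :
    (bialgebroidA h).comul ((bialgebroidA h).bimod.l r α) =
      (bialgebroidA h).bimod.l2 r ((bialgebroidA h).comul α) :=
  ext_evalTwo h fun x y => by
    rw [evalTwo_l2, evalTwo_comul, evalTwo_comul]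
    rfl

theorem bialgebroidA_comul_ρ (r : centralizerRing ι) (α : StepA ι) :
    (bialgebroidA h).comul ((bialgebroidA h).bimod.ρ r α) =
      (bialgebroidA h).bimod.ρ2 r ((bialgebroidA h).comul α) :=
  ext_evalTwo h fun x y => by
    rw [evalTwo_ρ2, evalTwo_comul, evalTwo_comul]
    rfl

/-- After evaluation, coassociativity reads `α((x y) z) = α(x (y z))` and the counit laws read `α(1
m) = α(m) = α(m 1)`. -/
theorem bialgebroidA_isCoring :
    (bialgebroidA h).bimod.IsCoring (bialgebroidA h).comul (bialgebroidA h).counit where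
  comul_l := bialgebroidA_comul_l h
  comul_ρ := bialgebroidA_comul_ρ h
  counit_l r α := rfl
  counit_ρ r α := rfl
  coassoc α := ext_evalThree h fun x y z => by
    have hl : (evalThree h x y z).comp ((bialgebroidA h).bimod.comulLeft _
        (bialgebroidA_comul_ρ h)) = evalTwo h (x * y) z :=
      BalTensor.hom_ext fun β β' => by
        change evalThree h x y z ((bialgebroidA h).bimod.appendR β' ((bialgebroidA h).comul β)) = _
        rw [evalThree_appendR, evalTwo_comul]
        rfl
    have hr : (evalThree h x y z).comp ((bialgebroidA h).bimod.comulRight _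
        (bialgebroidA_comul_l h)) = evalTwo h x (y * z) :=
      BalTensor.hom_ext fun β β' => by
        change β.ev x * evalTwo h y z ((bialgebroidA h).comul β') = _
        rw [evalTwo_comul]
        rfl
    have el := DFunLike.congr_fun hl ((bialgebroidA h).comul α)
    have er := DFunLike.congr_fun hr ((bialgebroidA h).comul α)
    rw [evalTwo_comul] at el er
    exact el.trans ((congrArg α.ev (mul_assoc x y z)).trans er.symm)
  counit_comul α := StepA.ext fun m => by
    have : ∀ T : (bialgebroidA h).bimod.T2, ((bialgebroidA h).bimod.counitLeft
        (bialgebroidA h).counit (fun r α => rfl) T).ev m = evalTwo h 1 m T := by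
      intro T
      induction T using BalTensor.induction_on with
      | zero => simp; rfl
      | tmul α β => rfl
      | add a b ha hb => rw [map_add, StepA.ev_add, ha, hb, map_add]
    rw [this, evalTwo_comul, one_mul]
  comul_counit α := StepA.ext fun m => by
    have : ∀ T : (bialgebroidA h).bimod.T2, ((bialgebroidA h).bimod.counitRight
        (bialgebroidA h).counit (fun r α => rfl) T).ev m = evalTwo h m 1 T := by
      intro T
      induction T using BalTensor.induction_on with
      | zero => simp; rfl
      | tmul α β => rfl
      | add a b ha hb => rw [map_add, StepA.ev_add, ha, hb, map_add]
    rw [this, evalTwo_comul, mul_one]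

/-- The Takeuchi condition evaluates to `α((x r) y) = α(x (r y))`, multiplicativity of `Δ_A` has
`α(β(x y))` on both sides, and each counit axiom compares two expressions for `α(β(1))`. -/
theorem bialgebroidA_isLeftBialgebroid : (bialgebroidA h).IsLeftBialgebroid where
  coring := bialgebroidA_isCoring h
  takeuchi α r := ext_evalTwo h fun x y => by
    rw [evalTwo_mulT, evalTwo_mulT, evalTwo_comul, evalTwo_comul]
    exact congrArg α.ev (mul_assoc x (r : M) y)
  comul_mul α β := ext_evalTwo h fun x y => by
    rw [evalTwo_comul]
    -- For fixed `α`, the product `Δ_A(α) (u ⊗ v)` evaluates at `(x, y)` to `α(u(x) v(y))`. So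
    -- multiplying by `Δ_A(α)` amounts to applying `α` to the evaluated second factor.
    have : ∀ hX, (evalTwo h x y).comp
        ((bialgebroidA h).takeuchiMul ((bialgebroidA h).comul α) hX) =
        α.ev.comp (evalTwo h x y) := fun hX =>
      BalTensor.hom_ext fun u v => by
        change evalTwo h x y ((bialgebroidA h).mulT u v _) = _
        rw [evalTwo_mulT, evalTwo_comul]
        rfl
    refine Eq.trans ?_ (DFunLike.congr_fun (this _) ((bialgebroidA h).comul β)).symm
    rw [AddMonoidHom.comp_apply, evalTwo_comul]
    rfl
  comul_one := ext_evalTwo h fun x y => by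
    rw [evalTwo_comul]
    rfl
  counit_one := rfl
  counit_s α β := Subtype.ext (congrArg α.ev (mul_one (β.ev 1)))
  counit_t α β := Subtype.ext (congrArg α.ev (one_mul (β.ev 1)))

end

/-! ### The right bialgebroid `B` -/

section

variable {N M : Type*} [Ring N] [Ring M] {ι : N →+* M}

/-! ### The tensor cube `M ⊗_N M ⊗_N M` and its structure maps -/

variable (ι) in
/-- The tensor cube `M ⊗_N (M ⊗_N M)`. -/
abbrev TensorCube : Type _ :=
  BalTensor (fun n : N => AddMonoidHom.mulRight (ι n)) (fun n : N => act ι (ι n) 1)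

namespace TensorCube

variable (ι) in
/-- `x ⊗ w` in `M ⊗_N (M ⊗_N M)`. -/
abbrev tmul (x : M) (w : TensorSq ι) : TensorCube ι :=
  BalTensor.mk (fun n : N => AddMonoidHom.mulRight (ι n)) (fun n : N => act ι (ι n) 1) x w

theorem tmul_add_left (x x' : M) (w : TensorSq ι) :
    tmul ι (x + x') w = tmul ι x w + tmul ι x' w :=
  BalTensor.mk_add_left _ _ x x' w

theorem tmul_add_right (x : M) (w w' : TensorSq ι) :
    tmul ι x (w + w') = tmul ι x w + tmul ι x w' :=
  BalTensor.mk_add_right _ _ x w w'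

theorem tmul_bal (x : M) (n : N) (w : TensorSq ι) :
    tmul ι (x * ι n) w = tmul ι x (act ι (ι n) 1 w) :=
  BalTensor.mk_bal (fun n : N => AddMonoidHom.mulRight (ι n)) (fun n : N => act ι (ι n) 1) x n w

/-- The map `x ⊗ y ↦ x ⊗ y · w`. -/
def join (w : TensorSq ι) : TensorSq ι →+ TensorCube ι :=
  BalTensor.lift (fun x y => tmul ι x (act ι y 1 w))
    (fun x x' y => tmul_add_left x x' _)
    (fun x y y' => by rw [act_add_left, tmul_add_right])
    (fun x n y => by
      change tmul ι (x * ι n) (act ι y 1 w) = tmul ι x (act ι (ι n * y) 1 w)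
      rw [tmul_bal, act_act, one_mul])

@[simp] theorem join_tmul (w : TensorSq ι) (x y : M) :
    join w (TensorSq.tmul ι x y) = tmul ι x (act ι y 1 w) := rfl

theorem join_add (w w' z : TensorSq ι) : join (w + w') z = join w z + join w' z := by
  have : join (w + w') = join w + join w' := BalTensor.hom_ext fun x y => by
    change tmul ι x (act ι y 1 (w + w')) = tmul ι x (act ι y 1 w) + tmul ι x (act ι y 1 w')
    rw [map_add, tmul_add_right]
  exact DFunLike.congr_fun this z

/-- The middle entry of the cube is a product in `M`, so a right multiplier of the first tensor may
equally be a left multiplier of the second. For `y` in `R` and `a = 1` this is the balancing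
condition behind `toCube`. -/
theorem join_act_right (w : TensorSq ι) (a y : M) (z : TensorSq ι) :
    join w (act ι a y z) = join (act ι y 1 w) (act ι a 1 z) := by
  have : (join w).comp (act ι a y) = (join (act ι y 1 w)).comp (act ι a 1) :=
    BalTensor.hom_ext fun u v => by
      change tmul ι (a * u) (act ι (v * y) 1 w) = tmul ι (a * u) (act ι (v * 1) 1 (act ι y 1 w))
      rw [act_act, mul_one, mul_one]
  exact DFunLike.congr_fun this z

variable (ι) in
/-- The `M`-`M`-bimodule structure of `M ⊗_N (M ⊗_N M)`. -/
def outer (p q : M) : TensorCube ι →+ TensorCube ι :=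
  BalTensor.lift (fun x w => tmul ι (p * x) (act ι 1 q w))
    (fun x x' w => by rw [mul_add, tmul_add_left])
    (fun x w w' => by rw [map_add, tmul_add_right])
    (fun x n w => by
      change tmul ι (p * (x * ι n)) (act ι 1 q w) = tmul ι (p * x) (act ι 1 q (act ι (ι n) 1 w))
      rw [← mul_assoc, tmul_bal, act_act, act_act, mul_one, one_mul, mul_one, one_mul])

theorem outer_join (p q : M) (w z : TensorSq ι) :
    outer ι p q (join w z) = join (act ι 1 q w) (act ι p 1 z) := by
  have : (outer ι p q).comp (join w) = (join (act ι 1 q w)).comp (act ι p 1) :=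
    BalTensor.hom_ext fun u v => by
      change tmul ι (p * u) (act ι 1 q (act ι v 1 w)) =
        tmul ι (p * u) (act ι (v * 1) 1 (act ι 1 q w))
      rw [act_act, act_act, mul_one, mul_one, one_mul, one_mul, mul_one]
  exact DFunLike.congr_fun this z

variable (ι) in
/-- The map `x ⊗ y ↦ x ⊗ 1 ⊗ y`. -/
def insertOne : TensorSq ι →+ TensorCube ι :=
  BalTensor.lift (fun x y => tmul ι x (TensorSq.tmul ι 1 y))
    (fun x x' y => tmul_add_left x x' _)
    (fun x y y' => by rw [TensorSq.tmul_add_right, tmul_add_right])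
    (fun x n y => by
      change tmul ι (x * ι n) (TensorSq.tmul ι 1 y) = tmul ι x (TensorSq.tmul ι 1 (ι n * y))
      rw [tmul_bal, act_tmul, mul_one, mul_one, ← TensorSq.tmul_bal, one_mul])

@[simp] theorem insertOne_tmul (x y : M) :
    insertOne ι (TensorSq.tmul ι x y) = tmul ι x (TensorSq.tmul ι 1 y) := rfl

theorem insertOne_act (p q : M) (z : TensorSq ι) :
    insertOne ι (act ι p q z) = outer ι p q (insertOne ι z) := by
  have : (insertOne ι).comp (act ι p q) = (outer ι p q).comp (insertOne ι) :=
    BalTensor.hom_ext fun u v => by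
      change tmul ι (p * u) (TensorSq.tmul ι 1 (v * q)) =
        tmul ι (p * u) (TensorSq.tmul ι (1 * 1) (v * q))
      rw [one_mul]
  exact DFunLike.congr_fun this z

/-- The map `α ⊗ id ⊗ id`. -/
def mapFst (α : StepA ι) : TensorCube ι →+ TensorCube ι :=
  BalTensor.lift (fun x w => tmul ι (α.ev x) w)
    (fun x x' w => by rw [map_add, tmul_add_left])
    (fun x w w' => tmul_add_right _ w w')
    (fun x n w => by
      change tmul ι (α.ev (x * ι n)) w = tmul ι (α.ev x) (act ι (ι n) 1 w)
      rw [StepA.ev_r, tmul_bal])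

theorem mapFst_join (α : StepA ι) (w z : TensorSq ι) :
    mapFst α (join w z) = join w (Bialgd.mapFst ι α z) := by
  have : (mapFst α).comp (join w) = (join w).comp (Bialgd.mapFst ι α) :=
    BalTensor.hom_ext fun _ _ => rfl
  exact DFunLike.congr_fun this z

theorem mapFst_insertOne (α : StepA ι) (z : TensorSq ι) :
    mapFst α (insertOne ι z) = insertOne ι (Bialgd.mapFst ι α z) := by
  have : (mapFst α).comp (insertOne ι) = (insertOne ι).comp (Bialgd.mapFst ι α) :=
    BalTensor.hom_ext fun _ _ => rfl
  exact DFunLike.congr_fun this z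

/-- The map `x ⊗ w ↦ α(x) · w`. -/
def evalFst (α : StepA ι) : TensorCube ι →+ TensorSq ι :=
  BalTensor.lift (fun x w => act ι (α.ev x) 1 w)
    (fun x x' w => by rw [map_add, act_add_left])
    (fun x w w' => map_add _ w w')
    (fun x n w => by
      change act ι (α.ev (x * ι n)) 1 w = act ι (α.ev x) 1 (act ι (ι n) 1 w)
      rw [StepA.ev_r, act_act, one_mul])

/-- On `z¹ ⊗ z² w¹ ⊗ w²` the map gives `α(z¹) z² w¹ ⊗ w²`, so `z` enters only through `α(z¹) z²`.
This is why slices of `B ⊗_R B` can be computed in the cube. -/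
theorem evalFst_join (α : StepA ι) (w z : TensorSq ι) :
    evalFst α (join w z) = act ι (pairL ι α z) 1 w := by
  induction z using BalTensor.induction_on with
  | zero =>
    have := act_add_left ι 0 0 1 w
    rw [add_zero] at this
    rw [map_zero, map_zero, map_zero]
    exact (left_eq_add.1 this).symm
  | tmul x y =>
    change act ι (α.ev x) 1 (act ι y 1 w) = act ι (α.ev x * y) 1 w
    rw [act_act, one_mul]
  | add a b ha hb => rw [map_add, map_add, map_add, ha, hb, act_add_left]

theorem evalFst_insertOne (α : StepA ι) (z : TensorSq ι) :
    evalFst α (insertOne ι z) = Bialgd.mapFst ι α z := by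
  have : (evalFst α).comp (insertOne ι) = Bialgd.mapFst ι α :=
    BalTensor.hom_ext fun x y => by
      change TensorSq.tmul ι (α.ev x * 1) (y * 1) = TensorSq.tmul ι (α.ev x) y
      rw [mul_one, mul_one]
  exact DFunLike.congr_fun this z

/-- The map `x ⊗ w ↦ x · w`, that is `x ⊗ y ⊗ z ↦ x y ⊗ z`. -/
def mulFst : TensorCube ι →+ TensorSq ι := evalFst 1

/-- The map `x ⊗ y ⊗ z ↦ x ⊗ y z`. -/
def mulSnd : TensorCube ι →+ TensorSq ι :=
  BalTensor.lift (fun x w => TensorSq.tmul ι x (StepB.mulMap ι w))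
    (fun x x' w => TensorSq.tmul_add_left ι x x' _)
    (fun x w w' => by rw [map_add, TensorSq.tmul_add_right])
    (fun x n w => by
      change TensorSq.tmul ι (x * ι n) (StepB.mulMap ι w) =
        TensorSq.tmul ι x (StepB.mulMap ι (act ι (ι n) 1 w))
      rw [StepB.mulMap_act, mul_one, TensorSq.tmul_bal])

theorem mulSnd_join (w z : TensorSq ι) :
    mulSnd (join w z) = act ι 1 (StepB.mulMap ι w) z := by
  have : mulSnd.comp (join w) = act ι 1 (StepB.mulMap ι w) :=
    BalTensor.hom_ext fun x y => by
      change TensorSq.tmul ι x (StepB.mulMap ι (act ι y 1 w)) =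
        TensorSq.tmul ι (1 * x) (y * StepB.mulMap ι w)
      rw [StepB.mulMap_act, mul_one, one_mul]
  exact DFunLike.congr_fun this z

theorem mulSnd_insertOne (z : TensorSq ι) : mulSnd (insertOne ι z) = z := by
  have : mulSnd.comp (insertOne ι) = AddMonoidHom.id _ :=
    BalTensor.hom_ext fun x y => by
      change TensorSq.tmul ι x (1 * y) = TensorSq.tmul ι x y
      rw [one_mul]
  exact DFunLike.congr_fun this z

/-- The map `u ⊗ v ⊗ w ↦ u x¹ ⊗ x² v y¹ ⊗ y² w`, for `x` and `y` in `B`. -/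
def mulT (x y : StepB ι) : TensorCube ι →+ TensorCube ι :=
  BalTensor.lift (fun u w => join (StepB.leftMul y w) (act ι u 1 x.val))
    (fun u u' w => by rw [act_add_left, map_add])
    (fun u w w' => by rw [map_add, join_add])
    (fun u n w => by
      change join (StepB.leftMul y w) (act ι (u * ι n) 1 x.val) =
        join (StepB.leftMul y (act ι (ι n) 1 w)) (act ι u 1 x.val)
      rw [StepB.leftMul_act, ← join_act_right]
      have := congrArg (act ι u 1) (x.act_val n)
      rw [act_act, act_act, one_mul, mul_one, mul_one] at this
      rw [this])

theorem mulT_tmul (x y : StepB ι) (u : M) (w : TensorSq ι) :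
    mulT x y (tmul ι u w) = join (StepB.leftMul y w) (act ι u 1 x.val) := rfl

/-- Ensures that left multiplication by `x ⊗ y` on `B ⊗_R B` corresponds to an operator on the whole
cube, so that products with a coproduct can be computed after `toCube`. -/
theorem mulT_join (x y : StepB ι) (w z : TensorSq ι) :
    mulT x y (join w z) = join (StepB.leftMul y w) (StepB.leftMul x z) := by
  have : (mulT x y).comp (join w) = (join (StepB.leftMul y w)).comp (StepB.leftMul x) :=
    BalTensor.hom_ext fun u v => by
      change join (StepB.leftMul y (act ι v 1 w)) (act ι u 1 x.val) =
        join (StepB.leftMul y w) (act ι u v x.val)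
      rw [join_act_right _ u v, StepB.leftMul_act]
  exact DFunLike.congr_fun this z

/-- With `1` in the middle, `u x¹ ⊗ x² y¹ ⊗ y² v` is the cube element of `x ⊗ y` multiplied by `u`
and `v` on the outside. Products with elements `b¹ ⊗ 1 ⊗ b²` therefore see only the image of `x ⊗ y`
in the cube. -/
theorem mulT_insertOne_tmul (x y : StepB ι) (u v : M) :
    mulT x y (insertOne ι (TensorSq.tmul ι u v)) = outer ι u v (join y.val x.val) := by
  rw [insertOne_tmul, mulT_tmul, outer_join]
  rfl

end TensorCube

/-- `b = ∑ b_i · [β_i, b]`, on all of `M ⊗_N M`. -/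
theorem LeftQuasibasis.sum_act_pairL (q : LeftQuasibasis ι) (z : TensorSq ι) :
    ∑ i, act ι 1 (pairL ι (q.β i) z) (q.b i).val = z := by
  induction z using BalTensor.induction_on with
  | zero =>
    refine Finset.sum_eq_zero fun i _ => ?_
    have := act_add_right ι 1 0 0 (q.b i).val
    rw [add_zero] at this
    rw [map_zero]
    exact left_eq_add.1 this
  | tmul x y =>
    -- Multiply the quasibasis identity for `m = x` by `y` on the right.
    have := congrArg (act ι 1 y) (q.sum_eq x)
    rw [map_sum, act_tmul, one_mul, one_mul] at this
    refine Eq.trans (Finset.sum_congr rfl fun i _ => ?_) this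
    rw [act_act, one_mul]
    rfl
  | add a b ha hb =>
    conv_rhs => rw [← ha, ← hb, ← Finset.sum_add_distrib]
    refine Finset.sum_congr rfl fun i _ => ?_
    rw [map_add, act_add_right]

/-- `b = ∑ ⟨b, γ_i⟩ · c_i`, on all of `M ⊗_N M`. -/
theorem RightQuasibasis.sum_act_pairR (q : RightQuasibasis ι) (z : TensorSq ι) :
    ∑ i, act ι (pairR ι (q.γ i) z) 1 (q.c i).val = z := by
  induction z using BalTensor.induction_on with
  | zero =>
    refine Finset.sum_eq_zero fun i _ => ?_
    have := act_add_left ι 0 0 1 (q.c i).val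
    rw [add_zero] at this
    rw [map_zero]
    exact left_eq_add.1 this
  | tmul x y =>
    have := congrArg (act ι x 1) (q.sum_eq y)
    rw [map_sum, act_tmul, mul_one, mul_one] at this
    refine Eq.trans (Finset.sum_congr rfl fun i _ => ?_) this
    rw [act_act, one_mul]
    rfl
  | add a b ha hb =>
    conv_rhs => rw [← ha, ← hb, ← Finset.sum_add_distrib]
    refine Finset.sum_congr rfl fun i _ => ?_
    rw [map_add, act_add_left]

/-! ### The embedding of `B ⊗_R B` in the tensor cube -/

variable (h : IsD2 ι)

open TensorCube (join outer insertOne)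

/-- The map `B ⊗_R B → M ⊗_N M ⊗_N M`, `b ⊗ b' ↦ b¹ ⊗ b² b'¹ ⊗ b'²`. -/
def toCube : (bialgebroidB h).bimod.T2 →+ TensorCube ι :=
  BalTensor.lift (fun b b' => join b'.val b.val)
    (fun b b' c => by rw [map_add, map_add])
    (fun b c c' => by rw [map_add, TensorCube.join_add])
    (fun b r b' => by
      change join b'.val (act ι 1 (r : M) b.val) = join (act ι (r : M) 1 b'.val) b.val
      rw [TensorCube.join_act_right, act_one_one])

@[simp] theorem bialgebroidB_val_l (r : centralizerRing ι) (b : StepB ι) :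
    ((bialgebroidB h).bimod.l r b).val = act ι (r : M) 1 b.val := rfl

@[simp] theorem bialgebroidB_val_ρ (r : centralizerRing ι) (b : StepB ι) :
    ((bialgebroidB h).bimod.ρ r b).val = act ι 1 (r : M) b.val := rfl

theorem pairLB_add_right (α : StepA ι) (b b' : StepB ι) :
    pairLB (b + b') α = pairLB b α + pairLB b' α :=
  Subtype.ext (map_add (pairL ι α) b.val b'.val)

/-- The map `b ↦ [α, b]`. -/
def pairLBRight (α : StepA ι) : StepB ι →+ centralizerRing ι :=
  AddMonoidHom.mk' (fun b => pairLB b α) (pairLB_add_right α)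

theorem pairLBRight_ρ (α : StepA ι) (r : centralizerRing ι) (b : StepB ι) :
    pairLBRight α ((bialgebroidB h).bimod.ρ r b) = pairLBRight α b * r :=
  Subtype.ext (by
    change pairL ι α (act ι 1 (r : M) b.val) = pairL ι α b.val * r
    rw [pairL_act_right, act_one_one])

/-- The dual basis of `B_R`, made of the `b_i` and the functionals `[β_i, -]`, in the form
`ext_slice` needs. -/
theorem LeftQuasibasis.sum_ρ_pairLB (q : LeftQuasibasis ι) (b : StepB ι) :
    ∑ i, (bialgebroidB h).bimod.ρ (pairLBRight (q.β i) b) (q.b i) = b :=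
  StepB.ext (by
    rw [map_sum]
    exact q.sum_act_pairL b.val)

/-- The map `b ⊗ b' ↦ [α, b] · b'` on `B ⊗_R B`. -/
abbrev sliceB (α : StepA ι) : (bialgebroidB h).bimod.T2 →+ StepB ι :=
  BalTensor.slice (Bimod.l_add (bialgebroidB h).bimod) (Bimod.l_mul (bialgebroidB h).bimod)
    (pairLBRight α) (pairLBRight_ρ h α)

/-- Slices of `B ⊗_R B` factor through the cube; injectivity of `toCube` rests on this. -/
theorem val_sliceB (α : StepA ι) (T : (bialgebroidB h).bimod.T2) :
    (sliceB h α T).val = TensorCube.evalFst α (toCube h T) := by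
  have : StepB.val.comp (sliceB h α) = (TensorCube.evalFst α).comp (toCube h) :=
    BalTensor.hom_ext fun b b' => (TensorCube.evalFst_join α b'.val b.val).symm
  exact DFunLike.congr_fun this T

/-- The slices by the `β_i` determine an element of `B ⊗_R B`, and each of them is a function of the
image in the cube. -/
theorem toCube_injective : Function.Injective (toCube h) := by
  intro T T' hT
  obtain ⟨q⟩ := h.1.nonempty_quasibasis
  refine BalTensor.ext_slice (Bimod.l_add (bialgebroidB h).bimod)
    (Bimod.l_mul (bialgebroidB h).bimod) q.b (fun i => pairLBRight (q.β i))
    (fun i => pairLBRight_ρ h (q.β i)) (q.sum_ρ_pairLB h) fun i => StepB.ext ?_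
  exact (val_sliceB h (q.β i) T).trans
    ((congrArg _ hT).trans (val_sliceB h (q.β i) T').symm)

/-- For `z = x ⊗ y` the sum is `∑ b_i¹ ⊗ b_i² β_i(x) ⊗ y`, whose first two factors sum to `x ⊗ 1` by
the quasibasis identity. -/
theorem LeftQuasibasis.sum_join (q : LeftQuasibasis ι) (z : TensorSq ι) :
    ∑ i, join (mapFst ι (q.β i) z) (q.b i).val = insertOne ι z := by
  induction z using BalTensor.induction_on with
  | zero =>
    refine (Finset.sum_eq_zero fun i _ => ?_).trans (map_zero _).symm
    have := TensorCube.join_add 0 0 (q.b i).val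
    rw [add_zero] at this
    rw [map_zero]
    exact left_eq_add.1 this
  | tmul x y =>
    -- Moving `m = β_i(x)` to the right end of `b_i` leaves the second tensor `1 ⊗ y` independent of
    -- `i`, so one additive map can be applied to the quasibasis identity.
    have key : ∀ (m : M) (z : TensorSq ι),
        join (tmul ι m y) z = join (tmul ι 1 y) (act ι 1 m z) := fun m z => by
      rw [TensorCube.join_act_right, act_tmul, mul_one, mul_one, act_one_one]
    have := congrArg (join (tmul ι 1 y)) (q.sum_eq x)
    rw [map_sum, TensorCube.join_tmul, act_one_one] at this
    rw [TensorCube.insertOne_tmul, ← this]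
    exact Finset.sum_congr rfl fun i _ => key _ _
  | add a b ha hb =>
    rw [map_add, ← ha, ← hb, ← Finset.sum_add_distrib]
    refine Finset.sum_congr rfl fun i _ => ?_
    rw [map_add, TensorCube.join_add]

theorem exists_bialgebroidB_comul : ∃ q : LeftQuasibasis ι, ∀ b, (bialgebroidB h).comul b =
    ∑ i, (bialgebroidB h).bimod.tmul (q.b i) (mapFstB ι (q.β i) b) :=
  ⟨h.1.nonempty_quasibasis.some, fun _ => rfl⟩

/-- In the cube the coproduct of `B` merely inserts a unit. Since `toCube` is injective, this
determines `Δ_B(b)` without reference to the quasibasis. -/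
theorem toCube_comul (b : StepB ι) :
    toCube h ((bialgebroidB h).comul b) = insertOne ι b.val := by
  obtain ⟨q, hq⟩ := exists_bialgebroidB_comul h
  rw [hq, map_sum]
  exact q.sum_join b.val

theorem toCube_l2 (r : centralizerRing ι) (T : (bialgebroidB h).bimod.T2) :
    toCube h ((bialgebroidB h).bimod.l2 r T) = outer ι r 1 (toCube h T) := by
  have : (toCube h).comp ((bialgebroidB h).bimod.l2 r) = (outer ι r 1).comp (toCube h) :=
    BalTensor.hom_ext fun b b' => by
      refine Eq.trans ?_ (TensorCube.outer_join (r : M) 1 b'.val b.val).symm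
      rw [act_one_one]
      rfl
  exact DFunLike.congr_fun this T

theorem toCube_ρ2 (r : centralizerRing ι) (T : (bialgebroidB h).bimod.T2) :
    toCube h ((bialgebroidB h).bimod.ρ2 r T) = outer ι 1 r (toCube h T) := by
  have : (toCube h).comp ((bialgebroidB h).bimod.ρ2 r) = (outer ι 1 r).comp (toCube h) :=
    BalTensor.hom_ext fun b b' => by
      refine Eq.trans ?_ (TensorCube.outer_join 1 (r : M) b'.val b.val).symm
      rw [act_one_one]
      rfl
  exact DFunLike.congr_fun this T

theorem toCube_mulT (x y : StepB ι) (T : (bialgebroidB h).bimod.T2) :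
    toCube h ((bialgebroidB h).mulT x y T) = TensorCube.mulT x y (toCube h T) := by
  have : (toCube h).comp ((bialgebroidB h).mulT x y) = (TensorCube.mulT x y).comp (toCube h) :=
    BalTensor.hom_ext fun b b' => (TensorCube.mulT_join x y b'.val b.val).symm
  exact DFunLike.congr_fun this T

/-! ### Verification of the right bialgebroid axioms for `B` -/

theorem bialgebroidB_comul_l (r : centralizerRing ι) (b : StepB ι) :
    (bialgebroidB h).comul ((bialgebroidB h).bimod.l r b) =
      (bialgebroidB h).bimod.l2 r ((bialgebroidB h).comul b) :=
  toCube_injective h (by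
    rw [toCube_l2, toCube_comul, toCube_comul, ← TensorCube.insertOne_act]
    rfl)

theorem bialgebroidB_comul_ρ (r : centralizerRing ι) (b : StepB ι) :
    (bialgebroidB h).comul ((bialgebroidB h).bimod.ρ r b) =
      (bialgebroidB h).bimod.ρ2 r ((bialgebroidB h).comul b) :=
  toCube_injective h (by
    rw [toCube_ρ2, toCube_comul, toCube_comul, ← TensorCube.insertOne_act]
    rfl)

theorem bialgebroidB_counit_l (r : centralizerRing ι) (b : StepB ι) :
    (bialgebroidB h).counit ((bialgebroidB h).bimod.l r b) = r * (bialgebroidB h).counit b :=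
  Subtype.ext (by
    change StepB.mulMap ι (act ι r 1 b.val) = r * StepB.mulMap ι b.val
    rw [StepB.mulMap_act, mul_one])

theorem bialgebroidB_counit_ρ (r : centralizerRing ι) (b : StepB ι) :
    (bialgebroidB h).counit ((bialgebroidB h).bimod.ρ r b) = (bialgebroidB h).counit b * r :=
  Subtype.ext (by
    change StepB.mulMap ι (act ι 1 r b.val) = StepB.mulMap ι b.val * r
    rw [StepB.mulMap_act, one_mul])

theorem sliceB_comul (α : StepA ι) (b : StepB ι) :
    sliceB h α ((bialgebroidB h).comul b) = mapFstB ι α b :=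
  StepB.ext (by
    rw [val_sliceB, toCube_comul, TensorCube.evalFst_insertOne]
    rfl)

/-- The map `b ⊗ b' ⊗ b'' ↦ [α, b] · b' ⊗ b''`. -/
abbrev sliceB3 (α : StepA ι) : (bialgebroidB h).bimod.T3 →+ (bialgebroidB h).bimod.T2 :=
  BalTensor.slice (Bimod.l2_add (bialgebroidB h).bimod) (Bimod.l2_mul (bialgebroidB h).bimod)
    (pairLBRight α) (pairLBRight_ρ h α)

/-- Slicing turns the first leg into a left coefficient in `R`, and `Δ_B` is left `R`-linear, so
slicing commutes with the coproduct of the second leg. -/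
theorem sliceB3_comulRight (α : StepA ι) (T : (bialgebroidB h).bimod.T2) :
    sliceB3 h α ((bialgebroidB h).bimod.comulRight _ (bialgebroidB_comul_l h) T) =
      (bialgebroidB h).comul (sliceB h α T) := by
  have : (sliceB3 h α).comp ((bialgebroidB h).bimod.comulRight _ (bialgebroidB_comul_l h)) =
      (bialgebroidB h).comul.comp (sliceB h α) :=
    BalTensor.hom_ext fun x y => (bialgebroidB_comul_l h (pairLBRight α x) y).symm
  exact DFunLike.congr_fun this T

theorem sliceB3_appendR (α : StepA ι) (y : StepB ι) (T : (bialgebroidB h).bimod.T2) :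
    sliceB3 h α ((bialgebroidB h).bimod.appendR y T) =
      (bialgebroidB h).bimod.tmul (sliceB h α T) y := by
  induction T using BalTensor.induction_on with
  | zero =>
    rw [map_zero, map_zero, map_zero]
    exact (BalTensor.mk_zero_left _ _ y).symm
  | tmul a b => rfl
  | add a b ha hb => rw [map_add, map_add, map_add, ha, hb, Bimod.tmul_add_left]

/-- On `x ⊗ y`, slicing the coproduct of `x` gives `α(x¹) ⊗ x²`; joining this with `y` is the same
as applying `α` to the first entry of the cube element of `x ⊗ y`. -/
theorem toCube_sliceB3_comulLeft (α : StepA ι) (T : (bialgebroidB h).bimod.T2) :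
    toCube h (sliceB3 h α ((bialgebroidB h).bimod.comulLeft _ (bialgebroidB_comul_ρ h) T)) =
      TensorCube.mapFst α (toCube h T) := by
  have : ((toCube h).comp (sliceB3 h α)).comp
      ((bialgebroidB h).bimod.comulLeft _ (bialgebroidB_comul_ρ h)) =
      (TensorCube.mapFst α).comp (toCube h) :=
    BalTensor.hom_ext fun x y => by
      change toCube h (sliceB3 h α
        ((bialgebroidB h).bimod.appendR y ((bialgebroidB h).comul x))) = _
      rw [sliceB3_appendR, sliceB_comul]
      exact (TensorCube.mapFst_join α y.val x.val).symm
  exact DFunLike.congr_fun this T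

theorem ext_sliceB3 {T T' : (bialgebroidB h).bimod.T3}
    (hT : ∀ α, sliceB3 h α T = sliceB3 h α T') : T = T' := by
  obtain ⟨q⟩ := h.1.nonempty_quasibasis
  exact BalTensor.ext_slice (Bimod.l2_add (bialgebroidB h).bimod)
    (Bimod.l2_mul (bialgebroidB h).bimod) q.b (fun i => pairLBRight (q.β i))
    (fun i => pairLBRight_ρ h (q.β i)) (q.sum_ρ_pairLB h) fun i => hT (q.β i)

/-- After a slice by `α` and the embedding in the cube, both sides equal `α(b¹) ⊗ 1 ⊗ b²`. Slicing
first avoids a fourfold tensor power of `M`. -/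
theorem bialgebroidB_coassoc (b : StepB ι) :
    (bialgebroidB h).bimod.comulLeft _ (bialgebroidB_comul_ρ h) ((bialgebroidB h).comul b) =
      (bialgebroidB h).bimod.comulRight _ (bialgebroidB_comul_l h)
        ((bialgebroidB h).comul b) :=
  ext_sliceB3 h fun α => toCube_injective h (by
    rw [sliceB3_comulRight, sliceB_comul, toCube_comul, toCube_sliceB3_comulLeft, toCube_comul]
    exact TensorCube.mapFst_insertOne α b.val)

/-- The counit laws say that multiplying the first two, or the last two, entries of `b¹ ⊗ 1 ⊗ b²`
returns `b`. -/
theorem bialgebroidB_isCoring :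
    (bialgebroidB h).bimod.IsCoring (bialgebroidB h).comul (bialgebroidB h).counit where
  comul_l := bialgebroidB_comul_l h
  comul_ρ := bialgebroidB_comul_ρ h
  counit_l := bialgebroidB_counit_l h
  counit_ρ := bialgebroidB_counit_ρ h
  coassoc := bialgebroidB_coassoc h
  counit_comul b := StepB.ext (by
    have : StepB.val.comp ((bialgebroidB h).bimod.counitLeft _ (bialgebroidB_counit_ρ h)) =
        TensorCube.mulFst.comp (toCube h) :=
      BalTensor.hom_ext fun x y => (TensorCube.evalFst_join 1 y.val x.val).symm
    refine (DFunLike.congr_fun this ((bialgebroidB h).comul b)).trans ?_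
    rw [AddMonoidHom.comp_apply, toCube_comul]
    refine (TensorCube.evalFst_insertOne 1 b.val).trans ?_
    exact DFunLike.congr_fun (show mapFst ι (1 : StepA ι) = AddMonoidHom.id _ from
      BalTensor.hom_ext fun _ _ => rfl) b.val)
  comul_counit b := StepB.ext (by
    have : StepB.val.comp ((bialgebroidB h).bimod.counitRight _ (bialgebroidB_counit_l h)) =
        TensorCube.mulSnd.comp (toCube h) :=
      BalTensor.hom_ext fun x y => (TensorCube.mulSnd_join y.val x.val).symm
    refine (DFunLike.congr_fun this ((bialgebroidB h).comul b)).trans ?_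
    rw [AddMonoidHom.comp_apply, toCube_comul, TensorCube.mulSnd_insertOne])

/-- The elements `s(r) ⊗ 1` and `1 ⊗ t(r)` of `B ⊗_R B` have the same image `1 ⊗ r ⊗ 1` in the cube,
so they act alike on every `u ⊗ 1 ⊗ v`. -/
theorem bialgebroidB_takeuchi (b : StepB ι) (r : centralizerRing ι) :
    (bialgebroidB h).mulT ((bialgebroidB h).s r) 1 ((bialgebroidB h).comul b) =
      (bialgebroidB h).mulT 1 ((bialgebroidB h).t (op r)) ((bialgebroidB h).comul b) := by
  apply toCube_injective h
  rw [toCube_mulT, toCube_mulT, toCube_comul]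
  have : (TensorCube.mulT ((bialgebroidB h).s r) 1).comp (insertOne ι) =
      (TensorCube.mulT 1 ((bialgebroidB h).t (op r))).comp (insertOne ι) :=
    BalTensor.hom_ext fun u v => by
      refine (TensorCube.mulT_insertOne_tmul ((bialgebroidB h).s r) 1 u v).trans
        (Eq.trans ?_ (TensorCube.mulT_insertOne_tmul 1 ((bialgebroidB h).t (op r)) u v).symm)
      congr 1
      change TensorCube.tmul ι 1 (tmul ι ((r : M) * 1) (1 * 1)) =
        TensorCube.tmul ι 1 (tmul ι (1 * (r : M)) (1 * 1))
      simp only [mul_one, one_mul]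
  exact DFunLike.congr_fun this b.val

/-- Multiplicativity of `Δ_B` in the cube. Acting with `Δ_B(a)` on `u ⊗ 1 ⊗ v` gives `u a¹ ⊗ 1 ⊗ a²
v`, because `Δ_B(a)` itself has image `a¹ ⊗ 1 ⊗ a²`. -/
theorem LeftQuasibasis.sum_mulT_insertOne (q : LeftQuasibasis ι) (a : StepB ι)
    (z : TensorSq ι) :
    ∑ i, TensorCube.mulT (q.b i) (mapFstB ι (q.β i) a) (insertOne ι z) =
      insertOne ι (StepB.leftMul a z) := by
  induction z using BalTensor.induction_on with
  | zero => simp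
  | tmul u v =>
    rw [StepB.leftMul_tmul, TensorCube.insertOne_act, ← q.sum_join a.val, map_sum]
    exact Finset.sum_congr rfl fun i _ => TensorCube.mulT_insertOne_tmul _ _ u v
  | add a b ha hb => simp only [map_add, Finset.sum_add_distrib, ha, hb]

theorem bialgebroidB_isRightBialgebroid : (bialgebroidB h).IsRightBialgebroid where
  coring := bialgebroidB_isCoring h
  takeuchi := bialgebroidB_takeuchi h
  comul_mul a b := by
    apply toCube_injective h
    rw [toCube_comul]
    obtain ⟨q, hq⟩ := exists_bialgebroidB_comul h
    rw [hq a, map_sum, map_sum]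
    refine (q.sum_mulT_insertOne a b.val).symm.trans (Finset.sum_congr rfl fun i _ => ?_)
    rw [← toCube_comul h b, ← toCube_mulT]
    rfl
  comul_one := by
    apply toCube_injective h
    rw [toCube_comul]
    change TensorCube.tmul ι 1 (tmul ι 1 1) = TensorCube.tmul ι 1 (tmul ι (1 * 1) (1 * 1))
    rw [mul_one]
  counit_one := Subtype.ext (mul_one (1 : M))
  counit_t a b := Subtype.ext (by
    -- Both products multiply out to `b¹ a¹ a² b²`; the same holds for the source version below.
    have : (StepB.mulMap ι).comp
        (StepB.leftMul ((bialgebroidB h).t (op ((bialgebroidB h).counit a)))) =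
        (StepB.mulMap ι).comp (StepB.leftMul a) :=
      BalTensor.hom_ext fun u v => by
        change u * StepB.mulMap ι a.val * (1 * v) = StepB.mulMap ι (act ι u v a.val)
        rw [StepB.mulMap_act, one_mul]
    exact DFunLike.congr_fun this b.val)
  counit_s a b := Subtype.ext (by
    have : (StepB.mulMap ι).comp
        (StepB.leftMul ((bialgebroidB h).s ((bialgebroidB h).counit a))) =
        (StepB.mulMap ι).comp (StepB.leftMul a) :=
      BalTensor.hom_ext fun u v => by
        change u * 1 * (StepB.mulMap ι a.val * v) = StepB.mulMap ι (act ι u v a.val)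
        rw [StepB.mulMap_act, mul_one, mul_assoc]
    exact DFunLike.congr_fun this b.val)

end

/-! ### Transport of structure -/

namespace IsRightBialgebroidIso

variable {R B C : Type*} [Ring R] [Ring B] [Ring C] {ℬ : RightBialgebroidData R B}
  {𝒞 : RightBialgebroidData R C} {e : B ≃+* C} (he : IsRightBialgebroidIso ℬ 𝒞 e)

theorem map_l (he : IsRightBialgebroidIso ℬ 𝒞 e) (r : R) (x : B) :
    e (ℬ.bimod.l r x) = 𝒞.bimod.l r (e x) := by
  simp [he.map_t]

theorem map_ρ (he : IsRightBialgebroidIso ℬ 𝒞 e) (r : R) (x : B) :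
    e (ℬ.bimod.ρ r x) = 𝒞.bimod.ρ r (e x) := by
  simp [he.map_s]

/-- The map `e ⊗ e`. -/
def mapTwo : ℬ.bimod.T2 →+ 𝒞.bimod.T2 :=
  ℬ.bimod.map2 𝒞.bimod (e : B →+ C) he.map_l he.map_ρ

@[simp] theorem mapTwo_tmul (x y : B) :
    he.mapTwo (ℬ.bimod.tmul x y) = 𝒞.bimod.tmul (e x) (e y) := rfl

theorem comul_apply (b : B) : 𝒞.comul (e b) = he.mapTwo (ℬ.comul b) := he.map_comul b

theorem mapTwo_l2 (r : R) (T : ℬ.bimod.T2) :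
    he.mapTwo (ℬ.bimod.l2 r T) = 𝒞.bimod.l2 r (he.mapTwo T) := by
  have : he.mapTwo.comp (ℬ.bimod.l2 r) = (𝒞.bimod.l2 r).comp he.mapTwo :=
    BalTensor.hom_ext fun x y => by
      change 𝒞.bimod.tmul (e (ℬ.bimod.l r x)) (e y) = 𝒞.bimod.tmul (𝒞.bimod.l r (e x)) (e y)
      rw [he.map_l]
  exact DFunLike.congr_fun this T

theorem mapTwo_ρ2 (r : R) (T : ℬ.bimod.T2) :
    he.mapTwo (ℬ.bimod.ρ2 r T) = 𝒞.bimod.ρ2 r (he.mapTwo T) := by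
  have : he.mapTwo.comp (ℬ.bimod.ρ2 r) = (𝒞.bimod.ρ2 r).comp he.mapTwo :=
    BalTensor.hom_ext fun x y => by
      change 𝒞.bimod.tmul (e x) (e (ℬ.bimod.ρ r y)) = 𝒞.bimod.tmul (e x) (𝒞.bimod.ρ r (e y))
      rw [he.map_ρ]
  exact DFunLike.congr_fun this T

theorem mapTwo_mulT (x y : B) (T : ℬ.bimod.T2) :
    he.mapTwo (ℬ.mulT x y T) = 𝒞.mulT (e x) (e y) (he.mapTwo T) := by
  have : he.mapTwo.comp (ℬ.mulT x y) = (𝒞.mulT (e x) (e y)).comp he.mapTwo :=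
    BalTensor.hom_ext fun b b' => by
      change 𝒞.bimod.tmul (e (x * b)) (e (y * b')) = 𝒞.bimod.tmul (e x * e b) (e y * e b')
      rw [map_mul, map_mul]
  exact DFunLike.congr_fun this T

/-- The map `e ⊗ e ⊗ e`. -/
def mapThree : ℬ.bimod.T3 →+ 𝒞.bimod.T3 :=
  BalTensor.lift (fun x T => BalTensor.mk _ _ (e x) (he.mapTwo T))
    (fun x x' T => by rw [map_add, BalTensor.mk_add_left])
    (fun x T T' => by rw [map_add, BalTensor.mk_add_right])
    (fun x r T => by
      rw [he.map_ρ, mapTwo_l2]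
      exact BalTensor.mk_bal _ _ (e x) r _)

theorem mapThree_appendR (y : B) (T : ℬ.bimod.T2) :
    he.mapThree (ℬ.bimod.appendR y T) = 𝒞.bimod.appendR (e y) (he.mapTwo T) := by
  have : he.mapThree.comp (ℬ.bimod.appendR y) = (𝒞.bimod.appendR (e y)).comp he.mapTwo :=
    BalTensor.hom_ext fun _ _ => rfl
  exact DFunLike.congr_fun this T

/-- A right bialgebroid structure is transported along an isomorphism. -/
theorem isRightBialgebroid (he : IsRightBialgebroidIso ℬ 𝒞 e) (hB : ℬ.IsRightBialgebroid) : 𝒞.IsRightBialgebroid := by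
  -- Bilinearity and the Takeuchi condition come first because the maps appearing in the other
  -- axioms are only defined once they hold. Every argument is written as `e` of something, which
  -- turns each axiom into the image of the one for `ℬ`.
  have comul_l : ∀ r x, 𝒞.comul (𝒞.bimod.l r x) = 𝒞.bimod.l2 r (𝒞.comul x) := by
    intro r x
    obtain ⟨x, rfl⟩ := e.surjective x
    rw [← he.map_l, he.comul_apply, he.comul_apply, hB.coring.comul_l, mapTwo_l2]
  have comul_ρ : ∀ r x, 𝒞.comul (𝒞.bimod.ρ r x) = 𝒞.bimod.ρ2 r (𝒞.comul x) := by
    intro r x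
    obtain ⟨x, rfl⟩ := e.surjective x
    rw [← he.map_ρ, he.comul_apply, he.comul_apply, hB.coring.comul_ρ, mapTwo_ρ2]
  have counit_l : ∀ r x, 𝒞.counit (𝒞.bimod.l r x) = r * 𝒞.counit x := by
    intro r x
    obtain ⟨x, rfl⟩ := e.surjective x
    rw [← he.map_l, he.map_counit, he.map_counit, hB.coring.counit_l]
  have counit_ρ : ∀ r x, 𝒞.counit (𝒞.bimod.ρ r x) = 𝒞.counit x * r := by
    intro r x
    obtain ⟨x, rfl⟩ := e.surjective x
    rw [← he.map_ρ, he.map_counit, he.map_counit, hB.coring.counit_ρ]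
  have takeuchi : ∀ b r, 𝒞.mulT (𝒞.s r) 1 (𝒞.comul b) =
      𝒞.mulT 1 (𝒞.t (op r)) (𝒞.comul b) := by
    intro b r
    obtain ⟨b, rfl⟩ := e.surjective b
    rw [he.comul_apply, ← he.map_s, ← he.map_t, ← map_one e, ← mapTwo_mulT, hB.takeuchi,
      mapTwo_mulT]
  refine ⟨⟨comul_l, comul_ρ, counit_l, counit_ρ, ?_, ?_, ?_⟩, takeuchi, ?_, ?_, ?_, ?_, ?_⟩
  · intro x
    obtain ⟨x, rfl⟩ := e.surjective x
    have hl : (𝒞.bimod.comulLeft 𝒞.comul comul_ρ).comp he.mapTwo =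
        he.mapThree.comp (ℬ.bimod.comulLeft ℬ.comul hB.coring.comul_ρ) :=
      BalTensor.hom_ext fun u v => by
        change 𝒞.bimod.appendR (e v) (𝒞.comul (e u)) =
          he.mapThree (ℬ.bimod.appendR v (ℬ.comul u))
        rw [mapThree_appendR, he.comul_apply]
    have hr : (𝒞.bimod.comulRight 𝒞.comul comul_l).comp he.mapTwo =
        he.mapThree.comp (ℬ.bimod.comulRight ℬ.comul hB.coring.comul_l) :=
      BalTensor.hom_ext fun u v =>
        congrArg (BalTensor.mk _ 𝒞.bimod.l2 (e u)) (he.comul_apply v)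
    rw [he.comul_apply]
    exact (DFunLike.congr_fun hl (ℬ.comul x)).trans ((congrArg he.mapThree
      (hB.coring.coassoc x)).trans (DFunLike.congr_fun hr (ℬ.comul x)).symm)
  · intro x
    obtain ⟨x, rfl⟩ := e.surjective x
    have hc : (𝒞.bimod.counitLeft 𝒞.counit counit_ρ).comp he.mapTwo =
        (e : B →+ C).comp (ℬ.bimod.counitLeft ℬ.counit hB.coring.counit_ρ) :=
      BalTensor.hom_ext fun u v => by
        change 𝒞.bimod.l (𝒞.counit (e u)) (e v) = e (ℬ.bimod.l (ℬ.counit u) v)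
        rw [he.map_l, he.map_counit]
    rw [he.comul_apply]
    exact (DFunLike.congr_fun hc (ℬ.comul x)).trans (congrArg e (hB.coring.counit_comul x))
  · intro x
    obtain ⟨x, rfl⟩ := e.surjective x
    have hc : (𝒞.bimod.counitRight 𝒞.counit counit_l).comp he.mapTwo =
        (e : B →+ C).comp (ℬ.bimod.counitRight ℬ.counit hB.coring.counit_l) :=
      BalTensor.hom_ext fun u v => by
        change 𝒞.bimod.ρ (𝒞.counit (e v)) (e u) = e (ℬ.bimod.ρ (ℬ.counit v) u)
        rw [he.map_ρ, he.map_counit]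
    rw [he.comul_apply]
    exact (DFunLike.congr_fun hc (ℬ.comul x)).trans (congrArg e (hB.coring.comul_counit x))
  · intro a b
    obtain ⟨a, rfl⟩ := e.surjective a
    obtain ⟨b, rfl⟩ := e.surjective b
    have hc : (𝒞.takeuchiMul (𝒞.comul (e b)) (takeuchi (e b))).comp he.mapTwo =
        he.mapTwo.comp (ℬ.takeuchiMul (ℬ.comul b) (hB.takeuchi b)) :=
      BalTensor.hom_ext fun u v => by
        change 𝒞.mulT (e u) (e v) (𝒞.comul (e b)) = he.mapTwo (ℬ.mulT u v (ℬ.comul b))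
        rw [mapTwo_mulT, he.comul_apply]
    rw [← map_mul, he.comul_apply, hB.comul_mul, he.comul_apply a]
    exact (DFunLike.congr_fun hc (ℬ.comul a)).symm
  · rw [← map_one e, he.comul_apply, hB.comul_one, mapTwo_tmul]
  · rw [← map_one e, he.map_counit, hB.counit_one]
  · intro a b
    obtain ⟨a, rfl⟩ := e.surjective a
    obtain ⟨b, rfl⟩ := e.surjective b
    rw [he.map_counit, ← he.map_t, ← map_mul, ← map_mul, he.map_counit, he.map_counit,
      hB.counit_t]
  · intro a b
    obtain ⟨a, rfl⟩ := e.surjective a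
    obtain ⟨b, rfl⟩ := e.surjective b
    rw [he.map_counit, ← he.map_s, ← map_mul, ← map_mul, he.map_counit, he.map_counit,
      hB.counit_s]

end IsRightBialgebroidIso

/-! ### Duals of a left bialgebroid with dual bases -/

namespace LeftBialgebroid

variable {R A : Type*} [Ring R] [Ring A] (𝒜 : LeftBialgebroid R A)

/-- The coordinate map `x ↦ (⟨b_i, x⟩)` is a section of the map from the free module that sends the
standard basis to the `a_i`, so `A_R` is a retract of a finite free module. -/
theorem rightFGP_of_dualBasis (d : RightDual.DualBasis 𝒜) : 𝒜.RightFGP := by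
  let f : (Fin d.n → Rᵐᵒᵖ) →ₗ[Rᵐᵒᵖ] 𝒜.RightMod :=
    Fintype.linearCombination Rᵐᵒᵖ (fun i => (show 𝒜.RightMod from d.a i))
  let g : 𝒜.RightMod →ₗ[Rᵐᵒᵖ] (Fin d.n → Rᵐᵒᵖ) :=
    { toFun := fun x i => op ((d.b i).ev x)
      map_add' := fun x y => funext fun i => congrArg op (map_add (d.b i).ev x y)
      map_smul' := fun r x => funext fun i =>
        congrArg op ((d.b i).ev_t (unop r) x) }
  have hfg : f.comp g = LinearMap.id := LinearMap.ext fun x => d.sum_eq x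
  exact ⟨Module.Finite.of_surjective f fun x => ⟨g x, DFunLike.congr_fun hfg x⟩,
    Module.Projective.of_split g f hfg⟩

theorem leftFGP_of_dualBasis (d : LeftDual.DualBasis 𝒜) : 𝒜.LeftFGP := by
  let f : (Fin d.n → R) →ₗ[R] 𝒜.LeftMod :=
    Fintype.linearCombination R (fun i => (show 𝒜.LeftMod from d.a i))
  let g : 𝒜.LeftMod →ₗ[R] (Fin d.n → R) :=
    { toFun := fun x i => (d.b i).ev x
      map_add' := fun x y => funext fun i => map_add (d.b i).ev x y
      map_smul' := fun r x => funext fun i => (d.b i).ev_s r x }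
  have hfg : f.comp g = LinearMap.id := LinearMap.ext fun x => d.sum_eq x
  exact ⟨Module.Finite.of_surjective f fun x => ⟨g x, DFunLike.congr_fun hfg x⟩,
    Module.Projective.of_split g f hfg⟩

variable {𝒜}

theorem RightDual.ev_sum {κ : Type*} (s : Finset κ) (f : κ → 𝒜.RightDual) (a : A) :
    (∑ i ∈ s, f i).ev a = ∑ i ∈ s, (f i).ev a :=
  map_sum (AddMonoidHom.mk' (fun b : 𝒜.RightDual => b.ev a) fun _ _ => rfl) f s

theorem LeftDual.ev_sum {κ : Type*} (s : Finset κ) (f : κ → 𝒜.LeftDual) (a : A) :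
    (∑ i ∈ s, f i).ev a = ∑ i ∈ s, (f i).ev a :=
  map_sum (AddMonoidHom.mk' (fun b : 𝒜.LeftDual => b.ev a) fun _ _ => rfl) f s

/-- The dual basis read the other way: evaluating `x` on `a = ∑ a_i · ⟨b_i, a⟩` gives `∑ ⟨x, a_i⟩
⟨b_i, a⟩`. So the `b_i`, with evaluation at the `a_i`, expand elements of the left `R`-module `A*`.
-/
theorem RightDual.DualBasis.sum_l (d : RightDual.DualBasis 𝒜) (h : 𝒜.RightFGP)
    (x : 𝒜.RightDual) : ∑ i, (𝒜.rightDual h).bimod.l (x.ev (d.a i)) (d.b i) = x := by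
  refine RightDual.ext fun a => ?_
  rw [RightDual.ev_sum]
  conv_rhs => rw [← d.sum_eq a, map_sum]
  refine Finset.sum_congr rfl fun i _ => ?_
  rw [RightDual.ev_t]
  exact RightDual.ev_mul_tElt _ _ _

theorem LeftDual.DualBasis.sum_ρ (d : LeftDual.DualBasis 𝒜) (h : 𝒜.LeftFGP)
    (x : 𝒜.LeftDual) : ∑ i, (𝒜.leftDual h).bimod.ρ (x.ev (d.a i)) (d.b i) = x := by
  refine LeftDual.ext fun a => ?_
  rw [LeftDual.ev_sum]
  conv_rhs => rw [← d.sum_eq a, map_sum]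
  refine Finset.sum_congr rfl fun i _ => ?_
  rw [LeftDual.ev_s]
  exact LeftDual.ev_mul_sElt _ _ _

/-- For `T = x ⊗ y`, expand `y = ∑ ⟨y, a_j⟩ · b_j`, move the coefficient to `x`, and expand `x · ⟨y,
a_j⟩` in the `b_i`. The resulting coefficients are the pairings of `T` with `a_i`, `a_j`. -/
theorem RightDual.DualBasis.sum_pairing (d : RightDual.DualBasis 𝒜) (h : 𝒜.RightFGP)
    (T : (𝒜.rightDual h).bimod.T2) :
    ∑ j, ∑ i, (𝒜.rightDual h).bimod.tmul ((𝒜.rightDual h).bimod.l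
      (𝒜.rightDualPairing h (d.a i) (d.a j) T) (d.b i)) (d.b j) = T := by
  induction T using BalTensor.induction_on with
  | zero =>
    refine Finset.sum_eq_zero fun j _ => Finset.sum_eq_zero fun i _ => ?_
    rw [map_zero, map_zero]
    exact BalTensor.mk_zero_left _ _ _
  | tmul x y =>
    have h1 : ∀ j, ∑ i, (𝒜.rightDual h).bimod.tmul ((𝒜.rightDual h).bimod.l
        (((𝒜.rightDual h).bimod.ρ (y.ev (d.a j)) x).ev (d.a i)) (d.b i)) (d.b j) =
        (𝒜.rightDual h).bimod.tmul x ((𝒜.rightDual h).bimod.l (y.ev (d.a j)) (d.b j)) := by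
      intro j
      rw [← Bimod.tmul_bal]
      conv_rhs => rw [← d.sum_l h ((𝒜.rightDual h).bimod.ρ (y.ev (d.a j)) x)]
      exact (BalTensor.mk_sum_left _ _ _ _ _).symm
    refine (Finset.sum_congr rfl fun j _ => h1 j).trans ?_
    refine (BalTensor.mk_sum_right _ _ _ _ _).symm.trans ?_
    rw [d.sum_l h y]
  | add a b ha hb =>
    conv_rhs => rw [← ha, ← hb, ← Finset.sum_add_distrib]
    refine Finset.sum_congr rfl fun j _ => ?_
    rw [← Finset.sum_add_distrib]
    refine Finset.sum_congr rfl fun i _ => ?_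
    rw [map_add, Bimod.l_add, Bimod.tmul_add_left]

/-- The first factor is expanded here: its coefficient `[a_i, x]` passes to `y`, and `[a_i, x] · y`
is then expanded in the `b_j`. -/
theorem LeftDual.DualBasis.sum_pairing (d : LeftDual.DualBasis 𝒜) (h : 𝒜.LeftFGP)
    (T : (𝒜.leftDual h).bimod.T2) :
    ∑ i, ∑ j, (𝒜.leftDual h).bimod.tmul (d.b i) ((𝒜.leftDual h).bimod.ρ
      (𝒜.leftDualPairing h (d.a j) (d.a i) T) (d.b j)) = T := by
  induction T using BalTensor.induction_on with
  | zero =>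
    refine Finset.sum_eq_zero fun j _ => Finset.sum_eq_zero fun i _ => ?_
    rw [map_zero, map_zero]
    exact BalTensor.mk_zero_right _ _ _
  | tmul x y =>
    have h1 : ∀ i, ∑ j, (𝒜.leftDual h).bimod.tmul (d.b i) ((𝒜.leftDual h).bimod.ρ
        (((𝒜.leftDual h).bimod.l (x.ev (d.a i)) y).ev (d.a j)) (d.b j)) =
        (𝒜.leftDual h).bimod.tmul ((𝒜.leftDual h).bimod.ρ (x.ev (d.a i)) (d.b i)) y := by
      intro i
      rw [Bimod.tmul_bal]
      conv_rhs => rw [← d.sum_ρ h ((𝒜.leftDual h).bimod.l (x.ev (d.a i)) y)]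
      exact (BalTensor.mk_sum_right _ _ _ _ _).symm
    refine (Finset.sum_congr rfl fun j _ => h1 j).trans ?_
    refine (BalTensor.mk_sum_left _ _ _ _ _).symm.trans ?_
    rw [d.sum_ρ h x]
  | add a b ha hb =>
    conv_rhs => rw [← ha, ← hb, ← Finset.sum_add_distrib]
    refine Finset.sum_congr rfl fun j _ => ?_
    rw [← Finset.sum_add_distrib]
    refine Finset.sum_congr rfl fun i _ => ?_
    rw [map_add, map_add, AddMonoidHom.add_apply, Bimod.tmul_add_right]

/-- Nondegeneracy of the pairing, so `rightDual_comul` determines the coproduct of `A*`, whatever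
dual bases were used to define it. -/
theorem ext_rightDualPairing (h : 𝒜.RightFGP) {T T' : (𝒜.rightDual h).bimod.T2}
    (hT : ∀ a a', 𝒜.rightDualPairing h a a' T = 𝒜.rightDualPairing h a a' T') : T = T' := by
  obtain ⟨d⟩ := RightDual.nonempty_dualBasis h
  rw [← d.sum_pairing h T, ← d.sum_pairing h T']
  simp only [hT]

theorem ext_leftDualPairing (h : 𝒜.LeftFGP) {T T' : (𝒜.leftDual h).bimod.T2}
    (hT : ∀ a a', 𝒜.leftDualPairing h a a' T = 𝒜.leftDualPairing h a a' T') : T = T' := by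
  obtain ⟨d⟩ := LeftDual.nonempty_dualBasis h
  rw [← d.sum_pairing h T, ← d.sum_pairing h T']
  simp only [hT]

end LeftBialgebroid

/-! ### The duals of `A` are isomorphic to `B` -/

section

variable {N M : Type*} [Ring N] [Ring M] {ι : N →+* M} (h : IsD2 ι)

/-- The left bialgebroid `A`. -/
abbrev leftBialgebroidA : LeftBialgebroid (centralizerRing ι) (StepA ι) :=
  ⟨bialgebroidA h, bialgebroidA_isLeftBialgebroid h⟩

theorem leftBialgebroidA_rightFGP : (leftBialgebroidA h).RightFGP := by
  obtain ⟨q⟩ := h.2.nonempty_quasibasis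
  exact LeftBialgebroid.rightFGP_of_dualBasis _ ⟨q.n, q.γ, fun i =>
    LeftBialgebroid.RightDual.ofHom (pairRB (q.c i)) (pairRB_t_mul (q.c i)), q.sum_pairRB⟩

theorem leftBialgebroidA_leftFGP : (leftBialgebroidA h).LeftFGP := by
  obtain ⟨q⟩ := h.1.nonempty_quasibasis
  exact LeftBialgebroid.leftFGP_of_dualBasis _ ⟨q.n, q.β, fun i =>
    LeftBialgebroid.LeftDual.ofHom (pairLB (q.b i)) (pairLB_s_mul (q.b i)), q.sum_pairLB⟩

/-! #### The right dual -/

/-- The map `η(b)(α) = b¹ α(b²)`. -/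
def etaFun (b : StepB ι) : (leftBialgebroidA h).RightDual :=
  LeftBialgebroid.RightDual.ofHom (pairRB b) (pairRB_t_mul b)

theorem coe_ev_etaFun (b : StepB ι) (α : StepA ι) :
    ((etaFun h b).ev α : M) = pairR ι α b.val := rfl

theorem contract_etaFun (b : StepB ι) (T : (bialgebroidA h).bimod.T2) (m : M) :
    StepA.ev ((etaFun h b).contract T) m = evalSq h m T b.val := by
  induction T using BalTensor.induction_on with
  | zero => simp; rfl
  | tmul α β => rfl
  | add S T hS hT => rw [map_add, StepA.ev_add, hS, hT, map_add]; rfl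

/-- The contraction `⟨b, α₁⟩ · α₂` is `m ↦ b¹ α(b² m)`. Pairing it with `b'` gives `b'¹ b¹ α(b²
b'²)`, the value of `η(b b')` at `α`. -/
theorem etaFun_mul (b b' : StepB ι) : etaFun h (b * b') = etaFun h b * etaFun h b' :=
  LeftBialgebroid.RightDual.ext fun α => Subtype.ext (by
    have : (pairR ι α).comp (StepB.leftMul b) =
        pairR ι ((etaFun h b).contract ((bialgebroidA h).comul α)) :=
      BalTensor.hom_ext fun u v => by
        change pairR ι α (act ι u v b.val) = u * StepA.ev _ v
        rw [contract_etaFun, evalSq_comul, pairR_act_left]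
    exact DFunLike.congr_fun this b'.val)

/-- The ring homomorphism `η : B → A*`. -/
def etaHom : StepB ι →+* (leftBialgebroidA h).RightDual where
  toFun := etaFun h
  map_one' := LeftBialgebroid.RightDual.ext fun α => Subtype.ext (one_mul (α.ev 1))
  map_mul' := etaFun_mul h
  map_zero' := LeftBialgebroid.RightDual.ext fun α => Subtype.ext (map_zero (pairR ι α))
  map_add' b b' := LeftBialgebroid.RightDual.ext fun α =>
    Subtype.ext (map_add (pairR ι α) b.val b'.val)

/-- Injectivity is the expansion `b = ∑ ⟨b, γ_i⟩ · c_i`; surjectivity is the expansion `α = ∑ γ_i ·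
⟨c_i, α⟩`. -/
theorem etaHom_bijective : Function.Bijective (etaHom h) := by
  obtain ⟨q⟩ := h.2.nonempty_quasibasis
  constructor
  · intro b b' hb
    have hb' : ∀ α, pairR ι α b.val = pairR ι α b'.val := fun α =>
      congrArg (fun f => ((LeftBialgebroid.RightDual.ev f α : centralizerRing ι) : M)) hb
    apply StepB.ext
    rw [← q.sum_act_pairR b.val, ← q.sum_act_pairR b'.val]
    simp only [hb']
  · intro f
    -- Right linearity of `f` gives `f(α) = ∑ f(γ_i) ⟨c_i, α⟩`, which forces this preimage.
    refine ⟨∑ i, (bialgebroidB h).bimod.l (f.ev (q.γ i)) (q.c i),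
      LeftBialgebroid.RightDual.ext fun α => Subtype.ext ?_⟩
    have h1 := congrArg f.ev (q.sum_pairRB α)
    rw [map_sum] at h1
    refine Eq.trans ?_ (congrArg Subtype.val h1)
    change pairR ι α (StepB.val (∑ i, (bialgebroidB h).bimod.l (f.ev (q.γ i)) (q.c i))) = _
    rw [map_sum, map_sum, AddSubmonoidClass.coe_finsetSum]
    refine Finset.sum_congr rfl fun i _ => ?_
    rw [bialgebroidB_val_l, pairR_act_left, act_one_one]
    exact (congrArg Subtype.val (f.ev_t (pairRB (q.c i) α) (q.γ i))).symm

/-- The ring isomorphism `η : B ≃ A*`. -/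
def etaEquiv : StepB ι ≃+* (leftBialgebroidA h).RightDual :=
  RingEquiv.ofBijective (etaHom h) (etaHom_bijective h)

/-- The map `u ⊗ w ↦ u α(w¹ β(w²))`. -/
def cubePairR (α β : StepA ι) : TensorCube ι →+ M :=
  BalTensor.lift (fun u w => u * α.ev (pairR ι β w))
    (fun u u' w => add_mul u u' _)
    (fun u w w' => by rw [map_add, map_add, mul_add])
    (fun u n w => by
      change u * ι n * α.ev (pairR ι β w) = u * α.ev (pairR ι β (act ι (ι n) 1 w))
      rw [pairR_act_left, act_one_one, StepA.ev_l, mul_assoc])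

/-- Both sides are `b¹ α(b² b'¹ β(b'²))`. The right side is the pairing of `η(b) ⊗ η(b')` with `(α,
β)`, so that pairing factors through the cube. -/
theorem cubePairR_join (α β : StepA ι) (b b' : StepB ι) :
    cubePairR α β (TensorCube.join b'.val b.val) =
      pairR ι (α * StepA.tHom ι (op (pairRB b' β))) b.val := by
  have : (cubePairR α β).comp (TensorCube.join b'.val) =
      pairR ι (α * StepA.tHom ι (op (pairRB b' β))) :=
    BalTensor.hom_ext fun u v => by
      change u * α.ev (pairR ι β (act ι v 1 b'.val)) = u * α.ev (v * pairR ι β b'.val)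
      rw [pairR_act_left, act_one_one]
  exact DFunLike.congr_fun this b.val

theorem cubePairR_insertOne (α β : StepA ι) (z : TensorSq ι) :
    cubePairR α β (TensorCube.insertOne ι z) = pairR ι (α * β) z := by
  have : (cubePairR α β).comp (TensorCube.insertOne ι) = pairR ι (α * β) :=
    BalTensor.hom_ext fun u v => by
      change u * α.ev (1 * β.ev v) = u * α.ev (β.ev v)
      rw [one_mul]
  exact DFunLike.congr_fun this z

/-- The coproducts are compared by pairing with `(α, β)`: in `A*` the result is `⟨η(b), αβ⟩`, and
from `B` it is the cube pairing of `b¹ ⊗ 1 ⊗ b²`, namely `b¹ α(β(b²))`. -/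
theorem etaEquiv_isIso (hr : (leftBialgebroidA h).RightFGP) :
    IsRightBialgebroidIso (bialgebroidB h) ((leftBialgebroidA h).rightDual hr)
      (etaEquiv h) := by
  have map_s : ∀ r, etaEquiv h ((bialgebroidB h).s r) =
      ((leftBialgebroidA h).rightDual hr).s r := fun r =>
    LeftBialgebroid.RightDual.ext fun α => Subtype.ext (by
      change 1 * α.ev (r : M) = α.ev (1 * (r : M))
      rw [one_mul, one_mul])
  have map_t : ∀ r, etaEquiv h ((bialgebroidB h).t r) =
      ((leftBialgebroidA h).rightDual hr).t r := fun r =>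
    LeftBialgebroid.RightDual.ext fun α => rfl
  refine ⟨map_s, map_t, fun b => Subtype.ext ?_, fun b => ?_⟩
  · exact DFunLike.congr_fun (show pairR ι (1 : StepA ι) = StepB.mulMap ι from
      BalTensor.hom_ext fun _ _ => rfl) b.val
  · refine LeftBialgebroid.ext_rightDualPairing hr fun α β => ?_
    rw [LeftBialgebroid.rightDual_comul]
    have key : ∀ T : (bialgebroidB h).bimod.T2,
        (((leftBialgebroidA h).rightDualPairing hr α β
          ((bialgebroidB h).bimod.map2 ((leftBialgebroidA h).rightDual hr).bimod
            (etaEquiv h : StepB ι →+ (leftBialgebroidA h).RightDual)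
            (fun r x => by simp [map_t]) (fun r x => by simp [map_s]) T) :
              centralizerRing ι) : M) =
        cubePairR α β (toCube h T) := by
      intro T
      induction T using BalTensor.induction_on with
      | zero => simp
      | tmul x y =>
        refine Eq.trans ?_ (cubePairR_join α β x y).symm
        exact congrArg Subtype.val
          (LeftBialgebroid.RightDual.ev_mul_sElt (etaFun h x) (pairRB y β) α)
      | add S T hS hT => rw [map_add, map_add, Subring.coe_add, hS, hT, map_add, map_add]
    refine Subtype.ext (Eq.trans ?_ (key ((bialgebroidB h).comul b)).symm)
    rw [toCube_comul, cubePairR_insertOne]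
    rfl

/-! #### The left dual -/

/-- The map `ψ(b)(α) = α(b¹) b²`. -/
def psiFun (b : StepB ι) : (leftBialgebroidA h).LeftDual :=
  LeftBialgebroid.LeftDual.ofHom (pairLB b) (pairLB_s_mul b)

theorem coe_ev_psiFun (b : StepB ι) (α : StepA ι) :
    ((psiFun h b).ev α : M) = pairL ι α b.val := rfl

/-- The map `α ⊗ β ↦ α(x) β(z¹) z²`. -/
def evalSqRight (x : M) : (bialgebroidA h).bimod.T2 →+ TensorSq ι →+ M :=
  BalTensor.lift (fun α β => (AddMonoidHom.mulLeft (α.ev x)).comp (pairL ι β))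
    (fun α α' β => BalTensor.hom_ext fun u v => add_mul (α.ev x) (α'.ev x) (β.ev u * v))
    (fun α β β' => BalTensor.hom_ext fun u v => by
      change α.ev x * ((β.ev u + β'.ev u) * v) = α.ev x * (β.ev u * v) + α.ev x * (β'.ev u * v)
      rw [add_mul, mul_add])
    (fun α r β => BalTensor.hom_ext fun u v => by
      change α.ev x * r * (β.ev u * v) = α.ev x * (r * β.ev u * v)
      simp only [mul_assoc])

theorem evalSqRight_apply_tmul (x : M) (T : (bialgebroidA h).bimod.T2) (u v : M) :
    evalSqRight h x T (tmul ι u v) = evalTwo h x u T * v := by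
  induction T using BalTensor.induction_on with
  | zero => simp
  | tmul α β => exact (mul_assoc (α.ev x) (β.ev u) v).symm
  | add S T hS hT => rw [map_add, map_add, AddMonoidHom.add_apply, hS, hT, add_mul]

theorem evalSqRight_comul (x : M) (α : StepA ι) (z : TensorSq ι) :
    evalSqRight h x ((bialgebroidA h).comul α) z = pairL ι α (act ι x 1 z) := by
  have : evalSqRight h x ((bialgebroidA h).comul α) = (pairL ι α).comp (act ι x 1) :=
    BalTensor.hom_ext fun u v => by
      rw [evalSqRight_apply_tmul, evalTwo_comul]
      change α.ev (x * u) * v = α.ev (x * u) * (v * 1)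
      rw [mul_one]
  exact DFunLike.congr_fun this z

theorem contract_psiFun (b : StepB ι) (T : (bialgebroidA h).bimod.T2) (m : M) :
    StepA.ev ((psiFun h b).contract T) m = evalSqRight h m T b.val := by
  induction T using BalTensor.induction_on with
  | zero => simp; rfl
  | tmul α β => rfl
  | add S T hS hT => rw [map_add, StepA.ev_add, hS, hT, map_add]; rfl

/-- The contraction `α₁ · [α₂, b]` is `m ↦ α(m b¹) b²`, and pairing it with `b'` gives `α(b'¹ b¹) b²
b'²`. -/
theorem psiFun_mul (b b' : StepB ι) : psiFun h (b * b') = psiFun h b * psiFun h b' :=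
  LeftBialgebroid.LeftDual.ext fun α => Subtype.ext (by
    have : (pairL ι α).comp (StepB.leftMul b) =
        pairL ι ((psiFun h b).contract ((bialgebroidA h).comul α)) :=
      BalTensor.hom_ext fun u v => by
        change pairL ι α (act ι u v b.val) = StepA.ev _ u * v
        rw [contract_psiFun, evalSqRight_comul, pairL_act_right]
    exact DFunLike.congr_fun this b'.val)

/-- The ring homomorphism `ψ : B → *A`. -/
def psiHom : StepB ι →+* (leftBialgebroidA h).LeftDual where
  toFun := psiFun h
  map_one' := LeftBialgebroid.LeftDual.ext fun α => Subtype.ext (mul_one (α.ev 1))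
  map_mul' := psiFun_mul h
  map_zero' := LeftBialgebroid.LeftDual.ext fun α => Subtype.ext (map_zero (pairL ι α))
  map_add' b b' := LeftBialgebroid.LeftDual.ext fun α =>
    Subtype.ext (map_add (pairL ι α) b.val b'.val)

theorem psiHom_bijective : Function.Bijective (psiHom h) := by
  obtain ⟨q⟩ := h.1.nonempty_quasibasis
  constructor
  · intro b b' hb
    have hb' : ∀ α, pairL ι α b.val = pairL ι α b'.val := fun α =>
      congrArg (fun f => ((LeftBialgebroid.LeftDual.ev f α : centralizerRing ι) : M)) hb
    apply StepB.ext
    rw [← q.sum_act_pairL b.val, ← q.sum_act_pairL b'.val]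
    simp only [hb']
  · intro f
    -- The preimage is dictated by `f(α) = ∑ [α, b_i] f(β_i)`.
    refine ⟨∑ i, (bialgebroidB h).bimod.ρ (f.ev (q.β i)) (q.b i),
      LeftBialgebroid.LeftDual.ext fun α => Subtype.ext ?_⟩
    have h1 := congrArg f.ev (q.sum_pairLB α)
    rw [map_sum] at h1
    refine Eq.trans ?_ (congrArg Subtype.val h1)
    change pairL ι α (StepB.val (∑ i, (bialgebroidB h).bimod.ρ (f.ev (q.β i)) (q.b i))) = _
    rw [map_sum, map_sum, AddSubmonoidClass.coe_finsetSum]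
    refine Finset.sum_congr rfl fun i _ => ?_
    rw [bialgebroidB_val_ρ, pairL_act_right, act_one_one]
    exact (congrArg Subtype.val (f.ev_s (pairLB (q.b i) α) (q.β i))).symm

/-- The ring isomorphism `ψ : B ≃ *A`. -/
def psiEquiv : StepB ι ≃+* (leftBialgebroidA h).LeftDual :=
  RingEquiv.ofBijective (psiHom h) (psiHom_bijective h)

theorem pairL_mul_s (α : StepA ι) (r : centralizerRing ι) (z : TensorSq ι) :
    pairL ι (α * StepA.sHom ι r) z = pairL ι α (act ι r 1 z) := by
  have : pairL ι (α * StepA.sHom ι r) = (pairL ι α).comp (act ι r 1) :=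
    BalTensor.hom_ext fun u v => by
      change α.ev (r * u) * v = α.ev (r * u) * (v * 1)
      rw [mul_one]
  exact DFunLike.congr_fun this z

theorem pairL_mapFst (α β : StepA ι) (z : TensorSq ι) :
    pairL ι α (mapFst ι β z) = pairL ι (α * β) z := by
  have : (pairL ι α).comp (mapFst ι β) = pairL ι (α * β) :=
    BalTensor.hom_ext fun _ _ => rfl
  exact DFunLike.congr_fun this z

/-- The pairing of `ψ(b) ⊗ ψ(b')` with `(α, β)` is `α(β(b¹) b² b'¹) b'²`. It factors through the
cube by applying `β` to the first entry, multiplying the first two entries, and then pairing with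
`α`. On `b¹ ⊗ 1 ⊗ b²` this gives `α(β(b¹)) b²`. -/
theorem psiEquiv_isIso (hl : (leftBialgebroidA h).LeftFGP) :
    IsRightBialgebroidIso (bialgebroidB h) ((leftBialgebroidA h).leftDual hl)
      (psiEquiv h) := by
  have map_s : ∀ r, psiEquiv h ((bialgebroidB h).s r) =
      ((leftBialgebroidA h).leftDual hl).s r := fun r =>
    LeftBialgebroid.LeftDual.ext fun α => rfl
  have map_t : ∀ r, psiEquiv h ((bialgebroidB h).t r) =
      ((leftBialgebroidA h).leftDual hl).t r := fun r =>
    LeftBialgebroid.LeftDual.ext fun α => Subtype.ext (by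
      change α.ev ((unop r : centralizerRing ι) : M) * 1 =
        α.ev (((unop r : centralizerRing ι) : M) * 1)
      rw [mul_one, mul_one])
  refine ⟨map_s, map_t, fun b => Subtype.ext ?_, fun b => ?_⟩
  · exact DFunLike.congr_fun (show pairL ι (1 : StepA ι) = StepB.mulMap ι from
      BalTensor.hom_ext fun _ _ => rfl) b.val
  · refine LeftBialgebroid.ext_leftDualPairing hl fun α β => ?_
    rw [LeftBialgebroid.leftDual_comul]
    have key : ∀ T : (bialgebroidB h).bimod.T2,
        (((leftBialgebroidA h).leftDualPairing hl α β
          ((bialgebroidB h).bimod.map2 ((leftBialgebroidA h).leftDual hl).bimod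
            (psiEquiv h : StepB ι →+ (leftBialgebroidA h).LeftDual)
            (fun r x => by simp [map_t]) (fun r x => by simp [map_s]) T) :
              centralizerRing ι) : M) =
        pairL ι α (TensorCube.evalFst β (toCube h T)) := by
      intro T
      induction T using BalTensor.induction_on with
      | zero => simp
      | tmul x y =>
        refine Eq.trans ?_ (congrArg (pairL ι α)
          (TensorCube.evalFst_join β y.val x.val)).symm
        refine (congrArg Subtype.val
          (LeftBialgebroid.LeftDual.ev_mul_tElt (psiFun h y) (pairLB x β) α)).trans ?_
        exact pairL_mul_s α (pairLB x β) y.val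
      | add S T hS hT =>
        rw [map_add, map_add, Subring.coe_add, hS, hT, map_add, map_add, map_add]
    refine Subtype.ext (Eq.trans ?_ (key ((bialgebroidB h).comul b)).symm)
    rw [toCube_comul, TensorCube.evalFst_insertOne, pairL_mapFst]
    rfl

end

end Bialgd

end

/-! ### The duality theorem -/

theorem mainTheorem5 {N M : Type*} [Ring N] [Ring M] (ι : N →+* M) (h : Bialgd.IsD2 ι) :
    ∃ (hA : (Bialgd.bialgebroidA h).IsLeftBialgebroid)
      (hB : (Bialgd.bialgebroidB h).IsRightBialgebroid),
      let 𝒜 : Bialgd.LeftBialgebroid (Bialgd.centralizerRing ι) (Bialgd.StepA ι) :=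
        ⟨Bialgd.bialgebroidA h, hA⟩
      let ℬ : Bialgd.RightBialgebroid (Bialgd.centralizerRing ι) (Bialgd.StepB ι) :=
        ⟨Bialgd.bialgebroidB h, hB⟩
      ∃ (hr : 𝒜.RightFGP) (hl : 𝒜.LeftFGP),
        (𝒜.rightDual hr).IsRightBialgebroid ∧ (𝒜.leftDual hl).IsRightBialgebroid ∧
        (∃ η : Bialgd.StepB ι ≃+* 𝒜.RightDual,
          Bialgd.IsRightBialgebroidIso ℬ.toRightBialgebroidData (𝒜.rightDual hr) η ∧
          ∀ (b : Bialgd.StepB ι) (α : Bialgd.StepA ι),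
            ((η b).ev α : M) = Bialgd.pairR ι α b.val) ∧
        (∃ ψ : Bialgd.StepB ι ≃+* 𝒜.LeftDual,
          Bialgd.IsRightBialgebroidIso ℬ.toRightBialgebroidData (𝒜.leftDual hl) ψ ∧
          ∀ (b : Bialgd.StepB ι) (α : Bialgd.StepA ι),
            ((ψ b).ev α : M) = Bialgd.pairL ι α b.val) ∧
        Bialgd.AreDual 𝒜 ℬ := by
  have hB := Bialgd.bialgebroidB_isRightBialgebroid h
  have hr := Bialgd.leftBialgebroidA_rightFGP h
  have hl := Bialgd.leftBialgebroidA_leftFGP h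
  have eη := Bialgd.etaEquiv_isIso h hr
  have eψ := Bialgd.psiEquiv_isIso h hl
  -- The compatibilities in `eη` and `eψ` were established with the duals carrying only bialgebroid
  -- data, so the axioms for the duals can now be inherited from `B`.
  have hr' := eη.isRightBialgebroid hB
  have hl' := eψ.isRightBialgebroid hB
  exact ⟨Bialgd.bialgebroidA_isLeftBialgebroid h, hB, hr, hl, hr', hl',
    ⟨Bialgd.etaEquiv h, eη, Bialgd.coe_ev_etaFun h⟩,
    ⟨Bialgd.psiEquiv h, eψ, Bialgd.coe_ev_psiFun h⟩,
    hr, hl, hr', hl', ⟨Bialgd.etaEquiv h, eη⟩, ⟨Bialgd.psiEquiv h, eψ⟩⟩
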